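/- Tree-Path-Problem. Let $T$ be a rooted tree with $q$ nodes, given by the array of the parents of its nodes in an arbitrary numbering $0,\dots,q-1$. For a node $v$ and an ancestor $u$ of $v$ (possibly $u=v$), let $P_{v,u}$ be the set of nodes on the path from $v$ up to $u$, excluding $u$. Let $\mathcal P$ be a finite family (repetitions allowed) of such paths, each represented by the pair $(v,u)$, and let each $P\in\mathcal P$ have a weight $w(P)\in\mathbb Z$ of size polynomial in the size of the instance: $|w(P)|\le (q+|\mathcal P|)^d$ for a constant $d$. For every node $v$ of $T$, compute $$W_{\max}(v)=\max\{w(P): P\in\mathcal P,\ v\in P\}\quad(\max\emptyset=-\infty)\qquad\text{and}\qquad W_+(v)=\sum_{P\in\mathcal P,\ v\in P} w(P).$$ The Tree-Path-Problem can be solved in $O(q+|\mathcal P|)$ time on a word RAM. That is, there is a single program for a unit-cost random access machine (indirect addressing; constants, $+$, $-$, $\cdot$, integer division and remainder, comparisons, branching and loops; memory initially $0$ outside the input) such that for every $d$ there are constants $C$ and $k$ with the following property: on every instance with $|w(P)|\le (q+|\mathcal P|)^d$ for all $P\in\mathcal P$, the program halts after at most $C\,(q+|\mathcal P|)$ steps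 with $W_{\max}(v)$ and $W_+(v)$ in its memory for all nodes $v$, and all integers and addresses that occur in the computation have absolute value at most $(q+|\mathcal P|+1)^k$ (so that they fit in words of $O(\log(q+|\mathcal P|+1))$ bits). -/

import Mathlib

/-!
# Word random access machine

Programs are written in a structured RAM language with unit-cost instructions. The memory
consists of integer arrays; array names are literals of the program, so that each program uses
only finitely many arrays (on a machine with one memory they are interleaved), while the indices
are computed, so that addressing is indirect. A scalar variable is a cell of an array at a
constant index. Words have limited size: with word bound `B`, a program is stuck as soon as it
computes, loads or stores an integer of absolute value larger than `B`, or uses an index of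
absolute value larger than `B`.
-/

namespace WordRAM

/-- The binary operations of the machine. The comparisons return `1` or `0`. -/
inductive BinOp where
  | add | sub | mul | div | mod | le | eq

/-- The value of an operation; `div` and `mod` are integer division and its remainder. -/
def BinOp.apply : BinOp → ℤ → ℤ → ℤ
  | .add, x, y => x + y
  | .sub, x, y => x - y
  | .mul, x, y => x * y
  | .div, x, y => x / y
  | .mod, x, y => x % y
  | .le, x, y => if x ≤ y then 1 else 0
  | .eq, x, y => if x = y then 1 else 0

/-- Expressions: constants, `load a e` (the content of array `a` at index `e`), operations. -/
inductive Expr where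
  | const (z : ℤ)
  | load (a : ℕ) (e : Expr)
  | op (o : BinOp) (e₁ e₂ : Expr)

/-- Commands: `store a e₁ e₂` writes the value of `e₂` into array `a` at index `e₁`; the tests of
`ite` and `while` succeed when the value of the expression is not `0`. -/
inductive Cmd where
  | skip
  | store (a : ℕ) (e₁ e₂ : Expr)
  | seq (c₁ c₂ : Cmd)
  | ite (e : Expr) (c₁ c₂ : Cmd)
  | while (e : Expr) (c : Cmd)

/-- A memory: `M a j` is the content of the cell of array `a` with index `j`. -/
abbrev Memory := ℕ → ℤ → ℤ

/-- Replace the content of the cell of array `a` with index `j` by `z`. -/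
def Memory.set (M : Memory) (a : ℕ) (j z : ℤ) : Memory :=
  fun a' j' => if a' = a ∧ j' = j then z else M a' j'

namespace Expr

/-- The value of an expression. -/
def val (M : Memory) : Expr → ℤ
  | const z => z
  | load a e => M a (e.val M)
  | op o e₁ e₂ => o.apply (e₁.val M) (e₂.val M)

/-- The number of steps of an evaluation: one for every constant, load and operation. -/
def cost : Expr → ℕ
  | const _ => 1
  | load _ e => e.cost + 1
  | op _ e₁ e₂ => e₁.cost + e₂.cost + 1

/-- All values that occur in the evaluation (and so all indices that are used) fit in a word,
and there is no division by zero. -/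
def Fits (B : ℕ) (M : Memory) : Expr → Prop
  | const z => |z| ≤ (B : ℤ)
  | load a e => e.Fits B M ∧ |M a (e.val M)| ≤ (B : ℤ)
  | op o e₁ e₂ => e₁.Fits B M ∧ e₂.Fits B M ∧
      (o = BinOp.div ∨ o = BinOp.mod → e₂.val M ≠ 0) ∧
      |o.apply (e₁.val M) (e₂.val M)| ≤ (B : ℤ)

end Expr

/-- `Exec B p M t M'`: with word bound `B`, the command `p`, started on memory `M`, halts after
exactly `t` steps with memory `M'`, and all integers that occur on the way fit in a word. -/
inductive Exec (B : ℕ) : Cmd → Memory → ℕ → Memory → Prop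
  | skip (M : Memory) : Exec B Cmd.skip M 1 M
  | store (a : ℕ) (e₁ e₂ : Expr) (M : Memory) (h₁ : e₁.Fits B M) (h₂ : e₂.Fits B M) :
      Exec B (Cmd.store a e₁ e₂) M (e₁.cost + e₂.cost + 1) (M.set a (e₁.val M) (e₂.val M))
  | seq (c₁ c₂ : Cmd) (M M₁ M₂ : Memory) (t₁ t₂ : ℕ)
      (h₁ : Exec B c₁ M t₁ M₁) (h₂ : Exec B c₂ M₁ t₂ M₂) :
      Exec B (Cmd.seq c₁ c₂) M (t₁ + t₂) M₂
  | ite_true (e : Expr) (c₁ c₂ : Cmd) (M M' : Memory) (t : ℕ)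
      (he : e.Fits B M) (hv : e.val M ≠ 0) (h : Exec B c₁ M t M') :
      Exec B (Cmd.ite e c₁ c₂) M (e.cost + 1 + t) M'
  | ite_false (e : Expr) (c₁ c₂ : Cmd) (M M' : Memory) (t : ℕ)
      (he : e.Fits B M) (hv : e.val M = 0) (h : Exec B c₂ M t M') :
      Exec B (Cmd.ite e c₁ c₂) M (e.cost + 1 + t) M'
  | while_true (e : Expr) (c : Cmd) (M M₁ M₂ : Memory) (t₁ t₂ : ℕ)
      (he : e.Fits B M) (hv : e.val M ≠ 0)
      (h₁ : Exec B c M t₁ M₁) (h₂ : Exec B (Cmd.while e c) M₁ t₂ M₂) :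
      Exec B (Cmd.while e c) M (e.cost + 1 + t₁ + t₂) M₂
  | while_false (e : Expr) (c : Cmd) (M : Memory) (he : e.Fits B M) (hv : e.val M = 0) :
      Exec B (Cmd.while e c) M (e.cost + 1) M

/-- The array that holds `f 0, …, f (n - 1)` at the indices `0, …, n - 1`, and `0` elsewhere. -/
def arrayOf {n : ℕ} (f : Fin n → ℤ) (j : ℤ) : ℤ :=
  if h : 0 ≤ j ∧ j.toNat < n then f ⟨j.toNat, h.2⟩ else 0

end WordRAM

/-- An instance of the Tree-Path-Problem: a rooted tree (in its ancestor order: the root is `⊥`,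
and `Order.pred v` is the parent of `v ≠ ⊥`) with `q` nodes in an arbitrary numbering, and a family
of `m` weighted paths, each given by a node `lower i` and its ancestor `upper i`. -/
structure TreePathInstance where
  T : RootedTree.{0}
  q : ℕ
  num : T ≃ Fin q
  m : ℕ
  lower : Fin m → T
  upper : Fin m → T
  upper_le_lower : ∀ i, upper i ≤ lower i
  w : Fin m → ℤ

namespace TreePathInstance

/-- The nodes of the `i`-th path: from `lower i` up to its ancestor `upper i`, excluding the node
`upper i`. -/
def path (I : TreePathInstance) (i : Fin I.m) : Set I.T :=
  {x | I.upper i < x ∧ x ≤ I.lower i}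

open scoped Classical in
/-- The maximum of the weights of the paths containing `v`; it is `⊥` (that is, `-∞`) if there
are none. -/
noncomputable def maxWeight (I : TreePathInstance) (v : I.T) : WithBot ℤ :=
  (Finset.univ.filter fun i => v ∈ I.path i).sup fun i => ((I.w i : ℤ) : WithBot ℤ)

open scoped Classical in
/-- The sum of the weights of the paths containing `v`. -/
noncomputable def sumWeight (I : TreePathInstance) (v : I.T) : ℤ :=
  ∑ i ∈ Finset.univ.filter (fun i => v ∈ I.path i), I.w i

/-- The initial memory. Array `0` holds `q, m`; array `1` holds the number of the parent of each
node (for the root: its own number); the arrays `2`, `3`, `4` hold the numbers of the two ends and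
the weight of each path. All other cells are `0`. -/
def input (I : TreePathInstance) : WordRAM.Memory
  | 0 => WordRAM.arrayOf ![(I.q : ℤ), (I.m : ℤ)]
  | 1 => WordRAM.arrayOf fun x => ((I.num (Order.pred (I.num.symm x)) : ℕ) : ℤ)
  | 2 => WordRAM.arrayOf fun i => ((I.num (I.lower i) : ℕ) : ℤ)
  | 3 => WordRAM.arrayOf fun i => ((I.num (I.upper i) : ℕ) : ℤ)
  | 4 => WordRAM.arrayOf I.w
  | _ => fun _ => 0

/-- The final memory `M` holds the solution: at the index of each node `v`, array `5` tells by a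
value `≠ 0` that some path contains `v`, in which case array `6` holds the maximum weight (a value
`0` in array `5` stands for the maximum `-∞`); array `7` holds the sum of the weights. -/
def IsSolution (I : TreePathInstance) (M : WordRAM.Memory) : Prop :=
  ∀ v : I.T,
    (if M 5 ((I.num v : ℕ) : ℤ) = 0 then (⊥ : WithBot ℤ)
      else ((M 6 ((I.num v : ℕ) : ℤ) : ℤ) : WithBot ℤ)) = I.maxWeight v ∧
    M 7 ((I.num v : ℕ) : ℤ) = I.sumWeight v

end TreePathInstance

/-!
# A verification calculus for the machine

`Cmd.VC B c Q M τ` says that `c`, started at time `τ` on the memory `M` (whose contents fit in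
words), halts on a memory and at a time that satisfy `Q`. It is computed from the program text,
except at loops, where `vc_while` and `vc_for` apply.
-/

namespace WordRAM

/-- All contents of the memory fit in a word. -/
def Memory.Bounded (B : ℕ) (M : Memory) : Prop := ∀ a j, |M a j| ≤ (B : ℤ)

namespace Expr

/-- A condition that, on a bounded memory and for `16 ≤ B`, implies `Fits`. -/
def Ok (B : ℕ) (M : Memory) : Expr → Prop
  | const z => |z| ≤ 16
  | load _ e => e.Ok B M
  | op .add e₁ e₂ => e₁.Ok B M ∧ e₂.Ok B M ∧
      -(B : ℤ) ≤ e₁.val M + e₂.val M ∧ e₁.val M + e₂.val M ≤ B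
  | op .sub e₁ e₂ => e₁.Ok B M ∧ e₂.Ok B M ∧
      -(B : ℤ) ≤ e₁.val M - e₂.val M ∧ e₁.val M - e₂.val M ≤ B
  | op .mul e₁ e₂ => e₁.Ok B M ∧ e₂.Ok B M ∧
      -(B : ℤ) ≤ e₁.val M * e₂.val M ∧ e₁.val M * e₂.val M ≤ B
  | op .div e₁ e₂ => e₁.Ok B M ∧ e₂.Ok B M ∧ e₂.val M ≠ 0
  | op .mod e₁ e₂ => e₁.Ok B M ∧ e₂.Ok B M ∧ e₂.val M ≠ 0
  | op .le e₁ e₂ => e₁.Ok B M ∧ e₂.Ok B M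
  | op .eq e₁ e₂ => e₁.Ok B M ∧ e₂.Ok B M

theorem Fits.abs_val_le {B : ℕ} {M : Memory} {e : Expr} (h : e.Fits B M) : |e.val M| ≤ B := by
  cases e with
  | const z => exact h
  | load a e => exact h.2
  | op o e₁ e₂ => exact h.2.2.2

theorem Ok.fits {B : ℕ} {M : Memory} (hB : 16 ≤ B) (hM : M.Bounded B) {e : Expr}
    (h : e.Ok B M) : e.Fits B M := by
  induction e with
  | const z =>
    have : |z| ≤ 16 := h
    show |z| ≤ (B : ℤ)
    omega
  | load a e ih => exact ⟨ih h, hM _ _⟩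
  | op o e₁ e₂ ih₁ ih₂ =>
    cases o with
    | add => exact ⟨ih₁ h.1, ih₂ h.2.1, by simp, abs_le.2 h.2.2⟩
    | sub => exact ⟨ih₁ h.1, ih₂ h.2.1, by simp, abs_le.2 h.2.2⟩
    | mul => exact ⟨ih₁ h.1, ih₂ h.2.1, by simp, abs_le.2 h.2.2⟩
    | div =>
      refine ⟨ih₁ h.1, ih₂ h.2.1, fun _ => h.2.2, ?_⟩
      have h1 := (ih₁ h.1).abs_val_le
      refine le_trans ?_ h1
      show |e₁.val M / e₂.val M| ≤ _
      rw [Int.abs_eq_natAbs, Int.abs_eq_natAbs]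
      exact_mod_cast Int.natAbs_ediv_le_natAbs _ _
    | mod =>
      refine ⟨ih₁ h.1, ih₂ h.2.1, fun _ => h.2.2, ?_⟩
      have h1 := (ih₂ h.2.1).abs_val_le
      have h2 := Int.emod_lt_abs (e₁.val M) h.2.2
      have h3 := Int.emod_nonneg (e₁.val M) h.2.2
      show |e₁.val M % e₂.val M| ≤ _
      rw [abs_of_nonneg h3]
      omega
    | le =>
      refine ⟨ih₁ h.1, ih₂ h.2, by simp, ?_⟩
      simp only [BinOp.apply]
      split_ifs
      · simp; omega
      · simp
    | eq =>
      refine ⟨ih₁ h.1, ih₂ h.2, by simp, ?_⟩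
      simp only [BinOp.apply]
      split_ifs
      · simp; omega
      · simp

end Expr

theorem Memory.Bounded.set {B : ℕ} {M : Memory} (hM : M.Bounded B) (a : ℕ) (j : ℤ) {z : ℤ}
    (hz : |z| ≤ B) : (M.set a j z).Bounded B := by
  intro a' j'
  unfold Memory.set
  split_ifs
  exacts [hz, hM _ _]

theorem Exec.bounded {B : ℕ} {c : Cmd} {M M' : Memory} {t : ℕ} (h : Exec B c M t M')
    (hM : M.Bounded B) : M'.Bounded B := by
  induction h with
  | skip => exact hM
  | store a e₁ e₂ M h₁ h₂ => exact hM.set _ _ h₂.abs_val_le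
  | seq c₁ c₂ M M₁ M₂ t₁ t₂ h₁ h₂ ih₁ ih₂ => exact ih₂ (ih₁ hM)
  | ite_true e c₁ c₂ M M' t he hv h ih => exact ih hM
  | ite_false e c₁ c₂ M M' t he hv h ih => exact ih hM
  | while_true e c M M₁ M₂ t₁ t₂ he hv h₁ h₂ ih₁ ih₂ => exact ih₂ (ih₁ hM)
  | while_false => exact hM

namespace Cmd

/-- The arrays to which a command may write. -/
def writes : Cmd → List ℕ
  | skip => []
  | store a _ _ => [a]
  | seq c₁ c₂ => c₁.writes ++ c₂.writes
  | ite _ c₁ c₂ => c₁.writes ++ c₂.writes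
  | .while _ c => c.writes

/-- The verification condition. -/
def VC (B : ℕ) : Cmd → (Memory → ℕ → Prop) → Memory → ℕ → Prop
  | skip, Q, M, τ => Q M (τ + 1)
  | store a e₁ e₂, Q, M, τ =>
      e₁.Ok B M ∧ e₂.Ok B M ∧ Q (M.set a (e₁.val M) (e₂.val M)) (τ + (e₁.cost + e₂.cost + 1))
  | seq c₁ c₂, Q, M, τ => c₁.VC B (c₂.VC B Q) M τ
  | ite e c₁ c₂, Q, M, τ => e.Ok B M ∧ (e.val M ≠ 0 → c₁.VC B Q M (τ + (e.cost + 1))) ∧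
      (e.val M = 0 → c₂.VC B Q M (τ + (e.cost + 1)))
  | .while e c, Q, M, τ =>
      M.Bounded B → ∃ t M', Exec B (.while e c) M t M' ∧ Q M' (τ + t)

end Cmd

theorem Exec.frame {B : ℕ} {c : Cmd} {M M' : Memory} {t : ℕ} (h : Exec B c M t M')
    {a : ℕ} (ha : a ∉ c.writes) : M' a = M a := by
  induction h with
  | skip => rfl
  | store b e₁ e₂ M h₁ h₂ =>
    funext j
    simp only [Cmd.writes, List.mem_singleton] at ha
    simp [Memory.set, ha]
  | seq c₁ c₂ M M₁ M₂ t₁ t₂ h₁ h₂ ih₁ ih₂ =>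
    simp only [Cmd.writes, List.mem_append, not_or] at ha
    rw [ih₂ ha.2, ih₁ ha.1]
  | ite_true e c₁ c₂ M M' t he hv h ih =>
    simp only [Cmd.writes, List.mem_append, not_or] at ha
    exact ih ha.1
  | ite_false e c₁ c₂ M M' t he hv h ih =>
    simp only [Cmd.writes, List.mem_append, not_or] at ha
    exact ih ha.2
  | while_true e c M M₁ M₂ t₁ t₂ he hv h₁ h₂ ih₁ ih₂ => rw [ih₂ ha, ih₁ ha]
  | while_false => rfl

theorem Cmd.VC.exec {B : ℕ} (hB : 16 ≤ B) {c : Cmd} {Q : Memory → ℕ → Prop} {M : Memory} {τ : ℕ}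
    (h : c.VC B Q M τ) (hM : M.Bounded B) : ∃ t M', Exec B c M t M' ∧ Q M' (τ + t) := by
  induction c generalizing Q M τ with
  | skip => exact ⟨_, _, .skip M, h⟩
  | store a e₁ e₂ => exact ⟨_, _, .store a e₁ e₂ M (h.1.fits hB hM) (h.2.1.fits hB hM), h.2.2⟩
  | seq c₁ c₂ ih₁ ih₂ =>
    obtain ⟨t₁, M₁, e₁, h₁⟩ := ih₁ h hM
    obtain ⟨t₂, M₂, e₂, h₂⟩ := ih₂ h₁ (e₁.bounded hM)
    exact ⟨_, _, .seq _ _ _ _ _ _ _ e₁ e₂, by rwa [← Nat.add_assoc]⟩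
  | ite e c₁ c₂ ih₁ ih₂ =>
    by_cases hv : e.val M = 0
    · obtain ⟨t, M', e', h'⟩ := ih₂ (h.2.2 hv) hM
      exact ⟨_, _, .ite_false _ _ _ _ _ _ (h.1.fits hB hM) hv e', by rwa [← Nat.add_assoc]⟩
    · obtain ⟨t, M', e', h'⟩ := ih₁ (h.2.1 hv) hM
      exact ⟨_, _, .ite_true _ _ _ _ _ _ (h.1.fits hB hM) hv e', by rwa [← Nat.add_assoc]⟩
  | _ e c ih => exact h hM

theorem vc_mono {B : ℕ} {c : Cmd} {Q Q' : Memory → ℕ → Prop} {M : Memory} {τ : ℕ}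
    (h : c.VC B Q M τ) (hQ : ∀ M τ, Q M τ → Q' M τ) : c.VC B Q' M τ := by
  induction c generalizing Q Q' M τ with
  | skip => exact hQ _ _ h
  | store a e₁ e₂ => exact ⟨h.1, h.2.1, hQ _ _ h.2.2⟩
  | seq c₁ c₂ ih₁ ih₂ => exact ih₁ h fun M τ h' => ih₂ h' hQ
  | ite e c₁ c₂ ih₁ ih₂ =>
    exact ⟨h.1, fun hv => ih₁ (h.2.1 hv) hQ, fun hv => ih₂ (h.2.2 hv) hQ⟩
  | _ e c ih =>
    intro hM
    obtain ⟨t, M', e', h'⟩ := h hM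
    exact ⟨t, M', e', hQ _ _ h'⟩

theorem vc_frame {B : ℕ} {c : Cmd} {Q : Memory → ℕ → Prop} {M : Memory} {τ : ℕ}
    (h : c.VC B Q M τ) :
    c.VC B (fun M' τ' => Q M' τ' ∧ ∀ a, a ∉ c.writes → M' a = M a) M τ := by
  induction c generalizing Q M τ with
  | skip => exact ⟨h, fun _ _ => rfl⟩
  | store a e₁ e₂ =>
    refine ⟨h.1, h.2.1, h.2.2, fun b hb => ?_⟩
    funext j
    simp only [Cmd.writes, List.mem_singleton] at hb
    simp [Memory.set, hb]
  | seq c₁ c₂ ih₁ ih₂ =>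
    refine vc_mono (c := c₁) (ih₁ h) fun M₁ τ₁ h₁ =>
      vc_mono (c := c₂) (ih₂ h₁.1) fun M₂ τ₂ h₂ => ⟨h₂.1, fun a ha => ?_⟩
    simp only [Cmd.writes, List.mem_append, not_or] at ha
    rw [h₂.2 a ha.2, h₁.2 a ha.1]
  | ite e c₁ c₂ ih₁ ih₂ =>
    refine ⟨h.1, fun hv => vc_mono (ih₁ (h.2.1 hv)) ?_, fun hv => vc_mono (ih₂ (h.2.2 hv)) ?_⟩ <;>
    · rintro M₁ τ₁ h₁
      refine ⟨h₁.1, fun a ha => h₁.2 a ?_⟩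
      simp only [Cmd.writes, List.mem_append, not_or] at ha
      tauto
  | _ e c ih =>
    intro hM
    obtain ⟨t, M', e', h'⟩ := h hM
    exact ⟨t, M', e', h', fun a ha => e'.frame ha⟩

/-- The sequencing rule, for a first command with a known specification. -/
theorem vc_seq {B : ℕ} {c₁ c₂ : Cmd} {P Q : Memory → ℕ → Prop} {M : Memory} {τ : ℕ}
    (h₁ : c₁.VC B P M τ)
    (h₂ : ∀ M' τ', P M' τ' → (∀ a, a ∉ c₁.writes → M' a = M a) → c₂.VC B Q M' τ') :
    (Cmd.seq c₁ c₂).VC B Q M τ :=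
  vc_mono (c := c₁) (vc_frame h₁) fun M' τ' h => h₂ M' τ' h.1 h.2

/-- The rule for loops: the elapsed time is bounded as long as the invariant holds. -/
theorem vc_while {B : ℕ} (hB : 16 ≤ B) {e : Expr} {c : Cmd} {Q : Memory → ℕ → Prop} {M : Memory}
    {τ : ℕ} (I : Memory → ℕ → Prop) (K : ℕ) (hI : I M τ)
    (h : ∀ M τ, I M τ → τ ≤ K ∧ e.Ok B M ∧ (e.val M ≠ 0 → c.VC B I M (τ + (e.cost + 1))) ∧
      (e.val M = 0 → Q M (τ + (e.cost + 1)))) :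
    (Cmd.while e c).VC B Q M τ := by
  intro hM
  induction hn : K - τ using Nat.strong_induction_on generalizing M τ with
  | _ n ih =>
    obtain ⟨hK, hok, h1, h2⟩ := h M τ hI
    by_cases hv : e.val M = 0
    · exact ⟨_, _, .while_false _ _ _ (hok.fits hB hM) hv, h2 hv⟩
    · obtain ⟨t, M', he, hI'⟩ := (h1 hv).exec hB hM
      have hb := he.bounded hM
      have hK' := (h M' _ hI').1
      obtain ⟨t₂, M₂, he₂, hQ⟩ := ih (K - (τ + (e.cost + 1) + t)) (by omega) hI' hb rfl
      refine ⟨_, _, .while_true _ _ _ _ _ _ _ (hok.fits hB hM) hv he he₂, ?_⟩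
      rwa [show τ + (e.cost + 1 + t + t₂) = τ + (e.cost + 1) + t + t₂ by omega]

instance : Add Expr := ⟨.op .add⟩
instance : Sub Expr := ⟨.op .sub⟩
instance : Mul Expr := ⟨.op .mul⟩
instance : Div Expr := ⟨.op .div⟩
instance : Mod Expr := ⟨.op .mod⟩

namespace Expr

/-- The scalar variable `a`. -/
def var (a : ℕ) : Expr := .load a (.const 0)
/-- The test `e₁ < e₂`. -/
def lt (e₁ e₂ : Expr) : Expr := .op .eq (.op .le e₂ e₁) (.const 0)
/-- The test `e₁ = e₂`. -/
def beq (e₁ e₂ : Expr) : Expr := .op .eq e₁ e₂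

variable {B : ℕ} {M : Memory} (e₁ e₂ : Expr) (a : ℕ) (z : ℤ)

@[simp] theorem val_add : (e₁ + e₂).val M = e₁.val M + e₂.val M := rfl
@[simp] theorem val_sub : (e₁ - e₂).val M = e₁.val M - e₂.val M := rfl
@[simp] theorem val_mul : (e₁ * e₂).val M = e₁.val M * e₂.val M := rfl
@[simp] theorem val_div : (e₁ / e₂).val M = e₁.val M / e₂.val M := rfl
@[simp] theorem val_mod : (e₁ % e₂).val M = e₁.val M % e₂.val M := rfl
@[simp] theorem val_const : (const z).val M = z := rfl
@[simp] theorem val_load : (load a e₁).val M = M a (e₁.val M) := rfl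
@[simp] theorem val_var : (var a).val M = M a 0 := rfl
@[simp] theorem val_beq : (beq e₁ e₂).val M = if e₁.val M = e₂.val M then 1 else 0 := rfl
@[simp] theorem val_lt : (lt e₁ e₂).val M = if e₁.val M < e₂.val M then 1 else 0 := by
  simp only [lt, val, BinOp.apply]
  by_cases h : e₂.val M ≤ e₁.val M
  · simp [h]
  · simp [h, not_le.1 h]

@[simp] theorem cost_add : (e₁ + e₂).cost = e₁.cost + e₂.cost + 1 := rfl
@[simp] theorem cost_sub : (e₁ - e₂).cost = e₁.cost + e₂.cost + 1 := rfl
@[simp] theorem cost_mul : (e₁ * e₂).cost = e₁.cost + e₂.cost + 1 := rfl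
@[simp] theorem cost_div : (e₁ / e₂).cost = e₁.cost + e₂.cost + 1 := rfl
@[simp] theorem cost_mod : (e₁ % e₂).cost = e₁.cost + e₂.cost + 1 := rfl
@[simp] theorem cost_const : (const z).cost = 1 := rfl
@[simp] theorem cost_load : (load a e₁).cost = e₁.cost + 1 := rfl
@[simp] theorem cost_var : (var a).cost = 2 := rfl
@[simp] theorem cost_lt : (lt e₁ e₂).cost = e₂.cost + e₁.cost + 3 := rfl
@[simp] theorem cost_beq : (beq e₁ e₂).cost = e₁.cost + e₂.cost + 1 := rfl

@[simp] theorem ok_add : (e₁ + e₂).Ok B M ↔ e₁.Ok B M ∧ e₂.Ok B M ∧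
    -(B : ℤ) ≤ e₁.val M + e₂.val M ∧ e₁.val M + e₂.val M ≤ B := Iff.rfl
@[simp] theorem ok_sub : (e₁ - e₂).Ok B M ↔ e₁.Ok B M ∧ e₂.Ok B M ∧
    -(B : ℤ) ≤ e₁.val M - e₂.val M ∧ e₁.val M - e₂.val M ≤ B := Iff.rfl
@[simp] theorem ok_mul : (e₁ * e₂).Ok B M ↔ e₁.Ok B M ∧ e₂.Ok B M ∧
    -(B : ℤ) ≤ e₁.val M * e₂.val M ∧ e₁.val M * e₂.val M ≤ B := Iff.rfl
@[simp] theorem ok_div : (e₁ / e₂).Ok B M ↔ e₁.Ok B M ∧ e₂.Ok B M ∧ e₂.val M ≠ 0 := Iff.rfl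
@[simp] theorem ok_mod : (e₁ % e₂).Ok B M ↔ e₁.Ok B M ∧ e₂.Ok B M ∧ e₂.val M ≠ 0 := Iff.rfl
@[simp] theorem ok_const : (const z).Ok B M ↔ |z| ≤ 16 := Iff.rfl
@[simp] theorem ok_load : (load a e₁).Ok B M ↔ e₁.Ok B M := Iff.rfl
@[simp] theorem ok_var : (var a).Ok B M := by simp [var]
@[simp] theorem ok_lt : (lt e₁ e₂).Ok B M ↔ e₁.Ok B M ∧ e₂.Ok B M := by
  simp only [lt, Ok]; simp [and_comm]
@[simp] theorem ok_beq : (beq e₁ e₂).Ok B M ↔ e₁.Ok B M ∧ e₂.Ok B M := Iff.rfl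

end Expr

@[simp] theorem Memory.set_same (M : Memory) (a : ℕ) (j z j' : ℤ) :
    M.set a j z a j' = if j' = j then z else M a j' := by
  simp [Memory.set]

@[simp] theorem Memory.set_of_ne (M : Memory) {a a' : ℕ} (j z : ℤ) (h : a' ≠ a) :
    M.set a j z a' = M a' := by
  funext j'
  simp [Memory.set, h]

namespace Cmd

/-- Assignment to the scalar variable `a`. -/
def assign (a : ℕ) (e : Expr) : Cmd := .store a (.const 0) e

/-- The loop `for v = 0, …, e - 1`. -/
def forLoop (v : ℕ) (e : Expr) (c : Cmd) : Cmd :=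
  .seq (.assign v (.const 0))
    (.while (.lt (.var v) e) (.seq c (.assign v (.var v + .const 1))))

variable {B : ℕ} {M : Memory} {τ : ℕ} {Q : Memory → ℕ → Prop}

@[simp] theorem vc_assign {a : ℕ} {e : Expr} : (assign a e).VC B Q M τ ↔
    e.Ok B M ∧ Q (M.set a 0 (e.val M)) (τ + (e.cost + 2)) := by
  have h : (Expr.const 0).cost + e.cost + 1 = e.cost + 2 := by simp; omega
  simp [assign, VC, Expr.Ok, ← h]

@[simp] theorem vc_store {a : ℕ} {e₁ e₂ : Expr} : (store a e₁ e₂).VC B Q M τ ↔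
    e₁.Ok B M ∧ e₂.Ok B M ∧ Q (M.set a (e₁.val M) (e₂.val M)) (τ + (e₁.cost + e₂.cost + 1)) :=
  Iff.rfl

@[simp] theorem vc_skip : skip.VC B Q M τ ↔ Q M (τ + 1) := Iff.rfl

@[simp] theorem vc_seq_iff {c₁ c₂ : Cmd} :
    (seq c₁ c₂).VC B Q M τ ↔ c₁.VC B (c₂.VC B Q) M τ := Iff.rfl

@[simp] theorem vc_ite {e : Expr} {c₁ c₂ : Cmd} : (ite e c₁ c₂).VC B Q M τ ↔
    e.Ok B M ∧ (e.val M ≠ 0 → c₁.VC B Q M (τ + (e.cost + 1))) ∧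
      (e.val M = 0 → c₂.VC B Q M (τ + (e.cost + 1))) := Iff.rfl

end Cmd

theorem vc_for {B : ℕ} (hB : 16 ≤ B) {v : ℕ} {e : Expr} {c : Cmd} {n : ℕ} (hn : n ≤ B)
    {Q : Memory → ℕ → Prop} {M : Memory} {τ : ℕ} (I : ℕ → Memory → ℕ → Prop) (K : ℕ)
    (hK : ∀ i M τ, i ≤ n → I i M τ → τ ≤ K)
    (he : ∀ i M τ, i ≤ n → I i M τ → e.Ok B M ∧ e.val M = n)
    (h0 : I 0 (M.set v 0 0) (τ + 3))
    (hstep : ∀ i M τ, i < n → I i M τ → M v 0 = i →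
      c.VC B (fun M' τ' => M' v 0 = i ∧ I (i + 1) (M'.set v 0 (i + 1)) (τ' + 6)) M
        (τ + (e.cost + 6)))
    (hend : ∀ M τ, I n M τ → M v 0 = n → Q M (τ + (e.cost + 6))) :
    (Cmd.forLoop v e c).VC B Q M τ := by
  rw [Cmd.forLoop, Cmd.vc_seq_iff, Cmd.vc_assign]
  refine ⟨by simp, ?_⟩
  refine vc_while hB (fun M τ => ∃ i ≤ n, M v 0 = i ∧ I i M τ) K
    ⟨0, Nat.zero_le _, by simp, h0⟩ ?_
  rintro M τ ⟨i, hi, hv, hI⟩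
  have hcost : (Expr.lt (.var v) e).cost + 1 = e.cost + 6 := by simp
  obtain ⟨hok, hval⟩ := he i M τ hi hI
  rw [hcost]
  refine ⟨hK i M τ hi hI, by simpa using hok, fun hne => ?_, fun heq => ?_⟩
  · have hlt : i < n := by
      by_contra hcon
      apply hne
      simp [hv, hval]
      omega
    rw [Cmd.vc_seq_iff]
    refine vc_mono (hstep i M τ hlt hI hv) ?_
    rintro M' τ' ⟨hv', hI'⟩
    rw [Cmd.vc_assign]
    refine ⟨?_, ?_⟩
    · simp [hv']
      omega
    · refine ⟨i + 1, hlt, ?_, ?_⟩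
      · simp [hv']
      · simpa [hv'] using hI'
  · have : i = n := by
      simp [hv, hval] at heq
      omega
    subst this
    exact hend M τ hI hv

end WordRAM

/-!
# Numbering the nodes such that children come before their parents
-/

namespace WordRAM

open WordRAM.Expr WordRAM.Cmd

/-- Count the children of every node (the root counts itself) and find the root. -/
def countChildren : Cmd :=
  forLoop 12 (var 0)
    (.seq (.store 8 (load 1 (var 12)) (load 8 (load 1 (var 12)) + const 1))
      (.ite (beq (load 1 (var 12)) (var 12)) (assign 49 (var 12)) .skip))

/-- Append the node `e` to the queue. -/
def push (e : Expr) : Cmd :=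
  .seq (.store 9 (var 11) e) (.seq (.store 10 e (var 11)) (assign 11 (var 11 + const 1)))

def pushLeaves : Cmd :=
  forLoop 12 (var 0) (.ite (beq (load 8 (var 12)) (const 0)) (push (var 12)) .skip)

def peel : Cmd :=
  forLoop 12 (var 0 - const 1)
    (.seq (assign 14 (load 1 (load 9 (var 12))))
    (.seq (.store 8 (var 14) (load 8 (var 14) - const 1))
      (.ite (beq (load 8 (var 14)) (const 0)) (push (var 14)) .skip)))

def orderNodes : Cmd :=
  .seq countChildren (.seq pushLeaves (.seq peel (.seq (.store 9 (var 0 - const 1) (var 49))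
    (.store 10 (var 49) (var 0 - const 1)))))

/-- `par` is the parent function of a tree with the nodes `0, …, q - 1` and the root `r`;
`D` decreases towards the root. -/
structure ParentTree (q : ℕ) (par : ℕ → ℕ) (r : ℕ) (D : ℕ → ℕ) : Prop where
  root_lt : r < q
  par_root : par r = r
  par_lt : ∀ x < q, par x < q
  decr : ∀ x < q, x ≠ r → D (par x) < D x

variable {q : ℕ} {par : ℕ → ℕ} {r : ℕ} {D : ℕ → ℕ}

theorem ParentTree.par_eq_self (T : ParentTree q par r D) {x : ℕ} (hx : x < q) :
    par x = x ↔ x = r := by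
  refine ⟨fun h => ?_, fun h => by rw [h, T.par_root]⟩
  by_contra hne
  have := T.decr x hx hne
  rw [h] at this
  omega

/-- The children of `y`, where the root is a child of itself. -/
def childrenBelow (q : ℕ) (par : ℕ → ℕ) (y : ℕ) : Finset ℕ :=
  (Finset.range q).filter fun x => par x = y

theorem countChildren_spec {B : ℕ} (hB : 16 ≤ B) (hq : q < B) (T : ParentTree q par r D)
    {M : Memory} {τ : ℕ} (h0 : M 0 0 = q) (h1 : ∀ x < q, M 1 x = par x) (h8 : M 8 = 0) :
    countChildren.VC B (fun M' τ' => τ' ≤ τ + (40 * q + 20) ∧ M' 49 0 = r ∧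
      ∀ y, M' 8 (y : ℕ) = (childrenBelow q par y).card) M τ := by
  refine vc_for hB (n := q) hq.le
    (fun i M' τ' => τ' ≤ τ + (40 * i + 3) ∧ M' 0 = M 0 ∧ M' 1 = M 1 ∧ (r < i → M' 49 0 = r) ∧
      ∀ y, M' 8 (y : ℕ) = (childrenBelow i par y).card) (τ + (40 * q + 3)) ?_ ?_ ?_ ?_ ?_
  · intro i M' τ' hi h
    have := h.1
    omega
  · intro i M' τ' hi h
    simp [h.2.1, h0]
  · simp [h8, childrenBelow]
  · rintro i M' τ' hi ⟨hτ, e0, e1, e49, e8⟩ hv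
    have hpar := h1 i hi
    have hcard : (childrenBelow i par (par i)).card ≤ i := by
      simpa [childrenBelow] using Finset.card_filter_le (Finset.range i) (fun x => par x = par i)
    have key : ∀ y : ℕ, ((childrenBelow (i + 1) par y).card : ℤ) =
        if y = par i then (childrenBelow i par (par i)).card + 1
        else (childrenBelow i par y).card := by
      intro y
      simp only [childrenBelow, Finset.range_add_one, Finset.filter_insert]
      by_cases hy : y = par i
      · subst hy
        simp
      · simp [hy, Ne.symm hy]
    simp only [vc_seq_iff, vc_store, vc_ite, vc_assign, vc_skip]
    simp [hv, e0, e1, hpar, e8, key]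
    refine ⟨by omega, fun h => ⟨by omega, ?_⟩, fun h => ⟨by omega, ?_⟩⟩
    · exact fun _ => ((T.par_eq_self hi).1 h)
    · intro hr
      have : i ≠ r := fun h' => h ((T.par_eq_self hi).2 h')
      exact e49 (by omega)
  · rintro M' τ' ⟨hτ, e0, e1, e49, e8⟩ hv
    simp only [cost_var]
    exact ⟨by omega, e49 T.root_lt, e8⟩

/-- The queue `Qs 0, …, Qs (t - 1)` of distinct nodes other than `r`, as it is stored. -/
structure Queue (q r : ℕ) (M : Memory) (t : ℕ) (Qs : ℕ → ℕ) : Prop where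
  tail : M 11 0 = t
  lt : ∀ j < t, Qs j < q
  ne : ∀ j < t, Qs j ≠ r
  ord : ∀ j < t, M 9 j = Qs j
  pos : ∀ j < t, M 10 (Qs j) = j

namespace Queue

variable {M M' : Memory} {t : ℕ} {Qs : ℕ → ℕ}

theorem congr (h : Queue q r M t Qs) (h9 : M' 9 = M 9) (h10 : M' 10 = M 10)
    (h11 : M' 11 = M 11) : Queue q r M' t Qs :=
  ⟨by rw [h11, h.tail], h.lt, h.ne, by rw [h9]; exact h.ord, by rw [h10]; exact h.pos⟩

theorem inj (h : Queue q r M t Qs) {i j : ℕ} (hi : i < t) (hj : j < t) (hij : Qs i = Qs j) :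
    i = j := by
  have h1 := h.pos i hi
  rw [hij, h.pos j hj] at h1
  exact_mod_cast h1.symm

theorem lt_of_root (h : Queue q r M t Qs) (hr : r < q) : t < q := by
  have h1 : (Finset.range t).card ≤ ((Finset.range q).erase r).card := by
    refine Finset.card_le_card_of_injOn Qs (fun j hj => ?_) (fun i hi j hj hij => ?_)
    · have hj' : j < t := by simpa using hj
      simp [h.ne j hj', h.lt j hj']
    · exact h.inj (by simpa using hi) (by simpa using hj) hij
  rw [Finset.card_erase_of_mem (by simpa using hr)] at h1
  simp at h1
  omega

theorem lt_of_forall (hr : r < q) (h : ∀ x < q, x ≠ r → ∃ j < t, Qs j = x) : q ≤ t + 1 := by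
  have h1 : ((Finset.range q).erase r).card ≤ ((Finset.range t).image Qs).card := by
    refine Finset.card_le_card fun x hx => ?_
    simp only [Finset.mem_erase, Finset.mem_range] at hx
    obtain ⟨j, hj, e⟩ := h x hx.2 hx.1
    exact Finset.mem_image.2 ⟨j, by simpa using hj, e⟩
  have h2 := h1.trans Finset.card_image_le
  rw [Finset.card_erase_of_mem (by simpa using hr)] at h2
  simp at h2
  omega

theorem push (h : Queue q r M t Qs) {y : ℕ} (hy : y < q) (hyr : y ≠ r)
    (hnew : ∀ j < t, Qs j ≠ y) (h9 : M' 9 = (M.set 9 t y) 9) (h10 : M' 10 = (M.set 10 y t) 10)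
    (h11 : M' 11 0 = t + 1) : Queue q r M' (t + 1) (Function.update Qs t y) := by
  have hu : ∀ j < t, Function.update Qs t y j = Qs j := fun j hj =>
    Function.update_of_ne hj.ne _ _
  refine ⟨by simpa using h11, fun j hj => ?_, fun j hj => ?_, fun j hj => ?_, fun j hj => ?_⟩ <;>
    obtain hj | rfl := Nat.lt_succ_iff_lt_or_eq.1 hj
  · rw [hu j hj]; exact h.lt j hj
  · simpa using hy
  · rw [hu j hj]; exact h.ne j hj
  · simpa using hyr
  · rw [hu j hj, h9]
    simp [hj.ne, h.ord j hj]
  · simp [h9]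
  · rw [hu j hj, h10]
    simp [hnew j hj, h.pos j hj]
  · simp [h10]

end Queue

theorem childrenBelow_eq_zero {y : ℕ} (h : (childrenBelow q par y).card = 0) {x : ℕ}
    (hx : x < q) : par x ≠ y := by
  intro hxy
  rw [Finset.card_eq_zero] at h
  have : x ∈ childrenBelow q par y := by simp [childrenBelow, hx, hxy]
  simp [h] at this

theorem pushLeaves_spec {B : ℕ} (hB : 16 ≤ B) (hq : q < B) (T : ParentTree q par r D)
    {M : Memory} {τ : ℕ} (h0 : M 0 0 = q) (h11 : M 11 = 0)
    (h8 : ∀ y, M 8 (y : ℕ) = (childrenBelow q par y).card) :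
    pushLeaves.VC B (fun M' τ' => τ' ≤ τ + (50 * q + 20) ∧ ∃ t Qs, Queue q r M' t Qs ∧
      ∀ y < q, (∃ j < t, Qs j = y) ↔ M 8 y = 0) M τ := by
  refine vc_for hB (n := q) hq.le
    (fun i M' τ' => τ' ≤ τ + (50 * i + 3) ∧ M' 0 = M 0 ∧ M' 8 = M 8 ∧
      ∃ t Qs, Queue q r M' t Qs ∧ t ≤ i ∧ ∀ y < q, (∃ j < t, Qs j = y) ↔ M 8 y = 0 ∧ y < i)
    (τ + (50 * q + 3)) ?_ ?_ ?_ ?_ ?_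
  · intro i M' τ' hi h
    have := h.1
    omega
  · intro i M' τ' hi h
    simp [h.2.1, h0]
  · refine ⟨by simp, by simp, by simp, 0, id, ⟨by simp [h11], ?_, ?_, ?_, ?_⟩, by simp, by simp⟩ <;>
      simp
  · rintro i M' τ' hi ⟨hτ, e0, e8, t, Qs, hQ, hti, hmem⟩ hv
    simp only [vc_seq_iff, vc_store, vc_ite, vc_assign, vc_skip, WordRAM.push]
    simp [hv, e0, e8, hQ.tail]
    refine ⟨fun h => ⟨by omega, by omega, t + 1, Function.update Qs t i,
      hQ.push hi ?_ ?_ (by simp) (by funext; simp) (by simp), by omega, fun y hy => ?_⟩,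
      fun h => ⟨by omega, t, Qs, hQ.congr (by simp) (by simp) (by simp), by omega, fun y hy => ?_⟩⟩
    · rintro rfl
      rw [h8 i] at h
      exact childrenBelow_eq_zero (by exact_mod_cast h) T.root_lt T.par_root
    · intro j hj hji
      have := ((hmem i hi).1 ⟨j, hj, hji⟩).2
      omega
    · constructor
      · rintro ⟨j, hj, rfl⟩
        obtain hj | rfl := Nat.lt_succ_iff_lt_or_eq.1 hj
        · rw [Function.update_of_ne hj.ne] at hy ⊢
          have := (hmem _ hy).1 ⟨j, hj, rfl⟩
          exact ⟨this.1, by omega⟩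
        · simp [h]
      · rintro ⟨h1, h2⟩
        obtain h2 | rfl := Nat.lt_or_eq_of_le h2
        · obtain ⟨j, hj, e⟩ := (hmem y hy).2 ⟨h1, h2⟩
          exact ⟨j, by omega, by rw [Function.update_of_ne hj.ne, e]⟩
        · exact ⟨t, by omega, by simp⟩
    · rw [hmem y hy]
      refine and_congr_right fun h1 => ⟨fun h2 => by omega, fun h2 => ?_⟩
      obtain h2 | rfl := Nat.lt_or_eq_of_le h2
      · exact h2
      · exact absurd h1 h
  · rintro M' τ' ⟨hτ, e0, e8, t, Qs, hQ, hti, hmem⟩ hv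
    simp only [cost_var]
    refine ⟨by omega, t, Qs, hQ, fun y hy => ?_⟩
    rw [hmem y hy]
    simp [hy]

/-- The children of `y` that are not among the first `h` nodes of the queue. -/
def childrenLeft (q : ℕ) (par : ℕ → ℕ) (Qs : ℕ → ℕ) (h : ℕ) (y : ℕ) : Finset ℕ :=
  (Finset.range q).filter fun x => par x = y ∧ ∀ j < h, Qs j ≠ x

theorem peel_spec {B : ℕ} (hB : 16 ≤ B) (hq : q < B) (T : ParentTree q par r D)
    {M : Memory} {τ : ℕ} (h0 : M 0 0 = q) (h1 : ∀ x < q, M 1 x = par x)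
    (h8 : ∀ y, M 8 (y : ℕ) = (childrenBelow q par y).card) {t₀ : ℕ} {Qs₀ : ℕ → ℕ}
    (hQ₀ : Queue q r M t₀ Qs₀) (hmem₀ : ∀ y < q, (∃ j < t₀, Qs₀ j = y) ↔ M 8 y = 0) :
    peel.VC B (fun M' τ' => τ' ≤ τ + (60 * q + 20) ∧ ∃ Qs, Queue q r M' (q - 1) Qs ∧
      ∀ j < q - 1, ∀ x < q, par x = Qs j → ∃ i < j, Qs i = x) M τ := by
  have hq0 : 0 < q := Nat.zero_lt_of_lt T.root_lt
  refine vc_for hB (n := q - 1) (by omega)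
    (fun h M' τ' => τ' ≤ τ + (60 * h + 3) ∧ M' 0 = M 0 ∧ M' 1 = M 1 ∧
      ∃ t Qs, Queue q r M' t Qs ∧ h ≤ t ∧
      (∀ y < q, M' 8 y = (childrenLeft q par Qs h y).card) ∧
      (∀ y < q, (∃ j < t, Qs j = y) ↔ M' 8 y = 0) ∧
      ∀ j < t, ∀ x < q, par x = Qs j → ∃ i < h, i < j ∧ Qs i = x)
    (τ + (60 * q + 3)) ?_ ?_ ?_ ?_ ?_
  · intro i M' τ' hi h
    have := h.1
    omega
  · intro i M' τ' hi h
    simp [h.2.1, h0]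
    omega
  · refine ⟨by simp, by simp, by simp, t₀, Qs₀, hQ₀.congr (by simp) (by simp) (by simp), by simp,
      ?_, by simpa using hmem₀, ?_⟩
    · intro y hy
      simp [h8, childrenLeft, childrenBelow]
    · intro j hj x hx hxj
      have := (hmem₀ (Qs₀ j) (hQ₀.lt j hj)).1 ⟨j, hj, rfl⟩
      rw [h8] at this
      exact absurd hxj (childrenBelow_eq_zero (by exact_mod_cast this) hx)
  · rintro h M' τ' hh ⟨hτ, e0, e1, t, Qs, hQ, hht, hdeg, hmem, hprev⟩ hv
    have hlt : h < t := by
      refine lt_of_le_of_ne hht fun heq => ?_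
      subst heq
      have hall : ∀ n, ∀ x < q, x ≠ r → (∀ y < q, D y ≤ n) → n - D x < n + 1 := by omega
      suffices hs : ∀ n, ∀ x < q, x ≠ r → ((Finset.range q).sup D) - D x = n →
          ∃ j < h, Qs j = x by
        have := Queue.lt_of_forall T.root_lt fun x hx hxr => hs _ x hx hxr rfl
        omega
      intro n
      induction n using Nat.strong_induction_on with
      | _ n ih =>
        intro x hx hxr hn
        rw [hmem x hx, hdeg x hx, Nat.cast_eq_zero, Finset.card_eq_zero, childrenLeft,
          Finset.filter_eq_empty_iff]
        rintro y hy ⟨hyx, hall⟩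
        rw [Finset.mem_range] at hy
        have hyr : y ≠ r := by
          rintro rfl
          exact hxr (by rw [← hyx, T.par_root])
        have hD := T.decr y hy hyr
        have hs : D y ≤ (Finset.range q).sup D := Finset.le_sup (by simpa using hy)
        rw [hyx] at hD
        obtain ⟨j, hj, e⟩ := ih _ (by omega) y hy hyr rfl
        exact hall j hj e
    have hx := hQ.lt h hlt
    have hy := T.par_lt _ hx
    set x := Qs h with hxdef
    set y := par x with hydef
    have hsplit : ∀ z, childrenLeft q par Qs (h + 1) z = (childrenLeft q par Qs h z).erase x := by
      intro z
      ext u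
      simp only [childrenLeft, Finset.mem_filter, Finset.mem_range, Finset.mem_erase]
      constructor
      · rintro ⟨h1, h2, h3⟩
        exact ⟨fun e => h3 h (by omega) (by rw [e]), h1, h2, fun j hj => h3 j (by omega)⟩
      · rintro ⟨h1, h2, h3, h4⟩
        refine ⟨h2, h3, fun j hj => ?_⟩
        obtain hj | rfl := Nat.lt_succ_iff_lt_or_eq.1 hj
        · exact h4 j hj
        · exact fun e => h1 e.symm
    have hxmem : x ∈ childrenLeft q par Qs h y := by
      simp only [childrenLeft, Finset.mem_filter, Finset.mem_range]
      refine ⟨hx, rfl, fun j hj e => ?_⟩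
      have := hQ.inj (by omega) hlt e
      omega
    have hcard : ∀ z < q, ((childrenLeft q par Qs (h + 1) z).card : ℤ) =
        if z = y then M' 8 y - 1 else M' 8 z := by
      intro z hz
      rw [hsplit z]
      split_ifs with hzy
      · subst hzy
        have hpos : 0 < (childrenLeft q par Qs h y).card := Finset.card_pos.2 ⟨x, hxmem⟩
        rw [Finset.card_erase_of_mem hxmem, hdeg y hy]
        omega
      · rw [Finset.erase_eq_of_notMem, hdeg z hz]
        simp only [childrenLeft, Finset.mem_filter, not_and]
        intro _ e
        exact absurd e.symm hzy
    have hposy : 1 ≤ M' 8 y := by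
      have hpos : 0 < (childrenLeft q par Qs h y).card := Finset.card_pos.2 ⟨x, hxmem⟩
      rw [hdeg y hy]
      omega
    have hley : M' 8 y ≤ q := by
      rw [hdeg y hy]
      have := Finset.card_filter_le (Finset.range q) (fun x => par x = y ∧ ∀ j < h, Qs j ≠ x)
      rw [Finset.card_range] at this
      exact_mod_cast this
    have hynew : ∀ j < t, Qs j ≠ y := fun j hj e => by
      have := (hmem y hy).1 ⟨j, hj, e⟩
      omega
    have htq := hQ.lt_of_root T.root_lt
    have hordh : M' 9 h = x := hQ.ord h hlt
    simp only [vc_seq_iff, vc_store, vc_ite, vc_assign, vc_skip, WordRAM.push]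
    simp [hv, e0, e1, hQ.tail, hordh, h1 x hx, ← hydef]
    refine ⟨by omega, fun hz => ⟨by omega, by omega,
      t + 1, Function.update Qs t y, hQ.push hy ?_ hynew (by funext; simp) (by funext; simp)
        (by simp),
      by omega, ?_, ?_, ?_⟩, fun hz => ⟨by omega, t, Qs, hQ.congr (by simp) (by simp) (by simp), by omega,
      ?_, ?_, ?_⟩⟩
    · intro hyr
      have hc := hcard y hy
      rw [if_pos rfl, hz] at hc
      have hr : r ∈ childrenLeft q par Qs (h + 1) y := by
        simp only [childrenLeft, Finset.mem_filter, Finset.mem_range]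
        exact ⟨T.root_lt, by rw [T.par_root, hyr], fun j hj => hQ.ne j (by omega)⟩
      have := Finset.card_pos.2 ⟨r, hr⟩
      omega
    · intro z hz'
      have : childrenLeft q par (Function.update Qs t y) (h + 1) z =
          childrenLeft q par Qs (h + 1) z := by
        unfold childrenLeft
        refine Finset.filter_congr fun u _ => and_congr_right fun _ => forall₂_congr fun j hj => ?_
        rw [Function.update_of_ne (by omega)]
      rw [this, hcard z hz']
    · intro z hz'
      constructor
      · rintro ⟨j, hj, e⟩
        obtain hj | rfl := Nat.lt_succ_iff_lt_or_eq.1 hj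
        · rw [Function.update_of_ne hj.ne] at e
          subst e
          rw [if_neg (hynew j hj)]
          exact (hmem _ hz').1 ⟨j, hj, rfl⟩
        · rw [Function.update_self] at e
          rw [if_pos e.symm, hz]
      · intro he
        split_ifs at he with hzy
        · exact ⟨t, by omega, by simp [hzy]⟩
        · obtain ⟨j, hj, e⟩ := (hmem z hz').2 he
          exact ⟨j, by omega, by rw [Function.update_of_ne hj.ne, e]⟩
    · intro j hj u hu hpu
      obtain hj | rfl := Nat.lt_succ_iff_lt_or_eq.1 hj
      · rw [Function.update_of_ne hj.ne] at hpu
        obtain ⟨i, hi, hij, e⟩ := hprev j hj u hu hpu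
        exact ⟨i, by omega, hij, by rw [Function.update_of_ne (by omega), e]⟩
      · rw [Function.update_self] at hpu
        have hc := hcard y hy
        rw [if_pos rfl, hz, Nat.cast_eq_zero, Finset.card_eq_zero] at hc
        have hu' : u ∉ childrenLeft q par Qs (h + 1) y := by simp [hc]
        simp only [childrenLeft, Finset.mem_filter, Finset.mem_range, not_and, not_forall,
          not_not] at hu'
        obtain ⟨i, hi, e⟩ := hu' hu hpu
        exact ⟨i, by omega, by omega, by rw [Function.update_of_ne (by omega), e]⟩
    · intro z hz'
      rw [hcard z hz']
    · intro z hz'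
      rw [hmem z hz']
      split_ifs with hzy
      · subst hzy
        constructor
        · intro h'
          omega
        · intro h'
          exact absurd h' hz
      · rfl
    · intro j hj u hu hpu
      obtain ⟨i, hi, hij, e⟩ := hprev j hj u hu hpu
      exact ⟨i, by omega, hij, e⟩
  · rintro M' τ' ⟨hτ, e0, e1, t, Qs, hQ, hht, hdeg, hmem, hprev⟩ hv
    have htq := hQ.lt_of_root T.root_lt
    obtain rfl : t = q - 1 := by omega
    simp only [cost_var, cost_sub, cost_const]
    refine ⟨by omega, Qs, hQ, fun j hj x hx hxj => ?_⟩
    obtain ⟨i, hi, hij, e⟩ := hprev j hj x hx hxj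
    exact ⟨i, hij, e⟩

/-- `pos` and `ord` number the nodes such that children come before their parents. -/
structure Numbering (q : ℕ) (par : ℕ → ℕ) (r : ℕ) (ord pos : ℕ → ℕ) : Prop where
  ord_lt : ∀ i < q, ord i < q
  pos_lt : ∀ x < q, pos x < q
  pos_ord : ∀ i < q, pos (ord i) = i
  ord_pos : ∀ x < q, ord (pos x) = x
  pos_root : pos r = q - 1
  pos_par : ∀ x < q, x ≠ r → pos x < pos (par x)

theorem orderNodes_spec {B : ℕ} (hB : 16 ≤ B) (hq : q < B) (T : ParentTree q par r D)
    {M : Memory} {τ : ℕ} (h0 : M 0 0 = q) (h1 : ∀ x < q, M 1 x = par x) (h8 : M 8 = 0)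
    (h11 : M 11 = 0) :
    orderNodes.VC B (fun M' τ' => τ' ≤ τ + (150 * q + 100) ∧ ∃ ord pos, Numbering q par r ord pos ∧
      (∀ i < q, M' 9 (i : ℕ) = ord i) ∧ ∀ x < q, M' 10 (x : ℕ) = pos x) M τ := by
  have hr := T.root_lt
  refine vc_seq (countChildren_spec hB hq T h0 h1 h8) ?_
  rintro M₁ τ₁ ⟨hτ₁, hr₁, hd₁⟩ f₁
  have a0 : M₁ 0 = M 0 := f₁ 0 (by decide)
  have a1 : M₁ 1 = M 1 := f₁ 1 (by decide)
  have a11 : M₁ 11 = M 11 := f₁ 11 (by decide)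
  refine vc_seq (pushLeaves_spec hB hq T (by rw [a0, h0]) (by rw [a11, h11]) hd₁) ?_
  rintro M₂ τ₂ ⟨hτ₂, t, Qs, hQ, hmem⟩ f₂
  have b0 : M₂ 0 = M₁ 0 := f₂ 0 (by decide)
  have b1 : M₂ 1 = M₁ 1 := f₂ 1 (by decide)
  have b8 : M₂ 8 = M₁ 8 := f₂ 8 (by decide)
  have b49 : M₂ 49 = M₁ 49 := f₂ 49 (by decide)
  refine vc_seq (peel_spec hB hq T (by rw [b0, a0, h0]) (by rw [b1, a1]; exact h1)
    (by rw [b8]; exact hd₁) hQ (by rw [b8]; exact hmem)) ?_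
  rintro M₃ τ₃ ⟨hτ₃, Qs', hQ', hprev⟩ f₃
  have c0 : M₃ 0 0 = q := by rw [f₃ 0 (by decide), b0, a0, h0]
  have c49 : M₃ 49 0 = r := by rw [f₃ 49 (by decide), b49, hr₁]
  clear f₁ f₂ f₃
  have hsurj : ∀ x < q, x ≠ r → ∃ j < q - 1, Qs' j = x := by
    intro x hx hxr
    have hsub : (Finset.range (q - 1)).image Qs' ⊆ (Finset.range q).erase r := by
      intro y hy
      obtain ⟨j, hj, rfl⟩ := Finset.mem_image.1 hy
      rw [Finset.mem_range] at hj
      simp [hQ'.lt j hj, hQ'.ne j hj]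
    have hcard : ((Finset.range q).erase r).card ≤ ((Finset.range (q - 1)).image Qs').card := by
      rw [Finset.card_image_of_injOn, Finset.card_erase_of_mem (by simpa using hr)]
      · simp
      · intro i hi j hj hij
        exact hQ'.inj (by simpa using hi) (by simpa using hj) hij
    have heq := Finset.eq_of_subset_of_card_le hsub hcard
    have : x ∈ (Finset.range (q - 1)).image Qs' := by
      rw [heq]
      simp [hx, hxr]
    obtain ⟨j, hj, e⟩ := Finset.mem_image.1 this
    exact ⟨j, by simpa using hj, e⟩
  choose! p hp using hsurj
  have hpQ : ∀ j < q - 1, p (Qs' j) = j := fun j hj => by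
    have := hp _ (hQ'.lt j hj) (hQ'.ne j hj)
    exact hQ'.inj this.1 hj this.2
  simp only [vc_seq_iff, vc_store]
  simp [c0, c49]
  refine ⟨by omega, by omega, fun i => if i = q - 1 then r else Qs' i,
    fun x => if x = r then q - 1 else p x, ⟨?_, ?_, ?_, ?_, by simp, ?_⟩, ?_, ?_⟩
  · intro i hi
    show (if i = q - 1 then r else Qs' i) < q
    split_ifs
    exacts [hr, hQ'.lt i (by omega)]
  · intro x hx
    show (if x = r then q - 1 else p x) < q
    split_ifs with h
    · omega
    · have := (hp x hx h).1
      omega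
  · intro i hi
    by_cases h : i = q - 1
    · simp [h]
    · simp [h, hQ'.ne i (by omega), hpQ i (by omega)]
  · intro x hx
    by_cases h : x = r
    · simp [h]
    · have := hp x hx h
      simp [h, this.1.ne, this.2]
  · intro x hx hxr
    show (if x = r then q - 1 else p x) < (if par x = r then q - 1 else p (par x))
    have h1 := hp x hx hxr
    rw [if_neg hxr]
    split_ifs with h
    · exact h1.1
    · have h2 := hp _ (T.par_lt x hx) h
      obtain ⟨i, hi, e⟩ := hprev _ h2.1 x hx h2.2.symm
      have : i = p x := hQ'.inj (by omega) h1.1 (by rw [e, h1.2])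
      omega
  · intro i hi
    by_cases h : i = q - 1
    · subst h
      simp
      omega
    · have : (i : ℤ) ≠ q - 1 := by omega
      simp [h, this, hQ'.ord i (by omega)]
  · intro x hx
    by_cases h : x = r
    · subst h
      simp
      omega
    · have h1 := hp x hx h
      have h2 := hQ'.pos _ h1.1
      rw [h1.2] at h2
      simp [h, h2]

end WordRAM

/-!
# Ordered trees, and the sums of the weights
-/

namespace WordRAM

open WordRAM.Expr WordRAM.Cmd

/-- `p` is the parent function of a tree with the nodes `0, …, q - 1` and the root `q - 1`, in
which the children come before their parents. -/
structure OrderedTree (q : ℕ) (p : ℕ → ℕ) : Prop where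
  pos : 0 < q
  lt_parent : ∀ x, x + 1 < q → x < p x
  parent_lt : ∀ x < q, p x < q
  root : p (q - 1) = q - 1

/-- `y` is an ancestor of `x` (possibly `x` itself). -/
def Anc (p : ℕ → ℕ) (x y : ℕ) : Prop := ∃ k, p^[k] x = y

variable {q m : ℕ} {p : ℕ → ℕ} {x y z : ℕ}

namespace Anc

theorem refl (p : ℕ → ℕ) (x : ℕ) : Anc p x x := ⟨0, rfl⟩

theorem parent (p : ℕ → ℕ) (x : ℕ) : Anc p x (p x) := ⟨1, rfl⟩

theorem trans (h : Anc p x y) (h' : Anc p y z) : Anc p x z := by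
  obtain ⟨k, rfl⟩ := h
  obtain ⟨l, rfl⟩ := h'
  exact ⟨l + k, Function.iterate_add_apply _ _ _ _⟩

theorem eq_or_parent (h : Anc p x y) : y = x ∨ Anc p (p x) y := by
  obtain ⟨k, rfl⟩ := h
  cases k with
  | zero => exact Or.inl rfl
  | succ k => exact Or.inr ⟨k, rfl⟩

theorem total (h : Anc p x y) (h' : Anc p x z) : Anc p y z ∨ Anc p z y := by
  obtain ⟨k, rfl⟩ := h
  obtain ⟨l, rfl⟩ := h'
  obtain h | h := le_total k l
  · exact Or.inl ⟨l - k, by rw [← Function.iterate_add_apply, Nat.sub_add_cancel h]⟩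
  · exact Or.inr ⟨k - l, by rw [← Function.iterate_add_apply, Nat.sub_add_cancel h]⟩

end Anc

namespace OrderedTree

theorem le_parent (T : OrderedTree q p) (hx : x < q) : x ≤ p x := by
  by_cases h : x + 1 < q
  · exact (T.lt_parent x h).le
  · obtain rfl : x = q - 1 := by omega
    rw [T.root]

theorem anc_le (T : OrderedTree q p) (hx : x < q) (h : Anc p x y) : x ≤ y ∧ y < q := by
  obtain ⟨k, rfl⟩ := h
  induction k generalizing x with
  | zero => exact ⟨le_rfl, hx⟩
  | succ k ih =>
    have := ih (T.parent_lt x hx)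
    exact ⟨(T.le_parent hx).trans this.1, this.2⟩

theorem anc_of_le (T : OrderedTree q p) (hx : x < q) (h : Anc p x y) (h' : Anc p x z)
    (hyz : y ≤ z) : Anc p y z := by
  obtain h1 | h1 := h.total h'
  · exact h1
  · have := T.anc_le (T.anc_le hx h').2 h1
    obtain rfl : y = z := by omega
    exact Anc.refl _ _

open scoped Classical in
theorem indicator_anc (T : OrderedTree q p) (hy : y < q) (a : ℤ) :
    (if Anc p y x then a else 0) = (if y = x then a else 0) +
      ∑ c ∈ (Finset.range (q - 1)).filter (fun c => p c = x), if Anc p y c then a else 0 := by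
  have hno : ∀ c ∈ (Finset.range (q - 1)).filter (fun c => p c = x), ¬ Anc p x c := by
    intro c hc h
    simp only [Finset.mem_filter, Finset.mem_range] at hc
    obtain ⟨hc, rfl⟩ := hc
    have h1 := T.lt_parent c (by omega)
    have h2 := T.anc_le (T.parent_lt c (by omega)) h
    omega
  by_cases hyx : y = x
  · subst hyx
    rw [Finset.sum_eq_zero fun c hc => if_neg (hno c hc)]
    simp [Anc.refl]
  · by_cases h : Anc p y x
    · have hex : ∃ k, p^[k] y = x := h
      obtain ⟨k, hk⟩ : ∃ k, Nat.find hex = k + 1 := by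
        refine Nat.exists_eq_add_one_of_ne_zero fun h0 => hyx ?_
        have := Nat.find_spec hex
        rwa [h0] at this
      have hx : p (p^[k] y) = x := by
        have := Nat.find_spec hex
        rwa [hk, Function.iterate_succ_apply'] at this
      have hne : p^[k] y ≠ x := Nat.find_min hex (by omega)
      have hc := (T.anc_le hy ⟨k, rfl⟩).2
      set c := p^[k] y with hcdef
      have hyc : Anc p y c := ⟨k, rfl⟩
      have hcq : c < q - 1 := by
        by_contra hcon
        have : c = q - 1 := by omega
        rw [this, T.root] at hx
        omega
      rw [if_pos h, if_neg hyx, zero_add, Finset.sum_eq_single c, if_pos hyc]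
      · intro c' hc' hcc
        rw [if_neg]
        intro hyc'
        have h3 := hno c' hc'
        have h3' := hno c (by simp [hcq, hx])
        simp only [Finset.mem_filter, Finset.mem_range] at hc'
        obtain h1 | h1 := hyc.total hyc'
        · obtain h2 | h2 := h1.eq_or_parent
          · exact hcc h2
          · rw [hx] at h2
            exact h3 h2
        · obtain h2 | h2 := h1.eq_or_parent
          · exact hcc h2.symm
          · rw [hc'.2] at h2
            exact h3' h2
      · intro h'
        simp [hcq, hx] at h'
    · rw [if_neg h, if_neg hyx, Finset.sum_eq_zero, zero_add]
      intro c hc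
      rw [if_neg]
      intro h'
      simp only [Finset.mem_filter, Finset.mem_range] at hc
      exact h (h'.trans (hc.2 ▸ Anc.parent p c))

end OrderedTree

theorem Numbering.orderedTree {par : ℕ → ℕ} {r : ℕ} {D ord pos : ℕ → ℕ}
    (T : ParentTree q par r D) (N : Numbering q par r ord pos) :
    OrderedTree q fun i => pos (par (ord i)) := by
  have hr := T.root_lt
  refine ⟨by omega, fun x hx => ?_, fun x hx => N.pos_lt _ (T.par_lt _ (N.ord_lt x hx)), ?_⟩
  · have h1 := N.pos_par (ord x) (N.ord_lt x (by omega)) ?_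
    · rwa [N.pos_ord x (by omega)] at h1
    · intro h
      have := N.pos_ord x (by omega)
      rw [h, N.pos_root] at this
      omega
  · have : ord (q - 1) = r := by rw [← N.pos_root, N.ord_pos r hr]
    show pos (par (ord (q - 1))) = q - 1
    rw [this, T.par_root, N.pos_root]

/-- Translate the tree and the paths to the new numbers. -/
def renumber : Cmd :=
  .seq (forLoop 12 (var 0) (.store 15 (var 12) (load 10 (load 1 (load 9 (var 12))))))
    (forLoop 12 (load 0 (const 1))
      (.seq (.store 16 (var 12) (load 10 (load 2 (var 12))))
        (.store 17 (var 12) (load 10 (load 3 (var 12))))))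

theorem renumber_spec {B : ℕ} (hB : 16 ≤ B) (hq : q < B) (hm : m < B) {M : Memory} {τ : ℕ}
    {par ord pos lower upper : ℕ → ℕ}
    (h00 : M 0 0 = q) (h01 : M 0 1 = m) (h1 : ∀ x < q, M 1 x = par x) (hpar : ∀ x < q, par x < q)
    (h2 : ∀ i < m, M 2 i = lower i) (hlower : ∀ i < m, lower i < q)
    (h3 : ∀ i < m, M 3 i = upper i) (hupper : ∀ i < m, upper i < q)
    (h9 : ∀ i < q, M 9 i = ord i) (hord : ∀ i < q, ord i < q) (h10 : ∀ x < q, M 10 x = pos x) :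
    renumber.VC B (fun M' τ' => τ' ≤ τ + (30 * q + 30 * m + 40) ∧
      (∀ i < q, M' 15 i = (pos (par (ord i)) : ℕ)) ∧ (∀ i < m, M' 16 i = (pos (lower i) : ℕ)) ∧
      ∀ i < m, M' 17 i = (pos (upper i) : ℕ)) M τ := by
  refine vc_seq (P := fun M' τ' => τ' ≤ τ + (30 * q + 20) ∧
    ∀ i < q, M' 15 i = (pos (par (ord i)) : ℕ)) ?_ ?_
  · refine vc_for hB (n := q) hq.le
      (fun i M' τ' => τ' ≤ τ + (30 * i + 3) ∧ M' 0 = M 0 ∧ M' 1 = M 1 ∧ M' 9 = M 9 ∧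
        M' 10 = M 10 ∧ ∀ j < i, M' 15 j = (pos (par (ord j)) : ℕ)) (τ + (30 * q + 3)) ?_ ?_ ?_ ?_ ?_
    · intro i M' τ' hi h
      have := h.1
      omega
    · intro i M' τ' hi h
      simp [h.2.1, h00]
    · simp
    · rintro i M' τ' hi ⟨hτ, e0, e1, e9, e10, e15⟩ hv
      simp [e0, e1, e9, e10, hv, h9 i hi, h1 _ (hord i hi), h10 _ (hpar _ (hord i hi))]
      refine ⟨by omega, fun j hj => ?_⟩
      obtain hj | rfl := Nat.lt_or_eq_of_le hj
      · simp [hj.ne, e15 j hj]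
      · simp
    · rintro M' τ' ⟨hτ, e0, e1, e9, e10, e15⟩ hv
      simp only [cost_var]
      exact ⟨by omega, e15⟩
  · rintro M₁ τ₁ ⟨hτ₁, hp⟩ f₁
    have a0 : M₁ 0 = M 0 := f₁ 0 (by decide)
    have a2 : M₁ 2 = M 2 := f₁ 2 (by decide)
    have a3 : M₁ 3 = M 3 := f₁ 3 (by decide)
    have a10 : M₁ 10 = M 10 := f₁ 10 (by decide)
    refine vc_for hB (n := m) hm.le
      (fun i M' τ' => τ' ≤ τ₁ + (30 * i + 3) ∧ M' 0 = M 0 ∧ M' 2 = M 2 ∧ M' 3 = M 3 ∧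
        M' 10 = M 10 ∧ M' 15 = M₁ 15 ∧ ∀ j < i, M' 16 j = (pos (lower j) : ℕ) ∧
          M' 17 j = (pos (upper j) : ℕ)) (τ₁ + (30 * m + 3)) ?_ ?_ ?_ ?_ ?_
    · intro i M' τ' hi h
      have := h.1
      omega
    · intro i M' τ' hi h
      simp [h.2.1, h01]
    · simp [a0, a2, a3, a10]
    · rintro i M' τ' hi ⟨hτ, e0, e2, e3, e10, e15, e16⟩ hv
      simp [e0, e2, e3, e10, e15, hv, h2 i hi, h3 i hi, h10 _ (hlower i hi), h10 _ (hupper i hi)]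
      refine ⟨by omega, fun j hj => ?_⟩
      obtain hj | rfl := Nat.lt_or_eq_of_le hj
      · simp [hj.ne, e16 j hj]
      · simp
    · rintro M' τ' ⟨hτ, e0, e2, e3, e10, e15, e16⟩ hv
      simp only [cost_load, cost_const]
      exact ⟨by omega, by rwa [e15], fun i hi => (e16 i hi).1, fun i hi => (e16 i hi).2⟩

/-- Compute the sums of the weights of the paths through every node. -/
def sumWeights : Cmd :=
  .seq (forLoop 12 (load 0 (const 1))
      (.seq (.store 18 (load 16 (var 12)) (load 18 (load 16 (var 12)) + load 4 (var 12)))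
        (.store 18 (load 17 (var 12)) (load 18 (load 17 (var 12)) - load 4 (var 12)))))
    (forLoop 12 (var 0 - const 1)
      (.store 18 (load 15 (var 12)) (load 18 (load 15 (var 12)) + load 18 (var 12))))

theorem abs_ite_sub_ite_le {P Q : Prop} [Decidable P] [Decidable Q] {a W : ℤ} (h : |a| ≤ W) :
    |(if P then a else 0) - (if Q then a else 0)| ≤ 2 * W := by
  have h0 := abs_nonneg a
  rw [abs_le] at h ⊢
  split_ifs <;> omega

theorem abs_sum_range_le {n : ℕ} {f : ℕ → ℤ} {W : ℤ} (h : ∀ i < n, |f i| ≤ W) :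
    |∑ i ∈ Finset.range n, f i| ≤ n * W := by
  refine (Finset.abs_sum_le_sum_abs _ _).trans ?_
  refine (Finset.sum_le_card_nsmul _ _ W fun i hi => h i (by simpa using hi)).trans ?_
  simp

open scoped Classical in
theorem sumWeights_spec {B : ℕ} (hB : 16 ≤ B) (hq : q < B) (hm : m < B) {W : ℕ}
    (hW : 2 * m * W * (q + 1) ≤ B) (T : OrderedTree q p) {lo up : ℕ → ℕ} {w : ℕ → ℤ}
    (hlo : ∀ i < m, lo i < q) (hup : ∀ i < m, up i < q) (hw : ∀ i < m, |w i| ≤ W)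
    {M : Memory} {τ : ℕ} (h00 : M 0 0 = q) (h01 : M 0 1 = m) (h4 : ∀ i < m, M 4 i = w i)
    (h15 : ∀ i < q, M 15 i = p i) (h16 : ∀ i < m, M 16 i = lo i) (h17 : ∀ i < m, M 17 i = up i)
    (h18 : M 18 = 0) :
    sumWeights.VC B (fun M' τ' => τ' ≤ τ + (50 * q + 50 * m + 40) ∧
      ∀ x < q, M' 18 x = ∑ i ∈ Finset.range m,
        ((if Anc p (lo i) x then w i else 0) - (if Anc p (up i) x then w i else 0))) M τ := by
  have hq0 := T.pos
  set S : ℕ → ℕ → ℤ := fun n x => ∑ i ∈ Finset.range n,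
    ((if lo i = x then w i else 0) - (if up i = x then w i else 0)) with hS
  set F : ℕ → ℤ := fun x => ∑ i ∈ Finset.range m,
    ((if Anc p (lo i) x then w i else 0) - (if Anc p (up i) x then w i else 0)) with hF
  have hSle : ∀ n ≤ m, ∀ x, |S n x| ≤ m * (2 * W) := by
    intro n hn x
    refine (abs_sum_range_le (W := 2 * W) fun i hi =>
      abs_ite_sub_ite_le (hw i (by omega))).trans ?_
    gcongr
  have hFle : ∀ x, |F x| ≤ m * (2 * W) := by
    intro x
    exact abs_sum_range_le fun i hi => abs_ite_sub_ite_le (hw i hi)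
  have hB2 : (m * (2 * W) : ℤ) * (q + 1) ≤ B := by
    have : ((2 * m * W * (q + 1) : ℕ) : ℤ) ≤ B := by exact_mod_cast hW
    push_cast at this
    linarith
  have hB1 : (m * (2 * W) : ℤ) ≤ B := by
    refine le_trans ?_ hB2
    exact le_mul_of_one_le_right (by positivity) (by linarith [Int.natCast_nonneg q])
  refine vc_seq (P := fun M' τ' => τ' ≤ τ + (50 * m + 20) ∧ ∀ x : ℕ, M' 18 x = S m x) ?_ ?_
  · refine vc_for hB (n := m) hm.le
      (fun i M' τ' => τ' ≤ τ + (50 * i + 3) ∧ M' 0 = M 0 ∧ M' 4 = M 4 ∧ M' 16 = M 16 ∧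
        M' 17 = M 17 ∧ ∀ x : ℕ, M' 18 x = S i x) (τ + (50 * m + 3)) ?_ ?_ ?_ ?_ ?_
    · intro i M' τ' hi h
      have := h.1
      omega
    · intro i M' τ' hi h
      simp [h.2.1, h01]
    · simp [hS, h18]
    · rintro i M' τ' hi ⟨hτ, e0, e4, e16, e17, e18⟩ hv
      have hnext : ∀ x : ℕ, S (i + 1) x = S i x + (if lo i = x then w i else 0) -
          (if up i = x then w i else 0) := by
        intro x
        simp only [hS, Finset.sum_range_succ]
        ring
      have hmid : ∀ x : ℕ, |S i x + w i| ≤ B := by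
        intro x
        have h1 : |S i x| ≤ i * (2 * W) :=
          abs_sum_range_le fun j hj => abs_ite_sub_ite_le (hw j (by omega))
        have h2 := hw i hi
        have h3 : ((i : ℤ) + 1) * (2 * W) ≤ m * (2 * W) := by
          gcongr
          exact_mod_cast hi
        have := abs_add_le (S i x) (w i)
        linarith
      have hmid1 := abs_le.1 (hmid (lo i))
      have hend1 := abs_le.1 ((hSle (i + 1) hi (up i)).trans hB1)
      have hx := hnext (up i)
      rw [if_pos rfl] at hx
      simp [e0, e4, e16, e17, e18, hv, h4 i hi, h16 i hi, h17 i hi]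
      by_cases hlu : up i = lo i
      · simp only [hlu, if_true] at hx hend1 ⊢
        refine ⟨by omega, by omega, by omega, fun x => ?_⟩
        rw [hnext, hlu]
        by_cases hxl : x = lo i
        · subst hxl
          simp
        · simp [hxl, Ne.symm hxl]
      · simp only [hlu, Ne.symm hlu, if_false] at hx ⊢
        refine ⟨by omega, by omega, by omega, fun x => ?_⟩
        rw [hnext]
        by_cases hxl : x = lo i
        · subst hxl
          simp [hlu, Ne.symm hlu]
        · by_cases hxu : x = up i
          · subst hxu
            simp [Ne.symm hxl]
          · simp [hxl, hxu, Ne.symm hxl, Ne.symm hxu]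
    · rintro M' τ' ⟨hτ, e0, e4, e16, e17, e18⟩ hv
      simp only [cost_load, cost_const]
      exact ⟨by omega, e18⟩
  · rintro M₁ τ₁ ⟨hτ₁, hS₁⟩ f₁
    have a0 : M₁ 0 = M 0 := f₁ 0 (by decide)
    have a15 : M₁ 15 = M 15 := f₁ 15 (by decide)
    have hrec : ∀ x, F x = S m x +
        ∑ c ∈ (Finset.range (q - 1)).filter (fun c => p c = x), F c := by
      intro x
      simp only [hF, hS]
      rw [Finset.sum_comm, ← Finset.sum_add_distrib]
      refine Finset.sum_congr rfl fun i hi => ?_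
      rw [Finset.mem_range] at hi
      rw [T.indicator_anc (hlo i hi), T.indicator_anc (hup i hi), Finset.sum_sub_distrib]
      ring
    have hle : ∀ i ≤ q - 1, ∀ x, |S m x +
        ∑ c ∈ (Finset.range i).filter (fun c => p c = x), F c| ≤ B := by
      intro i hi x
      rw [Finset.sum_filter]
      have h1 : |∑ c ∈ Finset.range i, if p c = x then F c else 0| ≤ i * (m * (2 * W)) := by
        refine abs_sum_range_le fun c hc => ?_
        split_ifs
        · exact hFle c
        · simp only [abs_zero]
          positivity
      have h2 : (i : ℤ) * (m * (2 * W)) ≤ q * (m * (2 * W)) := by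
        gcongr
        omega
      have h3 := hSle m le_rfl x
      have h4 := abs_add_le (S m x) (∑ c ∈ Finset.range i, if p c = x then F c else 0)
      linarith
    refine vc_for hB (n := q - 1) (by omega)
      (fun i M' τ' => τ' ≤ τ₁ + (50 * i + 3) ∧ M' 0 = M 0 ∧ M' 15 = M 15 ∧
        ∀ x : ℕ, M' 18 x = S m x + ∑ c ∈ (Finset.range i).filter (fun c => p c = x), F c)
      (τ₁ + (50 * q + 3)) ?_ ?_ ?_ ?_ ?_
    · intro i M' τ' hi h
      have := h.1
      omega
    · intro i M' τ' hi h
      simp [h.2.1, h00]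
      omega
    · simp [a0, a15, hS₁]
    · rintro i M' τ' hi ⟨hτ, e0, e15, e18⟩ hv
      have hpi := T.lt_parent i (by omega)
      have hi18 : M' 18 i = F i := by
        rw [e18, hrec]
        congr 1
        refine Finset.sum_subset ?_ ?_
        · intro c hc
          simp only [Finset.mem_filter, Finset.mem_range] at hc ⊢
          exact ⟨by omega, hc.2⟩
        · intro c hc hc'
          simp only [Finset.mem_filter, Finset.mem_range] at hc hc'
          have := T.lt_parent c (by omega)
          exact absurd ⟨by omega, hc.2⟩ hc'
      have hnext : ∀ x : ℕ, ∑ c ∈ (Finset.range (i + 1)).filter (fun c => p c = x), F c =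
          (if x = p i then F i else 0) +
            ∑ c ∈ (Finset.range i).filter (fun c => p c = x), F c := by
        intro x
        rw [Finset.sum_filter, Finset.sum_filter, Finset.sum_range_succ, add_comm]
        simp only [eq_comm]
      have hb := abs_le.1 (hle (i + 1) (by omega) (p i))
      rw [hnext, if_pos rfl] at hb
      simp [e0, e15, hv, h15 i (by omega), hi18, hnext]
      rw [e18]
      refine ⟨by omega, by omega, fun x => ?_⟩
      split_ifs with h
      · subst h
        ring
      · rw [e18]
        ring
    · rintro M' τ' ⟨hτ, e0, e15, e18⟩ hv
      simp only [cost_sub, cost_var, cost_const]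
      exact ⟨by omega, fun x _ => by rw [e18, ← hrec]⟩

end WordRAM

/-!
# Sorting the paths by their weights
-/

namespace WordRAM

open WordRAM.Expr WordRAM.Cmd

/-- The array `f` holds the list `l`, from the index `o` on. -/
def Holds (f : ℤ → ℤ) (o : ℤ) (l : List ℕ) : Prop := ∀ (k x : ℕ), l[k]? = some x → f (o + k) = x

theorem Holds.nil (f : ℤ → ℤ) (o : ℤ) : Holds f o [] := by
  intro k x h
  simp at h

theorem Holds.congr {f g : ℤ → ℤ} {o : ℤ} {l : List ℕ} (h : Holds f o l)
    (hg : ∀ k < l.length, g (o + k) = f (o + k)) : Holds g o l := by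
  intro k x hx
  rw [hg k (List.getElem?_eq_some_iff.1 hx).1]
  exact h k x hx

theorem Holds.append {f g : ℤ → ℤ} {o : ℤ} {l : List ℕ} {x : ℕ} (h : Holds f o l)
    (hg : ∀ k < l.length, g (o + k) = f (o + k)) (hx : g (o + l.length) = x) :
    Holds g o (l ++ [x]) := by
  intro k y hy
  by_cases hk : k < l.length
  · rw [List.getElem?_append_left hk] at hy
    rw [hg k hk]
    exact h k y hy
  · have hlen := (List.getElem?_eq_some_iff.1 hy).1
    simp only [List.length_append, List.length_singleton] at hlen
    obtain rfl : k = l.length := by omega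
    simp only [List.getElem?_concat_length, Option.some.injEq] at hy
    rw [hx, hy]

theorem Holds.get {f : ℤ → ℤ} {o : ℤ} {l : List ℕ} (h : Holds f o l) {k : ℕ}
    (hk : k < l.length) : f (o + k) = l[k] :=
  h k _ (List.getElem?_eq_getElem hk)

section RadixPass

variable (b : ℕ) (dig : ℕ → ℕ) (l : List ℕ)

/-- The elements of `l` with the digit `d`. -/
def bucket (d : ℕ) : List ℕ := l.filter fun x => dig x = d

/-- The concatenation of the first `n` buckets. -/
def radixPass (n : ℕ) : List ℕ := (List.range n).flatMap (bucket dig l)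

theorem radixPass_succ (n : ℕ) :
    radixPass dig l (n + 1) = radixPass dig l n ++ bucket dig l n := by
  simp [radixPass, List.range_succ]

variable {b dig l}

theorem radixPass_perm (h : ∀ x ∈ l, dig x < b) : (radixPass dig l b).Perm l := by
  rw [List.perm_iff_count]
  intro x
  rw [radixPass, List.count_flatMap]
  by_cases hx : x ∈ l
  · have h1 : ∀ d, (List.count x ∘ bucket dig l) d = if d = dig x then List.count x l else 0 := by
      intro d
      simp only [Function.comp, bucket]
      split_ifs with hd
      · rw [List.count_filter]
        simp [hd]
      · rw [List.count_eq_zero]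
        simp [Ne.symm hd]
    have h2 : ∀ n, (List.map (List.count x ∘ bucket dig l) (List.range n)).sum =
        if dig x < n then List.count x l else 0 := by
      intro n
      induction n with
      | zero => simp
      | succ n ih =>
        rw [List.sum_range_succ, ih, h1]
        split_ifs <;> omega
    rw [h2, if_pos (h x hx)]
  · rw [List.count_eq_zero.2 hx, List.sum_eq_zero]
    intro c hc
    obtain ⟨d, -, rfl⟩ := List.mem_map.1 hc
    rw [Function.comp, List.count_eq_zero]
    exact fun h' => hx (List.mem_filter.1 h').1

theorem radixPass_length_le (h : ∀ x ∈ l, dig x < b) {n : ℕ} (hn : n ≤ b) :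
    (radixPass dig l n).length ≤ l.length := by
  rw [← (radixPass_perm h).length_eq]
  exact ((List.range_sublist.2 hn).flatMap _).length_le

theorem radixPass_sorted {key : ℕ → ℕ} {P : ℕ}
    (hl : l.Pairwise fun x y => key x % P ≤ key y % P) :
    (radixPass (fun x => key x / P % b) l b).Pairwise
      fun x y => key x % (P * b) ≤ key y % (P * b) := by
  rw [radixPass, List.pairwise_flatMap]
  refine ⟨fun d _ => ?_, ?_⟩
  · rw [bucket, List.pairwise_filter]
    refine hl.imp fun h hx hy => ?_
    simp only [decide_eq_true_eq] at hx hy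
    rw [Nat.mod_mul, Nat.mod_mul, hx, hy]
    omega
  · refine List.pairwise_lt_range.imp fun {d e} hde x hx y hy => ?_
    simp only [bucket, List.mem_filter, decide_eq_true_eq] at hx hy
    rw [Nat.mod_mul, Nat.mod_mul, hx.2, hy.2]
    obtain rfl | hP := Nat.eq_zero_or_pos P
    · simp at hx hy
      omega
    · have := Nat.mod_lt (key x) hP
      have h2 : P * (d + 1) ≤ P * e := Nat.mul_le_mul_left _ hde
      rw [Nat.mul_add] at h2
      omega

end RadixPass
/-- Compute the keys of the paths, in decreasing order of the weights. -/
def makeKeys : Cmd :=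
  .seq (forLoop 12 (load 0 (const 1))
      (.seq (.ite (lt (var 19) (load 4 (var 12))) (assign 19 (load 4 (var 12))) .skip)
        (.ite (lt (var 19) (const 0 - load 4 (var 12))) (assign 19 (const 0 - load 4 (var 12))) .skip)))
    (forLoop 12 (load 0 (const 1))
      (.seq (.store 20 (var 12) (var 19 - load 4 (var 12))) (.store 23 (var 12) (var 12))))

/-- Distribute the paths to the buckets. -/
def distribute : Cmd :=
  forLoop 12 (load 0 (const 1))
    (.seq (assign 13 (load 23 (var 12)))
    (.seq (assign 28 (load 20 (var 13) / var 22 % var 48))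
    (.seq (.store 24 (var 28 * load 0 (const 1) + load 25 (var 28)) (var 13))
      (.store 25 (var 28) (load 25 (var 28) + const 1)))))

/-- Concatenate the buckets. -/
def collect : Cmd :=
  .seq (assign 26 (const 0))
    (forLoop 12 (var 48)
      (.seq (forLoop 27 (load 25 (var 12))
          (.seq (.store 23 (var 26) (load 24 (var 12 * load 0 (const 1) + var 27)))
            (assign 26 (var 26 + const 1))))
        (.store 25 (var 12) (const 0))))

def sortPaths : Cmd :=
  .seq makeKeys
  (.seq (assign 48 (var 0 + load 0 (const 1) + const 1))
  (.seq (assign 21 (var 19 + var 19))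
  (.seq (assign 22 (const 1))
    (.while (beq (lt (var 21) (var 22)) (const 0))
      (.seq distribute (.seq collect (assign 22 (var 22 * var 48))))))))

variable {m : ℕ}

theorem makeKeys_spec {B : ℕ} (hB : 16 ≤ B) (hm : m < B) {W : ℕ} (hW : 2 * W ≤ B) {w : ℕ → ℤ}
    (hw : ∀ i < m, |w i| ≤ W) {M : Memory} {τ : ℕ} (h01 : M 0 1 = m) (h4 : ∀ i < m, M 4 i = w i)
    (h19 : M 19 = 0) :
    makeKeys.VC B (fun M' τ' => τ' ≤ τ + (120 * m + 40) ∧ ∃ X : ℕ, X ≤ W ∧ M' 19 0 = X ∧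
      (∀ i < m, |w i| ≤ X) ∧ (∀ i < m, M' 20 i = X - w i) ∧ ∀ i < m, M' 23 i = (i : ℕ)) M τ := by
  refine vc_seq (P := fun M' τ' => τ' ≤ τ + (60 * m + 20) ∧ ∃ X : ℕ, X ≤ W ∧ M' 19 0 = X ∧
      (∀ i < m, |w i| ≤ X)) ?_ ?_
  · refine vc_for hB (n := m) hm.le
      (fun i M' τ' => τ' ≤ τ + (60 * i + 3) ∧ M' 0 = M 0 ∧ M' 4 = M 4 ∧
        ∃ X : ℕ, X ≤ W ∧ M' 19 0 = X ∧ (∀ j < i, |w j| ≤ X)) (τ + (60 * m + 3)) ?_ ?_ ?_ ?_ ?_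
    · intro i M' τ' hi h
      have := h.1
      omega
    · intro i M' τ' hi h
      simp [h.2.1, h01]
    · exact ⟨by omega, by simp, by simp, 0, by omega, by simp [h19],
        by simp⟩
    · rintro i M' τ' hi ⟨hτ, e0, e4, X, hX, e19, hle⟩ hv
      have hwi := hw i hi
      rw [abs_le] at hwi
      have hstep : ∀ Y : ℕ, (X : ℤ) ≤ Y → -(Y : ℤ) ≤ w i → w i ≤ Y → ∀ j < i + 1, |w j| ≤ Y := by
        intro Y hY h1 h2 j hj
        obtain hj | rfl := Nat.lt_succ_iff_lt_or_eq.1 hj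
        · exact (hle j hj).trans hY
        · exact abs_le.2 ⟨h1, h2⟩
      simp [hv, e0, e4, h4 i hi, e19]
      refine ⟨fun h => ⟨by omega, fun h' => ⟨by omega, by omega, (-w i).toNat, by omega,
        by omega, ?_⟩, fun h' => ⟨by omega, (w i).toNat, by omega, by omega, ?_⟩⟩,
        fun h => ⟨by omega, fun h' => ⟨by omega, by omega, (-w i).toNat, by omega,
        by omega, ?_⟩, fun h' => ⟨by omega, hX, ?_⟩⟩⟩
      all_goals
        intro j hj
        refine hstep _ ?_ ?_ ?_ j (by omega) <;> omega
    · rintro M' τ' ⟨hτ, e0, e4, h⟩ hv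
      simp only [cost_load, cost_const]
      exact ⟨by omega, h⟩
  · rintro M₁ τ₁ ⟨hτ₁, X, hX, e19, hle⟩ f₁
    have a0 : M₁ 0 = M 0 := f₁ 0 (by decide)
    have a4 : M₁ 4 = M 4 := f₁ 4 (by decide)
    refine vc_for hB (n := m) hm.le
      (fun i M' τ' => τ' ≤ τ₁ + (60 * i + 3) ∧ M' 0 = M 0 ∧ M' 4 = M 4 ∧ M' 19 0 = X ∧
        ∀ j < i, M' 20 j = X - w j ∧ M' 23 j = (j : ℕ)) (τ₁ + (60 * m + 3)) ?_ ?_ ?_ ?_ ?_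
    · intro i M' τ' hi h
      have := h.1
      omega
    · intro i M' τ' hi h
      simp [h.2.1, h01]
    · simp [a0, a4, e19]
    · rintro i M' τ' hi ⟨hτ, e0, e4, e19, h⟩ hv
      have hwi := hle i hi
      rw [abs_le] at hwi
      simp [e0, e4, e19, hv, h4 i hi]
      refine ⟨by omega, by omega, fun j hj => ?_⟩
      obtain hj | rfl := Nat.lt_or_eq_of_le hj
      · simp [hj.ne, h j hj]
      · simp
    · rintro M' τ' ⟨hτ, e0, e4, e19, h⟩ hv
      simp only [cost_load, cost_const]
      exact ⟨by omega, X, hX, e19, hle, fun i hi => (h i hi).1, fun i hi => (h i hi).2⟩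

theorem distribute_spec {B : ℕ} (hB : 16 ≤ B) {b : ℕ} (hb : 0 < b) (hmb : b * m + m ≤ B)
    {l : List ℕ} (hl : l.length = m) (hlm : ∀ x ∈ l, x < m) {key : ℕ → ℕ} {P : ℕ} (hP : 0 < P)
    {M : Memory} {τ : ℕ} (h01 : M 0 1 = m) (h20 : ∀ i < m, M 20 i = key i) (h22 : M 22 0 = P)
    (h48 : M 48 0 = b) (h23 : Holds (M 23) 0 l) (h25 : ∀ d < b, M 25 d = 0) :
    distribute.VC B (fun M' τ' => τ' ≤ τ + (60 * m + 20) ∧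
      ∀ d < b, M' 25 d = (bucket (fun x => key x / P % b) l d).length ∧
        Holds (M' 24) (d * m) (bucket (fun x => key x / P % b) l d)) M τ := by
  set dig : ℕ → ℕ := fun x => key x / P % b with hdig
  have hdlt : ∀ x, dig x < b := fun x => Nat.mod_lt _ hb
  have hmB : m ≤ B := by
    have := Nat.le_mul_of_pos_left m hb
    omega
  refine vc_for hB (n := m) hmB
    (fun i M' τ' => τ' ≤ τ + (60 * i + 3) ∧ M' 0 = M 0 ∧ M' 20 = M 20 ∧ M' 22 = M 22 ∧
      M' 23 = M 23 ∧ M' 48 = M 48 ∧ ∀ d < b, M' 25 d = (bucket dig (l.take i) d).length ∧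
        Holds (M' 24) (d * m) (bucket dig (l.take i) d)) (τ + (60 * m + 3)) ?_ ?_ ?_ ?_ ?_
  · intro i M' τ' hi h
    have := h.1
    omega
  · intro i M' τ' hi h
    simp [h.2.1, h01]
  · simp [bucket, Holds.nil]
    exact h25
  · rintro i M' τ' hi ⟨hτ, e0, e20, e22, e23, e48, h⟩ hv
    have hil : i < l.length := by omega
    set x := l[i] with hx
    have hxm : x < m := hlm x (List.getElem_mem hil)
    have e23' : M 23 i = x := by simpa using h23.get hil
    have hd := hdlt x
    have hlen : ∀ d, (bucket dig (l.take i) d).length ≤ i := by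
      intro d
      refine (List.length_filter_le _ _).trans ?_
      simp
    have hc := (h (dig x) hd).1
    have hcl := hlen (dig x)
    set c := (bucket dig (l.take i) (dig x)).length with hcdef
    have hnext : ∀ d, bucket dig (l.take (i + 1)) d =
        if d = dig x then bucket dig (l.take i) d ++ [x] else bucket dig (l.take i) d := by
      intro d
      rw [List.take_add_one, List.getElem?_eq_getElem hil, bucket, List.filter_append]
      split_ifs with hdx
      · subst hdx
        simp [bucket, ← hx]
      · simp [bucket, ← hx, Ne.symm hdx]
    have hdm : dig x * m + m ≤ b * m := by
      have := Nat.mul_le_mul_right m (Nat.succ_le_of_lt hd)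
      rwa [Nat.succ_mul] at this
    have hdm0 : 0 ≤ (dig x : ℤ) * m := by positivity
    have hdmB : (dig x : ℤ) * m + m ≤ B := by
      have : dig x * m + m ≤ B := by omega
      exact_mod_cast this
    have hdval : (key x : ℤ) / P % b = (dig x : ℤ) := by simp [hdig]
    simp only [vc_seq_iff, vc_assign, vc_store]
    simp [e0, e20, e22, e23, e48, hv, h01, e23', h20 x hxm, h22, h48, hdval, hc]
    refine ⟨by omega, by omega, by omega, by omega, fun d hdb => ?_⟩
    rw [hnext]
    split_ifs with hdx
    · subst hdx
      refine ⟨by simp [hcdef], (h _ hd).2.append ?_ ?_⟩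
      · intro k hk
        rw [Memory.set_same, if_neg (by omega)]
        simp
      · simp [hcdef]
    · refine ⟨(h d hdb).1, (h d hdb).2.congr ?_⟩
      intro k hk
      rw [Memory.set_same, if_neg]
      · simp
      intro heq
      have h1 : d * m + k = dig x * m + c := by exact_mod_cast heq
      have h2 := (hlen d)
      obtain h3 | h3 := Nat.lt_or_gt_of_ne hdx
      · have := Nat.mul_le_mul_right m (Nat.succ_le_of_lt h3)
        rw [Nat.succ_mul] at this
        omega
      · have := Nat.mul_le_mul_right m (Nat.succ_le_of_lt h3)
        rw [Nat.succ_mul] at this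
        omega
  · rintro M' τ' ⟨hτ, e0, e20, e22, e23, e48, h⟩ hv
    rw [← hl, List.take_length] at h
    simp only [cost_load, cost_const]
    refine ⟨by omega, ?_⟩
    rwa [hl] at h

theorem collect_spec {B : ℕ} (hB : 16 ≤ B) {b : ℕ} (hb : 0 < b) (hmb : b * m + m ≤ B) (hbB : b ≤ B)
    {l : List ℕ} (hl : l.length = m) {dig : ℕ → ℕ} (hdig : ∀ x ∈ l, dig x < b)
    {M : Memory} {τ : ℕ} (h01 : M 0 1 = m) (h48 : M 48 0 = b)
    (h25 : ∀ d < b, M 25 d = (bucket dig l d).length ∧ Holds (M 24) (d * m) (bucket dig l d)) :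
    collect.VC B (fun M' τ' => τ' ≤ τ + (60 * b + 60 * m + 40) ∧
      Holds (M' 23) 0 (radixPass dig l b) ∧ ∀ d < b, M' 25 d = 0) M τ := by
  have hmB : m ≤ B := by
    have := Nat.le_mul_of_pos_left m hb
    omega
  have hpass : ∀ n ≤ b, (radixPass dig l n).length ≤ m := fun n hn => by
    rw [← hl]
    exact radixPass_length_le hdig hn
  rw [collect, vc_seq_iff, vc_assign]
  refine ⟨by simp, ?_⟩
  refine vc_for hB (n := b) hbB
    (fun d M' τ' => τ' ≤ τ + (60 * d + 60 * (radixPass dig l d).length + 10) ∧ M' 0 = M 0 ∧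
      M' 48 = M 48 ∧ M' 24 = M 24 ∧ M' 26 0 = (radixPass dig l d).length ∧
      Holds (M' 23) 0 (radixPass dig l d) ∧ ∀ e < b, M' 25 e = if e < d then 0 else M 25 e)
      (τ + (60 * b + 60 * m + 10)) ?_ ?_ ?_ ?_ ?_
  · intro d M' τ' hd h
    have := h.1
    have := hpass d hd
    omega
  · intro d M' τ' hd h
    simp [h.2.2.1, h48]
  · simp [radixPass, Holds.nil]
  · rintro d M' τ' hd ⟨hτ, e0, e48, e24, e26, hH, e25⟩ hv
    obtain ⟨hlen, hbk⟩ := h25 d hd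
    have hd25 : M' 25 d = (bucket dig l d).length := by rw [e25 d hd, if_neg (by omega), hlen]
    have hp1 := hpass (d + 1) hd
    rw [radixPass_succ, List.length_append] at hp1
    set acc := radixPass dig l d with hacc
    set bk := bucket dig l d with hbkdef
    have hdm : d * m + m ≤ b * m := by
      have := Nat.mul_le_mul_right m (Nat.succ_le_of_lt hd)
      rwa [Nat.succ_mul] at this
    have hdm0 : 0 ≤ (d : ℤ) * m := by positivity
    have hdmB : (d : ℤ) * m + m ≤ B := by
      have : d * m + m ≤ B := by omega
      exact_mod_cast this
    rw [vc_seq_iff, cost_var]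
    refine vc_for hB (n := bk.length) (by omega)
      (fun j M'' τ'' => τ'' ≤ τ' + (60 * j + 11) ∧ M'' 0 = M 0 ∧ M'' 48 = M 48 ∧ M'' 24 = M 24 ∧
        M'' 25 = M' 25 ∧ M'' 12 0 = d ∧ M'' 26 0 = acc.length + j ∧
        Holds (M'' 23) 0 (acc ++ bk.take j)) (τ' + (60 * bk.length + 11)) ?_ ?_ ?_ ?_ ?_
    · intro j M'' τ'' hj h
      have := h.1
      omega
    · intro j M'' τ'' hj h
      simp [h.2.2.2.2.1, h.2.2.2.2.2.1, hd25]
    · simp [e0, e48, e24, e26, hv, hH]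
    · rintro j M'' τ'' hj ⟨hτ', g0, g48, g24, g25, g12, g26, gH⟩ hv'
      have hval := hbk.get hj
      simp only [vc_seq_iff, vc_store, vc_assign]
      simp [g0, g48, g24, g25, g12, g26, hv', h01, hval]
      refine ⟨by omega, by omega, by omega, by ring, ?_⟩
      rw [List.take_add_one, List.getElem?_eq_getElem hj, ← List.append_assoc]
      refine gH.append ?_ ?_
      · intro k hk
        rw [List.length_append, List.length_take] at hk
        simp
        intro heq
        omega
      · simp [Nat.min_eq_left hj.le]
    · rintro M'' τ'' ⟨hτ', g0, g48, g24, g25, g12, g26, gH⟩ hv'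
      rw [List.take_length] at gH
      simp only [vc_store]
      simp [g12, g0, g48, g24, g26, g25, radixPass_succ, ← hacc, ← hbkdef]
      refine ⟨by omega, gH, fun e he => ?_⟩
      by_cases hed : e = d
      · simp [hed]
      · have : (e < d) ↔ (e ≤ d) := by omega
        simp [hed, e25 e he, this]
  · rintro M' τ' ⟨hτ, e0, e48, e24, e26, hH, e25⟩ hv
    have := hpass b le_rfl
    simp only [cost_var]
    refine ⟨by omega, hH, fun d hd => ?_⟩
    rw [e25 d hd, if_pos hd]

theorem sortPaths_spec {B : ℕ} (hB : 16 ≤ B) {q : ℕ} (hq : 0 < q) {b : ℕ} (hb : b = q + m + 1)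
    (hmb : b * m + m ≤ B) (hbB : b ≤ B) {W : ℕ} (e : ℕ) (hWe : 2 * W < b ^ e) (hbe : b ^ e ≤ B)
    {w : ℕ → ℤ} (hw : ∀ i < m, |w i| ≤ W) {M : Memory} {τ : ℕ} (h00 : M 0 0 = q)
    (h01 : M 0 1 = m) (h4 : ∀ i < m, M 4 i = w i) (h19 : M 19 = 0) (h25 : M 25 = 0) :
    sortPaths.VC B (fun M' τ' => τ' ≤ τ + (300 * (e + 1) * b + 300) ∧
      ∃ l : List ℕ, l.Perm (List.range m) ∧ Holds (M' 23) 0 l ∧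
        l.Pairwise fun i j => w j ≤ w i) M τ := by
  refine vc_seq (makeKeys_spec hB (by omega) (by omega) hw h01 h4 h19) ?_
  rintro M₁ τ₁ ⟨hτ₁, X, hXW, e19, hle, e20, e23⟩ f₁
  have a0 : M₁ 0 = M 0 := f₁ 0 (by decide)
  have a25 : M₁ 25 = M 25 := f₁ 25 (by decide)
  clear f₁
  set key : ℕ → ℕ := fun i => (X - w i).toNat with hkey
  have hkeyval : ∀ i < m, (key i : ℤ) = X - w i := by
    intro i hi
    have := abs_le.1 (hle i hi)
    simp only [hkey]
    omega
  have hkeyle : ∀ i < m, key i ≤ 2 * X := by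
    intro i hi
    have := abs_le.1 (hle i hi)
    have := hkeyval i hi
    omega
  simp only [vc_seq_iff, vc_assign]
  simp [a0, h00, h01, e19]
  refine ⟨⟨by omega, by omega, by omega⟩, by omega, ?_⟩
  refine vc_while hB (fun M' τ' => ∃ r ≤ e, τ' ≤ τ + (300 * (r + 1) * b + 200) ∧
    M' 0 = M 0 ∧ (∀ i < m, M' 20 i = key i) ∧ M' 21 0 = X + X ∧ M' 22 0 = (b ^ r : ℕ) ∧
    M' 48 0 = b ∧ (∀ d < b, M' 25 d = 0) ∧ ∃ l : List ℕ, l.Perm (List.range m) ∧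
      Holds (M' 23) 0 l ∧ l.Pairwise fun i j => key i % b ^ r ≤ key j % b ^ r)
    (τ + (300 * (e + 1) * b + 200)) ?_ ?_
  · refine ⟨0, Nat.zero_le _, by omega, by simp [a0], ?_, by simp, by simp, by simp [hb],
      by simp [a25, h25], List.range m, List.Perm.refl _, ?_, ?_⟩
    · intro i hi
      simp [e20 i hi, hkeyval i hi]
    · intro k x hx
      obtain ⟨hk, rfl⟩ := List.getElem?_eq_some_iff.1 hx
      simp only [List.length_range] at hk
      simp [e23 k hk]
    · simp [Nat.mod_one, List.pairwise_of_forall]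
  · rintro M' τ' ⟨r, hr, hτ', e0, e20, e21, e22, e48, e25, l, hperm, hH, hsort⟩
    have hlen : l.length = m := by simpa using hperm.length_eq
    have hlm : ∀ x ∈ l, x < m := fun x hx => by simpa using hperm.mem_iff.1 hx
    have hb0 : 0 < b := by omega
    have hmono : 300 * (r + 1) * b ≤ 300 * (e + 1) * b := by gcongr
    refine ⟨by omega, by simp, fun hne => ?_, fun hz => ?_⟩
    · simp [e21, e22] at hne
      have hne' : b ^ r ≤ 2 * X := by
        have : ((b ^ r : ℕ) : ℤ) ≤ X + X := by push_cast; exact hne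
        omega
      have hre : r < e := by
        by_contra hcon
        have : r = e := by omega
        subst this
        omega
      have hpow : 0 < b ^ r := by positivity
      have hpow2 : b ^ (r + 1) ≤ b ^ e := Nat.pow_le_pow_right hb0 hre
      refine vc_seq (distribute_spec hB hb0 hmb hlen hlm hpow (by rw [e0, h01]) e20 e22 e48 hH
        e25) ?_
      rintro M₂ τ₂ ⟨hτ₂, hbk⟩ f₂
      have c0 : M₂ 0 = M' 0 := f₂ 0 (by decide)
      have c20 : M₂ 20 = M' 20 := f₂ 20 (by decide)
      have c21 : M₂ 21 = M' 21 := f₂ 21 (by decide)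
      have c22 : M₂ 22 = M' 22 := f₂ 22 (by decide)
      have c48 : M₂ 48 = M' 48 := f₂ 48 (by decide)
      have hdig : ∀ x ∈ l, (fun x => key x / b ^ r % b) x < b := fun x _ => Nat.mod_lt _ hb0
      refine vc_seq (collect_spec hB hb0 hmb hbB hlen hdig (by rw [c0, e0, h01]) (by rw [c48, e48])
        hbk) ?_
      rintro M₃ τ₃ ⟨hτ₃, hH₃, e25₃⟩ f₃
      have d0 : M₃ 0 = M₂ 0 := f₃ 0 (by decide)
      have d20 : M₃ 20 = M₂ 20 := f₃ 20 (by decide)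
      have d21 : M₃ 21 = M₂ 21 := f₃ 21 (by decide)
      have d22 : M₃ 22 = M₂ 22 := f₃ 22 (by decide)
      have d48 : M₃ 48 = M₂ 48 := f₃ 48 (by decide)
      clear f₂ f₃
      have hpB : (b : ℤ) ^ r * b ≤ B := by
        have : b ^ (r + 1) ≤ B := by omega
        rw [← pow_succ]
        exact_mod_cast this
      have hp0 : 0 ≤ (b : ℤ) ^ r * b := by positivity
      rw [vc_assign]
      simp [d22, c22, e22, d48, c48, e48]
      refine ⟨⟨by omega, hpB⟩, r + 1, hre, ?_, by simp [d0, c0, e0], by simpa [d20, c20] using e20,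
        by simp [d21, c21, e21], by ring, e25₃, _, (radixPass_perm hdig).trans hperm, hH₃, ?_⟩
      · have : 300 * (r + 1 + 1) * b = 300 * (r + 1) * b + 300 * b := by ring
        simp only [cost_beq, cost_lt, cost_var, cost_const] at hτ₂
        omega
      · rw [pow_succ]
        exact radixPass_sorted hsort
    · simp [e21, e22] at hz
      have hz' : 2 * X < b ^ r := by
        have : (X : ℤ) + X < ((b ^ r : ℕ) : ℤ) := by push_cast; exact hz
        omega
      simp only [cost_beq, cost_lt, cost_var, cost_const]
      refine ⟨by omega, l, hperm, hH, ?_⟩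
      refine List.Pairwise.imp_of_mem ?_ hsort
      intro i j hi hj hij
      have h1 := hkeyle i (hlm i hi)
      have h2 := hkeyle j (hlm j hj)
      rw [Nat.mod_eq_of_lt (by omega), Nat.mod_eq_of_lt (by omega)] at hij
      have h3 := hkeyval i (hlm i hi)
      have h4 := hkeyval j (hlm j hj)
      omega

end WordRAM

/-!
# Sets of bits
-/

namespace WordRAM

open WordRAM.Expr WordRAM.Cmd

theorem sum_two_pow_lt {S : Finset ℕ} {n : ℕ} (h : ∀ i ∈ S, i < n) : ∑ i ∈ S, 2 ^ i < 2 ^ n := by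
  have h1 : ∑ i ∈ S, 2 ^ i ≤ ∑ i ∈ Finset.range n, 2 ^ i :=
    Finset.sum_le_sum_of_subset fun i hi => by simpa using h i hi
  have h2 := Nat.geomSum_eq (le_refl 2) n
  have h3 : 0 < 2 ^ n := by positivity
  simp at h2
  omega

theorem testBit_sum_two_pow (S : Finset ℕ) (j : ℕ) :
    (∑ i ∈ S, 2 ^ i).testBit j = true ↔ j ∈ S := by
  induction S using Finset.induction_on_max with
  | empty => simp
  | insert a s hs ih =>
    have ha : a ∉ s := fun h => lt_irrefl _ (hs a h)
    have hlt := sum_two_pow_lt hs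
    rw [Finset.sum_insert ha, Finset.mem_insert, ← ih]
    obtain h | rfl | h := lt_trichotomy j a
    · rw [Nat.testBit_two_pow_add_gt h]
      simp [h.ne]
    · rw [Nat.testBit_two_pow_add_eq, Nat.testBit_lt_two_pow hlt]
      simp
    · have h1 : 2 ^ a + ∑ i ∈ s, 2 ^ i < 2 ^ j := by
        have : 2 ^ (a + 1) ≤ 2 ^ j := Nat.pow_le_pow_right (by norm_num) h
        rw [pow_succ] at this
        omega
      rw [Nat.testBit_lt_two_pow h1, Nat.testBit_lt_two_pow (by omega)]
      simp [h.ne']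

/-- The highest common power of two in the binary representations of `a` and `u`; it is `0` if
there is none. -/
def commonBit (a u : ℕ) : ℕ :=
  if a = 0 then 0
  else if commonBit (a / 2) (u / 2) = 0 then a % 2 * (u % 2) else 2 * commonBit (a / 2) (u / 2)
termination_by a
decreasing_by all_goals omega

theorem commonBit_zero (u : ℕ) : commonBit 0 u = 0 := by
  rw [commonBit, if_pos rfl]

theorem commonBit_eq (a u : ℕ) : commonBit a u =
    if commonBit (a / 2) (u / 2) = 0 then a % 2 * (u % 2) else 2 * commonBit (a / 2) (u / 2) := by
  by_cases h : a = 0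
  · subst h
    simp [commonBit_zero]
  · rw [commonBit, if_neg h]

theorem commonBit_le (a u : ℕ) : commonBit a u ≤ a := by
  induction a using Nat.strong_induction_on generalizing u with
  | _ a ih =>
    by_cases h : a = 0
    · subst h
      simp [commonBit_zero]
    · have := ih (a / 2) (by omega) (u / 2)
      rw [commonBit_eq]
      split_ifs
      · obtain h1 | h1 := Nat.mod_two_eq_zero_or_one u <;> rw [h1] <;> omega
      · omega

theorem commonBit_spec (a u : ℕ) :
    (commonBit a u = 0 → ∀ i, a.testBit i = true → u.testBit i = false) ∧
    (commonBit a u ≠ 0 → ∃ i, commonBit a u = 2 ^ i ∧ a.testBit i = true ∧ u.testBit i = true ∧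
      ∀ j, a.testBit j = true → u.testBit j = true → j ≤ i) := by
  induction a using Nat.strong_induction_on generalizing u with
  | _ a ih =>
    by_cases h : a = 0
    · subst h
      simp [commonBit_zero]
    · obtain ⟨ih1, ih2⟩ := ih (a / 2) (by omega) (u / 2)
      rw [commonBit_eq]
      split_ifs with h0
      · have ih1 := ih1 h0
        refine ⟨fun h1 i hi => ?_, fun h1 => ⟨0, ?_, ?_, ?_, fun j hj hj' => ?_⟩⟩
        · cases i with
          | zero =>
            rw [Nat.testBit_zero] at hi ⊢
            simp only [decide_eq_true_eq] at hi
            simpa [hi] using h1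
          | succ i =>
            rw [Nat.testBit_succ] at hi ⊢
            exact ih1 i hi
        · have h2 : a % 2 ≠ 0 := fun h => by simp [h] at h1
          have h3 : u % 2 ≠ 0 := fun h => by simp [h] at h1
          rw [Nat.mod_two_ne_zero.1 h2, Nat.mod_two_ne_zero.1 h3]
          norm_num
        · have h2 : a % 2 ≠ 0 := fun h => by simp [h] at h1
          simp [Nat.mod_two_ne_zero.1 h2]
        · have h3 : u % 2 ≠ 0 := fun h => by simp [h] at h1
          simp [Nat.mod_two_ne_zero.1 h3]
        · cases j with
          | zero => rfl
          | succ j =>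
            rw [Nat.testBit_succ] at hj hj'
            rw [ih1 j hj] at hj'
            simp at hj'
      · obtain ⟨i, h1, h2, h3, h4⟩ := ih2 h0
        refine ⟨fun h5 => by omega, fun _ => ⟨i + 1, by rw [h1]; ring, ?_, ?_, fun j hj hj' => ?_⟩⟩
        · rwa [Nat.testBit_succ]
        · rwa [Nat.testBit_succ]
        · cases j with
          | zero => omega
          | succ j =>
            rw [Nat.testBit_succ] at hj hj'
            have := h4 j hj hj'
            omega

/-- `commonBit` for sets of objects `x` that are represented by distinct bits `idx x`. -/
theorem commonBit_sum {C A U : Finset ℕ} {idx : ℕ → ℕ} (hinj : Set.InjOn idx C) (hA : A ⊆ C)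
    (hU : U ⊆ C) :
    (commonBit (∑ x ∈ A, 2 ^ idx x) (∑ x ∈ U, 2 ^ idx x) = 0 → ∀ x ∈ A, x ∉ U) ∧
    (commonBit (∑ x ∈ A, 2 ^ idx x) (∑ x ∈ U, 2 ^ idx x) ≠ 0 → ∃ x ∈ A, x ∈ U ∧
      commonBit (∑ x ∈ A, 2 ^ idx x) (∑ x ∈ U, 2 ^ idx x) = 2 ^ idx x ∧
      ∀ y ∈ A, y ∈ U → idx y ≤ idx x) := by
  have key : ∀ S : Finset ℕ, S ⊆ C → ∀ i, (∑ x ∈ S, 2 ^ idx x).testBit i = true ↔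
      ∃ x ∈ S, idx x = i := by
    intro S hS i
    have : ∑ x ∈ S, 2 ^ idx x = ∑ i ∈ S.image idx, 2 ^ i :=
      (Finset.sum_image fun x hx y hy => hinj (hS hx) (hS hy)).symm
    rw [this, testBit_sum_two_pow, Finset.mem_image]
  obtain ⟨h1, h2⟩ := commonBit_spec (∑ x ∈ A, 2 ^ idx x) (∑ x ∈ U, 2 ^ idx x)
  refine ⟨fun h x hx hxU => ?_, fun h => ?_⟩
  · have h3 := h1 h (idx x) ((key A hA _).2 ⟨x, hx, rfl⟩)
    rw [(key U hU _).2 ⟨x, hxU, rfl⟩] at h3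
    simp at h3
  · obtain ⟨i, h3, h4, h5, h6⟩ := h2 h
    obtain ⟨x, hx, rfl⟩ := (key A hA _).1 h4
    obtain ⟨y, hy, hxy⟩ := (key U hU _).1 h5
    obtain rfl := hinj (hU hy) (hA hx) hxy
    exact ⟨y, hx, hy, h3, fun z hz hz' =>
      h6 _ ((key A hA _).2 ⟨z, hz, rfl⟩) ((key U hU _).2 ⟨z, hz', rfl⟩)⟩

/-- Choose the number of bits (stored in `29`, and `4` to this power in `30`). -/
def chooseBits : Cmd :=
  .seq (assign 29 (const 1)) (.seq (assign 30 (const 4))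
    (.while (beq (lt (var 48) (const 16 * (var 30 * var 30))) (const 0))
      (.seq (assign 29 (var 29 + const 1)) (assign 30 (const 4 * var 30)))))

/-- Tabulate `commonBit` for the arguments less than `var 30`. -/
def makeTable : Cmd :=
  forLoop 12 (var 30 * var 30)
    (.seq (assign 13 (var 12 / var 30))
    (.seq (assign 14 (var 12 % var 30))
    (.seq (assign 28 (load 31 (var 13 / const 2 * var 30 + var 14 / const 2)))
      (.store 31 (var 12) (const 2 * var 28 +
        beq (var 28) (const 0) * (var 13 % const 2 * (var 14 % const 2)))))))

theorem chooseBits_spec {B : ℕ} (hB : 16 ≤ B) {N : ℕ} (hN : 0 < N) (hNB : 256 * N ≤ B)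
    {M : Memory} {τ : ℕ} (h48 : M 48 0 = N) :
    chooseBits.VC B (fun M' τ' => τ' ≤ τ + (60 * N + 60) ∧ ∃ b : ℕ, 1 ≤ b ∧ M' 29 0 = b ∧
      M' 30 0 = (4 ^ b : ℕ) ∧ N < 16 ^ (b + 1) ∧ 16 ^ b ≤ 16 * N) M τ := by
  simp only [chooseBits, vc_seq_iff, vc_assign]
  simp
  refine vc_while hB (fun M' τ' => M' 48 0 = N ∧ ∃ b : ℕ, 1 ≤ b ∧ b ≤ N ∧ M' 29 0 = b ∧
      M' 30 0 = (4 ^ b : ℕ) ∧ 16 ^ b ≤ 16 * N ∧ τ' ≤ τ + (60 * b + 6)) (τ + (60 * N + 6)) ?_ ?_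
  · exact ⟨by simp [h48], 1, by simp, by omega, by simp, by simp, by omega, by omega⟩
  · rintro M' τ' ⟨e48, b, hb, hbN, e29, e30, hle, hτ⟩
    have hsq : (4 : ℤ) ^ b * 4 ^ b = (16 ^ b : ℕ) := by
      rw [← mul_pow]
      norm_num
    have h4 : (0 : ℤ) < 4 ^ b := by positivity
    simp [e48, e29, e30, hsq]
    norm_cast
    have h16 : 0 < 16 ^ b := by positivity
    refine ⟨by omega, ⟨by omega, by omega⟩, fun h => ?_, fun h => ⟨by omega, hb, ?_, hle⟩⟩
    · have hlt : b < 16 ^ b := Nat.lt_pow_self (by norm_num)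
      have h44 : 4 ^ b ≤ 16 ^ b := Nat.pow_le_pow_left (by norm_num) b
      refine ⟨⟨by omega, by omega⟩, ⟨by omega, by omega⟩, b + 1, by omega, by omega, rfl,
        by ring, ?_, by omega⟩
      rw [pow_succ]
      omega
    · rw [pow_succ]
      omega

theorem mul_add_div_mod {x y K : ℕ} (h : y < K) : (x * K + y) / K = x ∧ (x * K + y) % K = y := by
  constructor
  · rw [mul_comm, Nat.mul_add_div (by omega), Nat.div_eq_of_lt h]
    rfl
  · rw [mul_comm, Nat.mul_add_mod, Nat.mod_eq_of_lt h]

theorem makeTable_spec {B : ℕ} (hB : 16 ≤ B) {K : ℕ} (hK : 0 < K) (hKB : 2 * (K * K) ≤ B)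
    {M : Memory} {τ : ℕ} (h30 : M 30 0 = K) (h31 : M 31 = 0) :
    makeTable.VC B (fun M' τ' => τ' ≤ τ + (80 * (K * K) + 20) ∧
      ∀ a < K, ∀ u < K, M' 31 (a * K + u : ℕ) = commonBit a u) M τ := by
  refine vc_for hB (n := K * K) (by omega)
    (fun i M' τ' => τ' ≤ τ + (80 * i + 3) ∧ M' 30 0 = K ∧ (∀ j < i, M' 31 j = commonBit (j / K) (j % K))
      ∧ (i = 0 → M' 31 0 = 0)) (τ + (80 * (K * K) + 3)) ?_ ?_ ?_ ?_ ?_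
  · intro i M' τ' hi h
    have := h.1
    omega
  · intro i M' τ' hi h
    simp [h.2.1]
    have : (K : ℤ) * K ≤ B := by
      have : K * K ≤ B := by omega
      exact_mod_cast this
    have : (0 : ℤ) ≤ K * K := by positivity
    omega
  · simp [h30, h31]
  · rintro i M' τ' hi ⟨hτ, e30, e31, e0⟩ hv
    have hdm : K * (i / K) + i % K = i := Nat.div_add_mod i K
    have ha : i / K < K := Nat.div_lt_of_lt_mul hi
    have hu : i % K < K := Nat.mod_lt _ hK
    obtain ⟨a, hadef⟩ : ∃ a, a = i / K := ⟨_, rfl⟩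
    obtain ⟨u, hudef⟩ : ∃ u, u = i % K := ⟨_, rfl⟩
    rw [← hadef, ← hudef] at hdm
    rw [← hadef] at ha
    rw [← hudef] at hu
    have hidx : M' 31 ((a / 2 * K + u / 2 : ℕ) : ℤ) = commonBit (a / 2) (u / 2) := by
      by_cases hi0 : i = 0
      · have ha0 : a = 0 := by rw [hadef, hi0, Nat.zero_div]
        have hu0 : u = 0 := by rw [hudef, hi0, Nat.zero_mod]
        simp [ha0, hu0, e0 hi0, commonBit_zero]
      · have hlt : a / 2 * K + u / 2 < i := by
          obtain h | h := Nat.eq_zero_or_pos a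
          · rw [h] at hdm ⊢
            simp at hdm ⊢
            omega
          · have : a / 2 * K + K ≤ a * K := by
              have := Nat.mul_le_mul_right K (show a / 2 + 1 ≤ a by omega)
              rwa [Nat.succ_mul] at this
            rw [mul_comm] at hdm
            omega
        rw [e31 _ hlt]
        obtain ⟨h1, h2⟩ := mul_add_div_mod (x := a / 2) (show u / 2 < K by omega)
        rw [h1, h2]
    have hlek := commonBit_le (a / 2) (u / 2)
    have hrec := commonBit_eq a u
    set r := commonBit (a / 2) (u / 2) with hr
    have hKK : K ≤ K * K := Nat.le_mul_of_pos_left K hK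
    have hle2 : a / 2 * K + u / 2 ≤ K * K := by
      have := Nat.mul_le_mul_right K (show a / 2 + 1 ≤ K by omega)
      rw [Nat.succ_mul] at this
      omega
    have hle3 : a / 2 * K ≤ K * K := by omega
    have hm2 : (a % 2) * (u % 2) ≤ 1 := by
      obtain h1 | h1 := Nat.mod_two_eq_zero_or_one a <;>
      obtain h2 | h2 := Nat.mod_two_eq_zero_or_one u <;> simp [h1, h2]
    have hva : (i : ℤ) / K = (a : ℤ) := by rw [hadef]; push_cast; rfl
    have hvu : (i : ℤ) % K = (u : ℤ) := by rw [hudef]; push_cast; rfl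
    push_cast at hidx
    simp only [vc_seq_iff, vc_assign, vc_store]
    simp [e30, hv, hva, hvu, hidx]
    have hK0 : K ≠ 0 := by omega
    norm_cast
    have hite : (if r = 0 then a % 2 * (u % 2) else 0) ≤ 1 := by
      split_ifs <;> omega
    refine ⟨hK0, ⟨⟨by omega, by omega⟩, by omega, by omega⟩, ⟨⟨by omega, by omega⟩,
      ⟨⟨by omega, by omega⟩, by omega, by omega⟩, by omega, by omega⟩, by omega, fun j hj => ?_⟩
    · obtain hj | rfl := Nat.lt_or_eq_of_le hj
      · simp [hj.ne, e31 j hj]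
      · rw [if_pos rfl, ← hadef, ← hudef, hrec]
        congr 1
        split_ifs <;> omega
  · rintro M' τ' ⟨hτ, e30, e31, e0⟩ hv
    simp only [cost_mul, cost_var]
    refine ⟨by omega, fun a ha u hu => ?_⟩
    have hlt : a * K + u < K * K := by
      have := Nat.mul_le_mul_right K (show a + 1 ≤ K by omega)
      rw [Nat.succ_mul] at this
      omega
    rw [e31 _ hlt]
    obtain ⟨h1, h2⟩ := mul_add_div_mod (x := a) hu
    rw [h1, h2]

end WordRAM

/-!
# Partition of the tree into clusters

A cluster consists of nodes that are reached from some of the children of one node. It is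
identified with one of these children, its leader.
-/

namespace WordRAM

open WordRAM.Expr WordRAM.Cmd

/-- Group siblings, such that the groups and their descendants in no other group have about `b`
nodes. -/
def groupNodes : Cmd :=
  .seq (forLoop 12 (var 0 - const 1)
    (.seq (assign 14 (load 15 (var 12)))
    (.seq (.ite (load 32 (var 14)) .skip (.store 33 (var 14) (var 12)))
    (.seq (.store 34 (var 12) (load 33 (var 14)))
    (.seq (.store 32 (var 14) (load 32 (var 14) + load 32 (var 12) + const 1))
      (.ite (lt (load 32 (var 14)) (var 29)) .skip
        (.seq (.store 35 (load 33 (var 14)) (const 1)) (.store 32 (var 14) (const 0)))))))))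
    (.ite (load 32 (var 0 - const 1)) (.store 35 (load 33 (var 0 - const 1)) (const 1)) .skip)

/-- The state of the grouping when the nodes below `n` have been processed: `g x` is the leader of
the group of `x`, `E` the set of the leaders of completed groups, `μ x` the number of nodes that
descend from `x` without passing a node of a completed group; these numbers add up to `s y` for the
children of `y`. -/
structure Grouping (q : ℕ) (p : ℕ → ℕ) (b n : ℕ) (g : ℕ → ℕ) (E : Finset ℕ) (μ s : ℕ → ℕ) :
    Prop where
  leader_le : ∀ k < n, g k ≤ k
  parent_leader : ∀ k < n, p (g k) = p k
  mem_lt : ∀ c ∈ E, c < n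
  size : ∀ c ∈ E, ∑ k ∈ (Finset.range n).filter (fun k => g k = c), μ k < 2 * b
  pending : ∀ y < q, s y = ∑ k ∈ (Finset.range n).filter (fun k => p k = y ∧ g k ∉ E), μ k
  mass : ∀ x < n, μ x = 1 + ∑ k ∈ (Finset.range n).filter (fun k => p k = x ∧ g k ∉ E), μ k

variable {q b n : ℕ} {p : ℕ → ℕ} {g : ℕ → ℕ} {E : Finset ℕ} {μ s : ℕ → ℕ}

theorem sum_filter_range_succ_update {P P' : ℕ → Prop} [DecidablePred P] [DecidablePred P'] {v : ℕ}
    (h : ∀ k < n, P' k ↔ P k) :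
    ∑ k ∈ (Finset.range (n + 1)).filter P', Function.update μ n v k =
      (∑ k ∈ (Finset.range n).filter P, μ k) + if P' n then v else 0 := by
  rw [Finset.sum_filter, Finset.sum_range_succ, Finset.sum_filter]
  congr 1
  · refine Finset.sum_congr rfl fun k hk => ?_
    rw [Finset.mem_range] at hk
    rw [Function.update_of_ne hk.ne]
    simp only [h k hk]
  · simp

namespace Grouping

theorem s_pos (G : Grouping q p b n g E μ s) {k : ℕ} (hk : k < n) (hpk : p k < q)
    (hg : g k ∉ E) : 0 < s (p k) := by
  have h1 := G.mass k hk
  rw [G.pending _ hpk]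
  refine lt_of_lt_of_le (by omega : 0 < μ k) ?_
  exact Finset.single_le_sum (f := μ) (fun _ _ => Nat.zero_le _) (by simp [hk, hg])

theorem exists_of_s_ne_zero (G : Grouping q p b n g E μ s) {y : ℕ} (hy : y < q) (h : s y ≠ 0) :
    ∃ k < n, p k = y ∧ g k ∉ E := by
  rw [G.pending y hy] at h
  obtain ⟨k, hk, -⟩ := Finset.exists_ne_zero_of_sum_ne_zero h
  simp only [Finset.mem_filter, Finset.mem_range] at hk
  exact ⟨k, hk⟩

/-- Put the node `n` into the group with leader `c`. -/
theorem insertNode (G : Grouping q p b n g E μ s) (T : OrderedTree q p) (hn : n + 1 < q) {c : ℕ}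
    (hcn : c ≤ n) (hpc : p c = p n) (hcE : c ∉ E) :
    Grouping q p b (n + 1) (Function.update g n c) E (Function.update μ n (s n + 1))
      (Function.update s (p n) (s (p n) + s n + 1)) := by
  have hlt := T.lt_parent n hn
  have hg : ∀ k < n, Function.update g n c k = g k := fun k hk => Function.update_of_ne hk.ne _ _
  have hμ : ∀ k < n, Function.update μ n (s n + 1) k = μ k := fun k hk =>
    Function.update_of_ne hk.ne _ _
  have hsum : ∀ y, ∑ k ∈ (Finset.range (n + 1)).filter
        (fun k => p k = y ∧ Function.update g n c k ∉ E), Function.update μ n (s n + 1) k =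
      (∑ k ∈ (Finset.range n).filter (fun k => p k = y ∧ g k ∉ E), μ k) +
        if p n = y then s n + 1 else 0 := by
    intro y
    rw [sum_filter_range_succ_update (P := fun k => p k = y ∧ g k ∉ E)]
    · simp [hcE]
    · intro k hk
      rw [hg k hk]
  refine ⟨fun k hk => ?_, fun k hk => ?_, fun d hd => ?_, fun d hd => ?_, fun y hy => ?_,
    fun x hx => ?_⟩
  · obtain hk | rfl := Nat.lt_succ_iff_lt_or_eq.1 hk
    · rw [hg k hk]
      exact G.leader_le k hk
    · simpa using hcn
  · obtain hk | rfl := Nat.lt_succ_iff_lt_or_eq.1 hk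
    · rw [hg k hk]
      exact G.parent_leader k hk
    · simpa using hpc
  · have := G.mem_lt d hd
    omega
  · rw [sum_filter_range_succ_update (P := fun k => g k = d), if_neg]
    · exact G.size d hd
    · rintro rfl
      simp at hd
      exact hcE hd
    · intro k hk
      rw [hg k hk]
  · rw [hsum]
    by_cases h : p n = y
    · subst h
      rw [← G.pending _ hy]
      simp
      omega
    · rw [Function.update_of_ne (Ne.symm h), G.pending y hy, if_neg h, add_zero]
  · rw [hsum]
    obtain hx | rfl := Nat.lt_succ_iff_lt_or_eq.1 hx
    · rw [hμ x hx, if_neg (by omega)]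
      exact G.mass x hx
    · rw [Function.update_self, if_neg (by omega), ← G.pending x (by omega)]
      omega

/-- Complete the group with leader `c`. -/
theorem complete (G : Grouping q p b n g E μ s) {y c : ℕ} (hy : y < q) (hny : n ≤ y)
    (hc : c < n) (hcE : c ∉ E) (hpc : p c = y) (hlead : ∀ k < n, p k = y → g k ∉ E → g k = c)
    (hs : s y < 2 * b) : Grouping q p b n g (insert c E) μ (Function.update s y 0) := by
  have hother : ∀ z, z ≠ y → (Finset.range n).filter (fun k => p k = z ∧ g k ∉ insert c E) =
      (Finset.range n).filter (fun k => p k = z ∧ g k ∉ E) := by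
    intro z hz
    refine Finset.filter_congr fun k hk => and_congr_right fun hpk => ?_
    rw [Finset.mem_range] at hk
    rw [Finset.mem_insert, not_or]
    refine and_iff_right fun h => hz ?_
    rw [← hpk, ← G.parent_leader k hk, h, hpc]
  refine ⟨G.leader_le, G.parent_leader, fun d hd => ?_, fun d hd => ?_, fun z hz => ?_,
    fun x hx => ?_⟩
  · obtain rfl | hd := Finset.mem_insert.1 hd
    · exact hc
    · exact G.mem_lt d hd
  · obtain rfl | hd := Finset.mem_insert.1 hd
    · refine lt_of_le_of_lt ?_ hs
      rw [G.pending y hy]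
      refine Finset.sum_le_sum_of_subset fun k hk => ?_
      simp only [Finset.mem_filter, Finset.mem_range] at hk ⊢
      refine ⟨hk.1, ?_, by rw [hk.2]; exact hcE⟩
      rw [← G.parent_leader k hk.1, hk.2, hpc]
    · exact G.size d hd
  · by_cases h : z = y
    · subst h
      rw [Function.update_self, Finset.sum_eq_zero]
      intro k hk
      simp only [Finset.mem_filter, Finset.mem_range, Finset.mem_insert, not_or] at hk
      exact absurd (hlead k hk.1 hk.2.1 hk.2.2.2) hk.2.2.1
    · rw [Function.update_of_ne h, hother z h]
      exact G.pending z hz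
  · rw [hother x (by omega)]
    exact G.mass x hx

end Grouping

/-- The stored state of the grouping. -/
structure GroupingState (q : ℕ) (p : ℕ → ℕ) (b n : ℕ) (g : ℕ → ℕ) (E : Finset ℕ) (μ s : ℕ → ℕ)
    (M : Memory) : Prop where
  grouping : Grouping q p b n g E μ s
  pending : ∀ y < q, M 32 y = s y
  pending_lt : ∀ y < q, s y < b
  current : ∀ k < n, g k ∉ E → M 33 (p k) = g k
  group : ∀ k < n, M 34 k = g k
  completed : ∀ c < q, M 35 c = if c ∈ E then 1 else 0
  card : E.card * b + ∑ y ∈ Finset.Ico n q, s y ≤ n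

theorem GroupingState.congr {M M' : Memory} (h : GroupingState q p b n g E μ s M)
    (h32 : M' 32 = M 32) (h33 : M' 33 = M 33) (h34 : M' 34 = M 34) (h35 : M' 35 = M 35) :
    GroupingState q p b n g E μ s M' := by
  obtain ⟨h1, h2, h3, h4, h5, h6, h7⟩ := h
  exact ⟨h1, by rwa [h32], h3, by rwa [h33], by rwa [h34], by rwa [h35], h7⟩

theorem sum_Ico_update {y v : ℕ} (hn : n < y) (hy : y < q) :
    (∑ z ∈ Finset.Ico (n + 1) q, Function.update s y v z) + s n + s y =
      (∑ z ∈ Finset.Ico n q, s z) + v := by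
  have hmem : y ∈ Finset.Ico (n + 1) q := by simp; omega
  have h1 : ∑ z ∈ Finset.Ico n q, s z = s n + ∑ z ∈ Finset.Ico (n + 1) q, s z :=
    Finset.sum_eq_sum_Ico_succ_bot (by omega) _
  have h2 := Finset.sum_update_of_mem hmem s v
  have h4 := Finset.sum_sdiff (f := s) (Finset.singleton_subset_iff.2 hmem)
  rw [Finset.sum_singleton] at h4
  omega

theorem groupNodes_spec {B : ℕ} (hB : 16 ≤ B) (hq : q < B) (T : OrderedTree q p) (hb : 0 < b)
    (hbB : 2 * b ≤ B) {M : Memory} {τ : ℕ} (h00 : M 0 0 = q) (h15 : ∀ x < q, M 15 x = p x)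
    (h29 : M 29 0 = b) (h32 : M 32 = 0) (h35 : M 35 = 0) :
    groupNodes.VC B (fun M' τ' => τ' ≤ τ + (80 * q + 60) ∧ ∃ g E μ s,
      Grouping q p b (q - 1) g E μ s ∧ (∀ k < q - 1, p k = q - 1 → g k ∈ E) ∧
      (∀ k < q - 1, M' 34 k = g k) ∧ (∀ c < q, M' 35 c = if c ∈ E then 1 else 0) ∧
      E.card * b < q + b) M τ := by
  have hq0 := T.pos
  rw [groupNodes, vc_seq_iff]
  refine vc_for hB (n := q - 1) (by omega)
    (fun i M' τ' => τ' ≤ τ + (80 * i + 3) ∧ M' 0 = M 0 ∧ M' 15 = M 15 ∧ M' 29 = M 29 ∧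
      ∃ g E μ s, GroupingState q p b i g E μ s M') (τ + (80 * q + 3)) ?_ ?_ ?_ ?_ ?_
  · intro i M' τ' hi h
    have := h.1
    omega
  · intro i M' τ' hi h
    simp [h.2.1, h00]
    omega
  · refine ⟨by simp, by simp, by simp, by simp, fun _ => 0, ∅, fun _ => 0, fun _ => 0,
      ⟨?_, ?_, ?_, ?_, ?_, ?_⟩, ?_, ?_, ?_, ?_, ?_, ?_⟩ <;> simp [h32, h35, hb]
  · rintro i M' τ' hi ⟨hτ, e0, e15, e29, g, E, μ, s, G⟩ hv
    have hpi := T.lt_parent i (by omega)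
    have hpq := T.parent_lt i (by omega)
    have hsi := G.pending i (by omega)
    have hsi' := G.pending_lt i (by omega)
    have hsy := G.pending (p i) hpq
    have hsy' := G.pending_lt (p i) hpq
    obtain ⟨c, hcdef⟩ : ∃ c, c = if s (p i) = 0 then i else (M' 33 (p i)).toNat := ⟨_, rfl⟩
    have hcprop : c ≤ i ∧ p c = p i ∧ c ∉ E ∧ (∀ k < i, p k = p i → g k ∉ E → g k = c) ∧
        (if s (p i) = 0 then (i : ℤ) else M' 33 (p i)) = c := by
      split_ifs at hcdef ⊢ with h0
      · subst hcdef
        refine ⟨le_rfl, rfl, fun h => lt_irrefl _ (G.grouping.mem_lt c h), ?_, rfl⟩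
        intro k hk hpk hgk
        have := G.grouping.s_pos hk (by rw [hpk]; exact hpq) hgk
        rw [hpk] at this
        omega
      · obtain ⟨k, hk, hpk, hgk⟩ := G.grouping.exists_of_s_ne_zero hpq h0
        have hck := G.current k hk hgk
        rw [hpk] at hck
        have hc : c = g k := by rw [hcdef, hck]; simp
        subst hc
        refine ⟨(G.grouping.leader_le k hk).trans hk.le, ?_, hgk, ?_, hck⟩
        · rw [G.grouping.parent_leader k hk, hpk]
        · intro k' hk' hpk' hgk'
          have := G.current k' hk' hgk'
          rw [hpk', hck] at this
          exact_mod_cast this.symm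
    obtain ⟨hci, hpc, hcE, hlead, hcval⟩ := hcprop
    have G1 := G.grouping.insertNode T (by omega) hci hpc hcE
    have hmain : ∀ M₁ : Memory, ∀ τ₁, τ₁ ≤ τ + (80 * i + 3) + 24 → M₁ 0 = M 0 → M₁ 15 = M 15 →
        M₁ 29 = M 29 → M₁ 12 0 = i → M₁ 14 0 = p i → M₁ 32 = M' 32 →
        (∀ z : ℕ, M₁ 33 z = if z = p i then (c : ℤ) else M' 33 z) → M₁ 34 = M' 34 →
        M₁ 35 = M' 35 → (Cmd.seq (.store 34 (var 12) (load 33 (var 14)))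
        (.seq (.store 32 (var 14) (load 32 (var 14) + load 32 (var 12) + const 1))
        (.ite (lt (load 32 (var 14)) (var 29)) .skip
        (.seq (.store 35 (load 33 (var 14)) (const 1)) (.store 32 (var 14) (const 0)))))).VC B
        (fun M' τ' => M' 12 0 = i ∧ τ' + 6 ≤ τ + (80 * (i + 1) + 3) ∧ M' 0 = M 0 ∧
          M' 15 = M 15 ∧ M' 29 = M 29 ∧
          ∃ g E μ s, GroupingState q p b (i + 1) g E μ s M') M₁ τ₁ := by
      intro M₁ τ₁ hτ₁ d0 d15 d29 d12 d14 d32 d33 d34 d35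
      have d33y := d33 (p i)
      rw [if_pos rfl] at d33y
      have hgroup : ∀ k < i + 1, (if k = i then (c : ℤ) else M' 34 k) = Function.update g i c k := by
        intro k hk
        by_cases h : k = i
        · simp [h]
        · rw [if_neg h, Function.update_of_ne h]
          exact G.group k (by omega)
      have hpend : ∀ v : ℕ, ∀ z < q, (if z = p i then (v : ℤ) else M' 32 z) =
          Function.update s (p i) v z := by
        intro v z hz
        by_cases h : z = p i
        · simp [h]
        · rw [if_neg h, Function.update_of_ne h]
          exact G.pending z hz
      have hpend' : ∀ v : ℕ, v < b → ∀ z < q, Function.update s (p i) v z < b := by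
        intro v hv z hz
        by_cases h : z = p i
        · simpa [h] using hv
        · rw [Function.update_of_ne h]
          exact G.pending_lt z hz
      have hcur : ∀ F : Finset ℕ, E ⊆ F → ∀ k < i + 1, Function.update g i c k ∉ F →
          M₁ 33 (p k) = Function.update g i c k := by
        intro F hF k hk hgk
        rw [d33]
        by_cases hki : k = i
        · simp [hki]
        · rw [Function.update_of_ne hki] at hgk ⊢
          have hgk' : g k ∉ E := fun h => hgk (hF h)
          split_ifs with h
          · rw [hlead k (by omega) h hgk']
          · exact G.current k (by omega) hgk'
      simp only [vc_seq_iff, vc_store, vc_ite, vc_skip]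
      simp only [ok_load, ok_var, ok_add, ok_const, ok_lt, val_load, val_var, val_add, val_const,
        val_lt, cost_load, cost_var, cost_add, cost_const, cost_lt, true_and, and_true]
      simp [d0, d15, d29, d12, d14, d32, d33y, hsi, hsy, h29]
      refine ⟨by omega, fun h => ⟨by omega, _, _, _, _, G1, ?_, ?_, ?_, ?_, ?_, ?_⟩,
        fun h => ⟨by omega, Function.update g i c, insert c E, Function.update μ i (s i + 1),
          Function.update (Function.update s (p i) (s (p i) + s i + 1)) (p i) 0,
          G1.complete hpq (by omega) (by omega) hcE hpc ?_ ?_, ?_, ?_, ?_, ?_, ?_, ?_⟩⟩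
      · intro z hz
        rw [← hpend _ z hz]
        simp [d32]
      · exact hpend' _ (by omega)
      · intro k hk hgk
        simp [hcur E subset_rfl k hk hgk]
      · intro k hk
        rw [← hgroup k hk]
        simp [d34]
      · simpa [d35] using G.completed
      · have h1 := sum_Ico_update (s := s) (v := s (p i) + s i + 1) hpi hpq
        have h2 := G.card
        omega
      · intro k hk hpk hgk
        by_cases hki : k = i
        · simp [hki]
        · rw [Function.update_of_ne hki] at hgk ⊢
          exact hlead k (by omega) hpk hgk
      · rw [Function.update_self]
        omega
      · intro z hz
        rw [Function.update_idem, ← hpend _ z hz]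
        by_cases hzp : z = p i <;> simp [d32, hzp]
      · rw [Function.update_idem]
        exact hpend' _ hb
      · intro k hk hgk
        simp [hcur _ (Finset.subset_insert _ _) k hk hgk]
      · intro k hk
        rw [← hgroup k hk]
        simp [d34]
      · intro e he
        simp [d35, G.completed e he, Finset.mem_insert]
        by_cases hec : e = c <;> simp [hec]
      · rw [Function.update_idem, Finset.card_insert_of_notMem hcE]
        have h1 := sum_Ico_update (s := s) (v := 0) hpi hpq
        have h2 := G.card
        rw [Nat.succ_mul]
        omega
    have hfin : ∀ (M₂ : Memory) (τ₂ : ℕ), (M₂ 12 0 = i ∧ τ₂ + 6 ≤ τ + (80 * (i + 1) + 3) ∧ M₂ 0 = M 0 ∧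
        M₂ 15 = M 15 ∧ M₂ 29 = M 29 ∧ ∃ g E μ s, GroupingState q p b (i + 1) g E μ s M₂) →
        M₂ 12 0 = i ∧ τ₂ + 6 ≤ τ + (80 * (i + 1) + 3) ∧ (M₂.set 12 0 (i + 1)) 0 = M 0 ∧
        (M₂.set 12 0 (i + 1)) 15 = M 15 ∧ (M₂.set 12 0 (i + 1)) 29 = M 29 ∧
        ∃ g E μ s, GroupingState q p b (i + 1) g E μ s (M₂.set 12 0 (i + 1)) := by
      rintro M₂ τ₂ ⟨f12, fτ, f0, f15, f29, g', E', μ', s', G'⟩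
      exact ⟨f12, fτ, by simp [f0], by simp [f15], by simp [f29], g', E', μ', s',
        G'.congr (by simp) (by simp) (by simp) (by simp)⟩
    rw [vc_seq_iff, vc_assign]
    refine ⟨by simp, ?_⟩
    rw [vc_seq_iff, vc_ite]
    simp only [cost_sub, cost_var, cost_const, cost_load, val_load, val_var, e15, hv,
      h15 i (by omega)]
    refine ⟨by simp, fun h => ?_, fun h => ?_⟩
    · rw [vc_skip]
      have h0 : s (p i) ≠ 0 := by
        intro h0
        simp [hsy, h0] at h
      rw [if_neg h0] at hcval
      refine vc_mono (hmain _ _ (by omega) (by simp [e0]) (by simp [e15]) (by simp [e29])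
        (by simp [hv]) (by simp) (by simp) ?_ (by simp) (by simp)) hfin
      intro z
      by_cases hz : z = p i
      · simp [hz, hcval]
      · simp [hz]
    · rw [vc_store]
      have h0 : s (p i) = 0 := by simpa [hsy] using h
      rw [if_pos h0] at hcval
      refine ⟨by simp, by simp, vc_mono (hmain _ _ ?_ (by simp [e0]) (by simp [e15])
        (by simp [e29]) (by simp [hv]) (by simp) (by simp) ?_ (by simp) (by simp)) hfin⟩
      · simp only [cost_var]
        omega
      · intro z
        by_cases hz : z = p i
        · simp [hz, hcval, hv]
        · simp [hz]
  · rintro M' τ' ⟨hτ, e0, e15, e29, g, E, μ, s, G⟩ hv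
    have hroot : ((q : ℤ) - 1) = ((q - 1 : ℕ) : ℤ) := by omega
    have hsr := G.pending (q - 1) (by omega)
    have hsr' := G.pending_lt (q - 1) (by omega)
    have hcard := G.card
    rw [vc_ite]
    simp only [cost_sub, cost_var, cost_const, cost_load, vc_store, vc_skip]
    simp only [ok_load, ok_sub, ok_var, ok_const, val_load, val_sub, val_var, val_const, e0, h00,
      hroot, hsr]
    refine ⟨⟨trivial, by simp, by omega, by omega⟩, fun h => ⟨⟨trivial, by simp, by omega, by omega⟩,
      by simp, by omega, ?_⟩,
      fun h => ⟨by omega, g, E, μ, s, G.grouping, ?_, G.group, G.completed, by omega⟩⟩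
    · have h0 : s (q - 1) ≠ 0 := by exact_mod_cast h
      obtain ⟨k, hk, hpk, hgk⟩ := G.grouping.exists_of_s_ne_zero (by omega) h0
      have hck := G.current k hk hgk
      rw [hpk] at hck
      have hlead : ∀ k' < q - 1, p k' = q - 1 → g k' ∉ E → g k' = g k := by
        intro k' hk' hpk' hgk'
        have := G.current k' hk' hgk'
        rw [hpk', hck] at this
        exact_mod_cast this.symm
      have hle := G.grouping.leader_le k hk
      refine ⟨g, insert (g k) E, μ, _, G.grouping.complete (y := q - 1) (by omega) le_rfl (by omega)
        hgk ?_ hlead (by omega), ?_, ?_, ?_, ?_⟩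
      · rw [G.grouping.parent_leader k hk, hpk]
      · intro k' hk' hpk'
        rw [Finset.mem_insert, or_iff_not_imp_right]
        exact hlead k' hk' hpk'
      · intro k' hk'
        simp [G.group k' hk']
      · intro c hc
        simp [hck, G.completed c hc, Finset.mem_insert]
        by_cases hcg : c = g k <;> simp [hcg]
      · rw [Finset.card_insert_of_notMem hgk, Nat.succ_mul]
        omega
    · intro k hk hpk
      by_contra hgk
      have := G.grouping.s_pos hk (by omega) hgk
      rw [hpk] at this
      have h0 : s (q - 1) = 0 := by exact_mod_cast h
      omega

end WordRAM

namespace WordRAM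

open WordRAM.Expr WordRAM.Cmd

/-- The leader of the cluster of `x`, for the leaders `g` of the groups and the leaders `E` of the
completed groups. -/
def clusterOf (q : ℕ) (p g : ℕ → ℕ) (E : Finset ℕ) (x : ℕ) : ℕ :=
  if g x ∉ E ∧ x < p x ∧ p x < q then clusterOf q p g E (p x) else g x
termination_by q - x
decreasing_by omega

/-- The number of nodes from `a` on in the cluster `c`. -/
def clusterCount (q : ℕ) (cl : ℕ → ℕ) (a c : ℕ) : ℕ :=
  ((Finset.Ico a (q - 1)).filter fun y => cl y = c).card

/-- The number of the bit that represents `x` in its cluster. -/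
def bitIndex (q : ℕ) (cl : ℕ → ℕ) (x : ℕ) : ℕ := clusterCount q cl (x + 1) (cl x)

/-- A partition of the nodes other than the root into clusters of less than `n` nodes; `cl x` is the
leader of the cluster of `x`. -/
structure Clustering (q : ℕ) (p : ℕ → ℕ) (n : ℕ) (cl : ℕ → ℕ) : Prop where
  leader_lt : ∀ x < q - 1, cl x < q - 1
  anc_exit : ∀ x < q - 1, Anc p x (p (cl x))
  lt_exit : ∀ x < q - 1, x < p (cl x)
  eq_of_lt_exit : ∀ x < q - 1, ∀ y, Anc p x y → y < p (cl x) → cl y = cl x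
  count_lt : ∀ x < q - 1, clusterCount q cl 0 (cl x) < n

section Count

variable {q : ℕ} {cl : ℕ → ℕ}

theorem clusterCount_succ {a : ℕ} (ha : a < q - 1) (c : ℕ) : clusterCount q cl a c =
    clusterCount q cl (a + 1) c + if cl a = c then 1 else 0 := by
  rw [clusterCount, ← Finset.insert_Ico_add_one_left_eq_Ico ha, Finset.filter_insert]
  split_ifs with h
  · rw [Finset.card_insert_of_notMem (by simp)]
    rfl
  · rfl

theorem clusterCount_anti (c : ℕ) {a a' : ℕ} (h : a ≤ a') :
    clusterCount q cl a' c ≤ clusterCount q cl a c :=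
  Finset.card_le_card (Finset.filter_subset_filter _ (Finset.Ico_subset_Ico_left h))

theorem bitIndex_lt {x y : ℕ} (hxy : x < y) (hy : y < q - 1) (hc : cl x = cl y) :
    bitIndex q cl y < bitIndex q cl x := by
  have h1 := clusterCount_succ (cl := cl) hy (cl y)
  rw [if_pos rfl] at h1
  have h2 := clusterCount_anti (q := q) (cl := cl) (cl y) (show x + 1 ≤ y from hxy)
  rw [bitIndex, bitIndex, hc]
  omega

theorem bitIndex_lt_count {x : ℕ} (hx : x < q - 1) :
    bitIndex q cl x < clusterCount q cl 0 (cl x) := by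
  have h1 := clusterCount_succ (cl := cl) hx (cl x)
  rw [if_pos rfl] at h1
  have h2 := clusterCount_anti (q := q) (cl := cl) (cl x) (Nat.zero_le x)
  rw [bitIndex]
  omega

theorem bitIndex_injOn (c : ℕ) :
    Set.InjOn (bitIndex q cl) ((Finset.range (q - 1)).filter fun y => cl y = c) := by
  intro x hx y hy hxy
  simp only [Finset.coe_filter, Finset.mem_range, Set.mem_ofPred_eq] at hx hy
  obtain h | h | h := lt_trichotomy x y
  · have := bitIndex_lt (cl := cl) h hy.1 (by rw [hx.2, hy.2])
    omega
  · exact h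
  · have := bitIndex_lt (cl := cl) h hx.1 (by rw [hx.2, hy.2])
    omega

theorem sum_two_pow_bitIndex {a : ℕ} (ha : a ≤ q - 1) (c : ℕ) :
    ∑ y ∈ (Finset.Ico a (q - 1)).filter (fun y => cl y = c), 2 ^ bitIndex q cl y + 1 =
      2 ^ clusterCount q cl a c := by
  induction ha using Nat.decreasingInduction with
  | self => simp [clusterCount]
  | of_succ a ha ih =>
    rw [clusterCount_succ ha, ← Finset.insert_Ico_add_one_left_eq_Ico ha, Finset.filter_insert]
    split_ifs with h
    · rw [Finset.sum_insert (by simp), pow_succ, ← ih, bitIndex, h, ← ih]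
      ring
    · simpa using ih

end Count

variable {q b : ℕ} {p : ℕ → ℕ} {g : ℕ → ℕ} {E : Finset ℕ} {μ s : ℕ → ℕ} {x : ℕ}

theorem clusterOf_of_mem (h : g x ∈ E) : clusterOf q p g E x = g x := by
  rw [clusterOf, if_neg]
  simp [h]

theorem clusterOf_of_notMem (T : OrderedTree q p) (hx : x < q - 1) (h : g x ∉ E) :
    clusterOf q p g E x = clusterOf q p g E (p x) := by
  rw [clusterOf, if_pos]
  exact ⟨h, T.lt_parent x (by omega), T.parent_lt x (by omega)⟩

theorem parent_lt_of_notMem (T : OrderedTree q p) (hE : ∀ k < q - 1, p k = q - 1 → g k ∈ E)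
    (hx : x < q - 1) (h : g x ∉ E) : p x < q - 1 := by
  have := T.parent_lt x (by omega)
  have : p x ≠ q - 1 := fun h' => h (hE x hx h')
  omega

theorem OrderedTree.induction_from_root (T : OrderedTree q p) {P : ℕ → Prop}
    (h : ∀ x < q - 1, (p x < q - 1 → P (p x)) → P x) : ∀ x < q - 1, P x := by
  intro x hx
  induction hn : q - x using Nat.strong_induction_on generalizing x with
  | _ n ih =>
    have := T.lt_parent x (by omega)
    exact h x hx fun hp => ih (q - p x) (by omega) (p x) hp rfl

theorem clusterOf_mem (T : OrderedTree q p) (hE : ∀ k < q - 1, p k = q - 1 → g k ∈ E) :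
    ∀ x < q - 1, clusterOf q p g E x ∈ E := by
  refine T.induction_from_root fun x hx ih => ?_
  by_cases h : g x ∈ E
  · rwa [clusterOf_of_mem h]
  · rw [clusterOf_of_notMem T hx h]
    exact ih (parent_lt_of_notMem T hE hx h)

theorem clusterCount_clusterOf_lt (T : OrderedTree q p) (G : Grouping q p b (q - 1) g E μ s)
    (hE : ∀ k < q - 1, p k = q - 1 → g k ∈ E) {c : ℕ} (hc : c ∈ E) :
    clusterCount q (clusterOf q p g E) 0 c < 2 * b := by
  set cl := clusterOf q p g E with hcl
  refine lt_of_le_of_lt ?_ (G.size c hc)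
  suffices h : ∀ a ≤ q - 1, clusterCount q cl a c + ∑ k ∈ Finset.range a,
      (if cl k = c ∧ (g k ∈ E ∨ a ≤ p k) then μ k else 0) =
      ∑ k ∈ (Finset.range (q - 1)).filter (fun k => g k = c), μ k by
    have := h 0 (Nat.zero_le _)
    simpa using this.le
  intro a ha
  induction ha using Nat.decreasingInduction with
  | self =>
    rw [Finset.sum_filter]
    simp only [clusterCount, Finset.Ico_self, Finset.filter_empty, Finset.card_empty, zero_add]
    refine Finset.sum_congr rfl fun k hk => ?_
    rw [Finset.mem_range] at hk
    have hpk := T.parent_lt k (by omega)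
    by_cases hg : g k ∈ E
    · simp [hcl, clusterOf_of_mem hg, hg]
    · have h1 := parent_lt_of_notMem T hE hk hg
      rw [if_neg (fun h => by simp only [hg, false_or] at h; omega),
        if_neg (fun h : g k = c => hg (by rwa [h]))]
  | of_succ x hx ih =>
    rw [← ih, clusterCount_succ hx, Finset.sum_range_succ]
    have hpx := T.lt_parent x (by omega)
    have hsplit : ∑ k ∈ Finset.range x, (if cl k = c ∧ (g k ∈ E ∨ x ≤ p k) then μ k else 0) =
        ∑ k ∈ Finset.range x, (if cl k = c ∧ (g k ∈ E ∨ x + 1 ≤ p k) then μ k else 0) +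
          if cl x = c then ∑ k ∈ (Finset.range (q - 1)).filter (fun k => p k = x ∧ g k ∉ E), μ k
          else 0 := by
      have h1 : (Finset.range (q - 1)).filter (fun k => p k = x ∧ g k ∉ E) =
          (Finset.range x).filter (fun k => p k = x ∧ g k ∉ E) := by
        ext k
        simp only [Finset.mem_filter, Finset.mem_range]
        refine ⟨fun h => ⟨?_, h.2⟩, fun h => ⟨by omega, h.2⟩⟩
        have := T.lt_parent k (by omega)
        omega
      rw [h1, Finset.sum_filter]
      have h2 : (if cl x = c then ∑ k ∈ Finset.range x, (if p k = x ∧ g k ∉ E then μ k else 0)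
          else 0) = ∑ k ∈ Finset.range x, if cl k = c ∧ p k = x ∧ g k ∉ E then μ k else 0 := by
        have h3 : ∀ k ∈ Finset.range x, (if cl k = c ∧ p k = x ∧ g k ∉ E then μ k else 0) =
            if cl x = c then (if p k = x ∧ g k ∉ E then μ k else 0) else 0 := by
          intro k hk
          rw [Finset.mem_range] at hk
          by_cases h : p k = x ∧ g k ∉ E
          · have : cl k = cl x := by
              rw [hcl, clusterOf_of_notMem T (by omega) h.2, h.1]
            simp [h, this]
          · simp [h]
        rw [Finset.sum_congr rfl h3]
        split_ifs <;> simp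
      rw [h2, ← Finset.sum_add_distrib]
      refine Finset.sum_congr rfl fun k _ => ?_
      by_cases hgk : g k ∈ E
      · simp [hgk]
      · by_cases hck : cl k = c
        · simp only [hgk, hck, false_or, true_and, not_false_eq_true, and_true]
          split_ifs <;> omega
        · simp [hck]
    rw [hsplit]
    have hm := G.mass x hx
    by_cases h : cl x = c
    · have hor : g x ∈ E ∨ x + 1 ≤ p x := Or.inr hpx
      simp only [h, hor, true_and, if_true]
      omega
    · simp [h]

theorem clustering_clusterOf (T : OrderedTree q p) (G : Grouping q p b (q - 1) g E μ s)
    (hE : ∀ k < q - 1, p k = q - 1 → g k ∈ E) :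
    Clustering q p (2 * b) (clusterOf q p g E) := by
  have hexit : ∀ x < q - 1, Anc p x (p (clusterOf q p g E x)) ∧ x < p (clusterOf q p g E x) ∧
      ∀ y, Anc p x y → y < p (clusterOf q p g E x) →
        clusterOf q p g E y = clusterOf q p g E x := by
    refine T.induction_from_root fun x hx ih => ?_
    have hpx := T.lt_parent x (by omega)
    by_cases h : g x ∈ E
    · rw [clusterOf_of_mem h, G.parent_leader x hx]
      refine ⟨Anc.parent _ _, hpx, fun y hy hyp => ?_⟩
      obtain rfl | hy' := hy.eq_or_parent
      · exact clusterOf_of_mem h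
      · have := (T.anc_le (T.parent_lt x (by omega)) hy').1
        omega
    · have hp := parent_lt_of_notMem T hE hx h
      obtain ⟨h1, h2, h3⟩ := ih hp
      rw [clusterOf_of_notMem T hx h]
      refine ⟨(Anc.parent _ _).trans h1, by omega, fun y hy hyp => ?_⟩
      obtain rfl | hy' := hy.eq_or_parent
      · exact clusterOf_of_notMem T hx h
      · exact h3 y hy' hyp
  have hmem := clusterOf_mem T hE
  exact ⟨fun x hx => G.mem_lt _ (hmem x hx), fun x hx => (hexit x hx).1,
    fun x hx => (hexit x hx).2.1, fun x hx => (hexit x hx).2.2,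
    fun x hx => clusterCount_clusterOf_lt T G hE (hmem x hx)⟩

open scoped Classical in
/-- The ancestors of `x` in its cluster. -/
noncomputable def clusterPath (q : ℕ) (p cl : ℕ → ℕ) (x : ℕ) : Finset ℕ :=
  (Finset.range (q - 1)).filter fun y => Anc p x y ∧ cl y = cl x

/-- The representation of a set of nodes of a cluster by bits. -/
def nodeBits (q : ℕ) (cl : ℕ → ℕ) (S : Finset ℕ) : ℕ := ∑ y ∈ S, 2 ^ bitIndex q cl y

theorem nodeBits_lt {n c : ℕ} {cl : ℕ → ℕ} (hc : clusterCount q cl 0 c ≤ n) {S : Finset ℕ}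
    (hS : S ⊆ (Finset.range (q - 1)).filter fun y => cl y = c) : nodeBits q cl S < 2 ^ n := by
  have h1 := sum_two_pow_bitIndex (q := q) (cl := cl) (Nat.zero_le (q - 1)) c
  have h2 : nodeBits q cl S ≤ ∑ y ∈ (Finset.Ico 0 (q - 1)).filter (fun y => cl y = c),
      2 ^ bitIndex q cl y := by
    refine Finset.sum_le_sum_of_subset ?_
    rwa [← Finset.range_eq_Ico]
  have h3 : 2 ^ clusterCount q cl 0 c ≤ 2 ^ n := Nat.pow_le_pow_right (by norm_num) hc
  omega

theorem clusterPath_of_mem (T : OrderedTree q p) (G : Grouping q p b (q - 1) g E μ s)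
    (hE : ∀ k < q - 1, p k = q - 1 → g k ∈ E) (hx : x < q - 1) (h : g x ∈ E) :
    clusterPath q p (clusterOf q p g E) x = {x} := by
  have C := clustering_clusterOf T G hE
  ext y
  simp only [clusterPath, Finset.mem_filter, Finset.mem_range, Finset.mem_singleton]
  constructor
  · rintro ⟨hy, hxy, hc⟩
    obtain rfl | hy' := hxy.eq_or_parent
    · rfl
    · have h1 := (T.anc_le (T.parent_lt x (by omega)) hy').1
      have h2 := C.lt_exit y hy
      rw [hc, clusterOf_of_mem h, G.parent_leader x hx] at h2
      omega
  · rintro rfl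
    exact ⟨hx, Anc.refl _ _, rfl⟩

theorem clusterPath_of_notMem (T : OrderedTree q p) (hx : x < q - 1) (h : g x ∉ E) :
    clusterPath q p (clusterOf q p g E) x =
      insert x (clusterPath q p (clusterOf q p g E) (p x)) := by
  have hcl := clusterOf_of_notMem T hx h
  ext y
  simp only [clusterPath, Finset.mem_filter, Finset.mem_range, Finset.mem_insert]
  constructor
  · rintro ⟨hy, hxy, hc⟩
    obtain rfl | hy' := hxy.eq_or_parent
    · exact Or.inl rfl
    · exact Or.inr ⟨hy, hy', by rw [hc, hcl]⟩
  · rintro (rfl | ⟨h1, h2, h3⟩)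
    · exact ⟨hx, Anc.refl _ _, rfl⟩
    · exact ⟨h1, (Anc.parent _ _).trans h2, by rw [h3, hcl]⟩

/-- Compute the clusters and the representations by bits. -/
def clusterNodes : Cmd :=
  forLoop 12 (var 0 - const 1)
    (.seq (assign 13 (var 0 - const 2 - var 12))
    (.seq (assign 28 (load 34 (var 13)))
    (.seq (.ite (load 35 (var 28)) (assign 51 (const 0))
      (.seq (assign 28 (load 36 (load 15 (var 13)))) (assign 51 (load 37 (load 15 (var 13))))))
    (.seq (assign 40 (load 38 (var 28) + const 1))
    (.seq (.store 38 (var 28) (load 38 (var 28) + var 40))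
    (.seq (.store 39 (var 28 * var 30 + var 40) (var 13))
    (.seq (.store 36 (var 13) (var 28))
      (.store 37 (var 13) (var 51 + var 40)))))))))

theorem clusterNodes_spec {B : ℕ} (hB : 16 ≤ B) (hq : q < B) (T : OrderedTree q p)
    (G : Grouping q p b (q - 1) g E μ s) (hE : ∀ k < q - 1, p k = q - 1 → g k ∈ E)
    {K : ℕ} (hK : K = 4 ^ b) (hKB : (q + 2) * K ≤ B)
    {M : Memory} {τ : ℕ} (h00 : M 0 0 = q) (h15 : ∀ x < q, M 15 x = p x) (h30 : M 30 0 = K)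
    (h34 : ∀ k < q - 1, M 34 k = g k) (h35 : ∀ c < q, M 35 c = if c ∈ E then 1 else 0)
    (h38 : M 38 = 0) :
    clusterNodes.VC B (fun M' τ' => τ' ≤ τ + (100 * q + 20) ∧
      (∀ x < q - 1, M' 36 x = clusterOf q p g E x ∧
        M' 37 x = nodeBits q (clusterOf q p g E) (clusterPath q p (clusterOf q p g E) x) ∧
        M' 39 (clusterOf q p g E x * K + 2 ^ bitIndex q (clusterOf q p g E) x : ℕ) = x) ∧
      ∀ c : ℕ, M' 38 c = nodeBits q (clusterOf q p g E)
        ((Finset.range (q - 1)).filter fun y => clusterOf q p g E y = c)) M τ := by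
  have hq0 := T.pos
  have C := clustering_clusterOf T G hE
  have hmem := clusterOf_mem T hE
  have hof := fun x => @clusterOf_of_mem q p g E x
  have hof' := fun x => @clusterOf_of_notMem q p g E x T
  have hpath := fun x => @clusterPath_of_mem q b p g E μ s x T G hE
  have hpath' := fun x => @clusterPath_of_notMem q p g E x T
  generalize clusterOf q p g E = cl at *
  have hK2 : K = 2 ^ (2 * b) := by rw [hK, pow_mul]; norm_num
  have hbits : ∀ x < q - 1, 2 ^ bitIndex q cl x < K := by
    intro x hx
    rw [hK2]
    exact Nat.pow_lt_pow_right (by norm_num) ((bitIndex_lt_count hx).trans (C.count_lt x hx))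
  have hpathlt : ∀ x < q - 1, nodeBits q cl (clusterPath q p cl x) < K := by
    intro x hx
    rw [hK2]
    refine nodeBits_lt (C.count_lt x hx).le fun y hy => ?_
    simp only [clusterPath, Finset.mem_filter] at hy ⊢
    exact ⟨hy.1, hy.2.2⟩
  have hKpos : 0 < K := by rw [hK]; positivity
  have hKq : q * K + 2 * K ≤ B := by rw [← Nat.add_mul]; exact hKB
  refine vc_for hB (n := q - 1) (by omega)
    (fun i M' τ' => τ' ≤ τ + (100 * i + 3) ∧ M' 0 = M 0 ∧ M' 15 = M 15 ∧ M' 30 = M 30 ∧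
      M' 34 = M 34 ∧ M' 35 = M 35 ∧
      (∀ x < q - 1, q - 1 - i ≤ x → M' 36 x = cl x ∧
        M' 37 x = nodeBits q cl (clusterPath q p cl x) ∧
        M' 39 (cl x * K + 2 ^ bitIndex q cl x : ℕ) = x) ∧
      ∀ c : ℕ, M' 38 c = 2 ^ clusterCount q cl (q - 1 - i) c - 1) (τ + (100 * q + 3))
      ?_ ?_ ?_ ?_ ?_
  · intro i M' τ' hi h
    have := h.1
    omega
  · intro i M' τ' hi h
    simp [h.2.1, h00]
    omega
  · refine ⟨by simp, by simp, by simp, by simp, by simp, by simp, fun x hx hx' => by omega, ?_⟩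
    intro c
    simp [h38, clusterCount]
  · rintro i M' τ' hi ⟨hτ, e0, e15, e30, e34, e35, ex, e38⟩ hv
    obtain ⟨x, hxdef⟩ : ∃ x, x = q - 2 - i := ⟨_, rfl⟩
    have hx : x < q - 1 := by omega
    have hxi : q - 1 - i = x + 1 := by omega
    have hxi' : q - 1 - (i + 1) = x := by omega
    rw [hxi] at ex e38
    rw [hxi']
    have hxval : (q : ℤ) - 2 - i = x := by omega
    have hpx := T.lt_parent x (by omega)
    have hclx := C.leader_lt x hx
    have hbx := hbits x hx
    have hpl := hpathlt x hx
    have hgx : g x < q := by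
      have := G.leader_le x hx
      omega
    have hclK : cl x * K + K ≤ q * K := by
      have := Nat.mul_le_mul_right K (show cl x + 1 ≤ q by omega)
      rwa [Nat.succ_mul] at this
    have hclKB : (cl x : ℤ) * K + K ≤ q * K := by exact_mod_cast hclK
    have hKqB : (q : ℤ) * K + 2 * K ≤ B := by exact_mod_cast hKq
    have hclK0 : (0 : ℤ) ≤ cl x * K := by positivity
    have hbxZ : (2 : ℤ) ^ bitIndex q cl x < K := by exact_mod_cast hbx
    have hbxpos : (0 : ℤ) < 2 ^ bitIndex q cl x := by positivity
    have hplZ : (nodeBits q cl (clusterPath q p cl x) : ℤ) < K := by exact_mod_cast hpl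
    have hcount : ∀ c, (2 : ℤ) ^ clusterCount q cl x c - 1 = if c = cl x then
        (2 : ℤ) ^ bitIndex q cl x - 1 + 2 ^ bitIndex q cl x
        else 2 ^ clusterCount q cl (x + 1) c - 1 := by
      intro c
      rw [clusterCount_succ hx]
      by_cases h : c = cl x
      · subst h
        simp only [if_true, pow_succ, bitIndex]
        ring
      · simp [h, Ne.symm h]
    have hcx : M' 38 (cl x) = 2 ^ bitIndex q cl x - 1 := e38 (cl x)
    have hmain : ∀ (M₁ : Memory) (τ₁ : ℕ) (v : ℤ), τ₁ ≤ τ + (100 * i + 3) + 40 → M₁ 0 = M 0 →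
        M₁ 15 = M 15 → M₁ 30 = M 30 → M₁ 34 = M 34 → M₁ 35 = M 35 → M₁ 36 = M' 36 →
        M₁ 37 = M' 37 → M₁ 38 = M' 38 → M₁ 39 = M' 39 → M₁ 12 0 = i → M₁ 13 0 = x →
        M₁ 28 0 = cl x → M₁ 51 0 = v →
        v + 2 ^ bitIndex q cl x = nodeBits q cl (clusterPath q p cl x) →
        Cmd.VC B (.seq (assign 40 (load 38 (var 28) + const 1))
          (.seq (.store 38 (var 28) (load 38 (var 28) + var 40))
          (.seq (.store 39 (var 28 * var 30 + var 40) (var 13))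
          (.seq (.store 36 (var 13) (var 28))
          (.store 37 (var 13) (var 51 + var 40)))))) (fun M' τ' => M' 12 0 = i ∧
          τ' + 6 ≤ τ + (100 * (i + 1) + 3) ∧ (M'.set 12 0 (i + 1)) 0 = M 0 ∧
          (M'.set 12 0 (i + 1)) 15 = M 15 ∧ (M'.set 12 0 (i + 1)) 30 = M 30 ∧
          (M'.set 12 0 (i + 1)) 34 = M 34 ∧ (M'.set 12 0 (i + 1)) 35 = M 35 ∧
          (∀ y < q - 1, x ≤ y → (M'.set 12 0 (i + 1)) 36 y = cl y ∧
            (M'.set 12 0 (i + 1)) 37 y = nodeBits q cl (clusterPath q p cl y) ∧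
            (M'.set 12 0 (i + 1)) 39 (cl y * K + 2 ^ bitIndex q cl y : ℕ) = y) ∧
          ∀ c : ℕ, (M'.set 12 0 (i + 1)) 38 c = 2 ^ clusterCount q cl x c - 1) M₁ τ₁ := by
      intro M₁ τ₁ v hτ₁ d0 d15 d30 d34 d35 d36 d37 d38 d39 d12 d13 d28 d51 hv'
      simp only [vc_seq_iff, vc_assign, vc_store]
      simp [d0, d15, d30, d34, d35, d36, d37, d38, d39, d12, d13, d28, d51, hcx, h30, hv', hcount]
      refine ⟨by omega, by omega, by omega, by omega, by omega, fun y hy hxy => ?_, fun c => ?_⟩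
      · obtain hxy | rfl := Nat.lt_or_eq_of_le hxy
        · obtain ⟨h1, h2, h3⟩ := ex y hy hxy
          rw [if_neg (by omega), if_neg (by omega), if_neg]
          · push_cast at h3
            exact ⟨h1, h2, h3⟩
          · intro heq
            have heq' : cl y * K + 2 ^ bitIndex q cl y = cl x * K + 2 ^ bitIndex q cl x := by
              exact_mod_cast heq
            have hby := hbits y hy
            have hcc : cl y = cl x := by
              rw [← (mul_add_div_mod (x := cl y) hby).1, heq', (mul_add_div_mod hbx).1]
            have hbb : 2 ^ bitIndex q cl y = 2 ^ bitIndex q cl x := by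
              rw [hcc] at heq'
              omega
            have := bitIndex_lt hxy hy hcc.symm
            have := Nat.pow_lt_pow_right (show 1 < 2 by norm_num) this
            omega
        · simp
      · split_ifs with h
        · rfl
        · rw [e38]
    rw [vc_seq_iff, vc_assign]
    refine ⟨by simp [e0, h00]; omega, ?_⟩
    rw [vc_seq_iff, vc_assign]
    refine ⟨by simp, ?_⟩
    rw [vc_seq_iff, vc_ite]
    simp only [cost_sub, cost_var, cost_const, cost_load]
    simp only [val_sub, val_var, val_const, val_load, e0, h00, hv, hxval]
    refine ⟨by simp, fun h => ?_, fun h => ?_⟩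
    · have hgE : g x ∈ E := by
        by_contra hcon
        simp [e34, e35, h34 x hx, h35 _ hgx, hcon] at h
      rw [vc_assign]
      refine ⟨by simp, hmain _ _ 0 ?_ (by simp [e0]) (by simp [e15]) (by simp [e30]) (by simp [e34])
        (by simp [e35]) (by simp) (by simp) (by simp) (by simp) (by simp [hv]) (by simp) ?_ (by simp)
        ?_⟩
      · simp only [cost_const]
        omega
      · simp [e34, h34 x hx, hof x hgE]
      · rw [hpath x hx hgE]
        simp [nodeBits]
    · have hgE : g x ∉ E := by
        intro hcon
        simp [e34, e35, h34 x hx, h35 _ hgx, hcon] at h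
      have hpx' := parent_lt_of_notMem T hE hx hgE
      obtain ⟨h1, h2, h3⟩ := ex (p x) hpx' hpx
      rw [vc_seq_iff, vc_assign]
      refine ⟨by simp, ?_⟩
      rw [vc_assign]
      refine ⟨by simp, hmain _ _ (nodeBits q cl (clusterPath q p cl (p x))) ?_ (by simp [e0])
        (by simp [e15]) (by simp [e30]) (by simp [e34])
        (by simp [e35]) (by simp) (by simp) (by simp) (by simp) (by simp [hv]) (by simp) ?_ ?_ ?_⟩
      · simp only [cost_load, cost_var]
        omega
      · simp [e15, h15 x (by omega), h1, hof' x hx hgE]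
      · simp [e15, h15 x (by omega), h2]
      · rw [hpath' x hx hgE, nodeBits, nodeBits, Finset.sum_insert]
        · push_cast
          ring
        · simp only [clusterPath, Finset.mem_filter, not_and]
          intro _ h'
          have := (T.anc_le (T.parent_lt x (by omega)) h').1
          omega
  · rintro M' τ' ⟨hτ, e0, e15, e30, e34, e35, ex, e38⟩ hv
    simp only [cost_sub, cost_var, cost_const]
    rw [Nat.sub_self] at ex e38
    refine ⟨by omega, fun x hx => ex x hx (Nat.zero_le _), fun c => ?_⟩
    have h1 := sum_two_pow_bitIndex (q := q) (cl := cl) (Nat.zero_le (q - 1)) c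
    rw [e38, nodeBits, Finset.range_eq_Ico]
    have h2 : ((2 : ℤ) ^ clusterCount q cl 0 c) = ((2 ^ clusterCount q cl 0 c : ℕ) : ℤ) := by
      push_cast
      rfl
    rw [h2, ← h1]
    push_cast
    ring

end WordRAM

/-!
# Sets of clusters
-/

namespace WordRAM

open WordRAM.Expr WordRAM.Cmd

/-- The number of the elements of `E` that are represented by `r`. -/
def classSize (E : Finset ℕ) (rep : ℕ → ℕ) (r : ℕ) : ℕ := (E.filter fun c => rep c = r).card

/-- The representatives after replacing `a` by `b`. -/
def mergeRep (rep : ℕ → ℕ) (a b : ℕ) (c : ℕ) : ℕ := if rep c = a then b else rep c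

/-- A partition of `E` as it is stored: the representative of every element, the top (an arbitrary
element), the size and the elements of every set. -/
structure SetPartition (q : ℕ) (E : Finset ℕ) (rep top : ℕ → ℕ) (M : Memory) : Prop where
  rep_mem : ∀ c ∈ E, rep c ∈ E
  rep_rep : ∀ c ∈ E, rep (rep c) = rep c
  top_mem : ∀ r ∈ E, rep r = r → top r ∈ E
  load_rep : ∀ c ∈ E, M 41 c = rep c
  load_top : ∀ r ∈ E, rep r = r → M 42 r = top r
  load_size : ∀ r ∈ E, rep r = r → M 43 r = classSize E rep r
  load_elem : ∀ r ∈ E, rep r = r → ∀ k < classSize E rep r, ∃ c ∈ E, rep c = r ∧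
    M 44 (r * q + k : ℕ) = c
  cover : ∀ c ∈ E, ∃ k < classSize E rep (rep c), M 44 (rep c * q + k : ℕ) = c

variable {q : ℕ} {E : Finset ℕ} {rep top : ℕ → ℕ} {a b : ℕ}

theorem SetPartition.congr {M M' : Memory} (h : SetPartition q E rep top M) (h41 : M' 41 = M 41)
    (h42 : M' 42 = M 42) (h43 : M' 43 = M 43) (h44 : M' 44 = M 44) :
    SetPartition q E rep top M' := by
  obtain ⟨h1, h2, h3, h4, h5, h6, h7, h8⟩ := h
  exact ⟨h1, h2, h3, by rwa [h41], by rwa [h42], by rwa [h43], by rwa [h44], by rwa [h44]⟩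

theorem classSize_pos {c : ℕ} (hc : c ∈ E) : 0 < classSize E rep (rep c) :=
  Finset.card_pos.2 ⟨c, by simp [hc]⟩

theorem classSize_add_le (hab : a ≠ b) : classSize E rep a + classSize E rep b ≤ E.card := by
  rw [classSize, classSize, ← Finset.card_union_of_disjoint]
  · exact Finset.card_le_card (Finset.union_subset (Finset.filter_subset _ _)
      (Finset.filter_subset _ _))
  · rw [Finset.disjoint_filter]
    rintro c _ rfl h
    exact hab h

theorem classSize_le (r : ℕ) : classSize E rep r ≤ E.card := Finset.card_filter_le _ _

theorem classSize_mergeRep_same (hab : a ≠ b) : classSize E (mergeRep rep a b) b =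
    classSize E rep a + classSize E rep b := by
  rw [classSize, classSize, classSize, ← Finset.card_union_of_disjoint]
  · congr 1
    ext c
    by_cases h : rep c = a <;> simp [mergeRep, h, hab]
  · rw [Finset.disjoint_filter]
    rintro c _ rfl h
    exact hab h

theorem classSize_mergeRep_of_ne {r : ℕ} (hra : r ≠ a) (hrb : r ≠ b) :
    classSize E (mergeRep rep a b) r = classSize E rep r := by
  rw [classSize, classSize]
  congr 1
  refine Finset.filter_congr fun c _ => ?_
  rw [mergeRep]
  split_ifs with h
  · rw [h]
    exact ⟨fun h' => absurd h'.symm hrb, fun h' => absurd h'.symm hra⟩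
  · rfl

/-- The potential for the time to merge sets. -/
def potential (n : ℕ) (E : Finset ℕ) (rep : ℕ → ℕ) : ℕ :=
  ∑ c ∈ E, (Nat.log 2 n - Nat.log 2 (classSize E rep (rep c)))

theorem potential_mergeRep {n : ℕ} (hn : E.card ≤ n) (hab : a ≠ b)
    (hsize : classSize E rep a ≤ classSize E rep b) :
    potential n E (mergeRep rep a b) + classSize E rep a ≤ potential n E rep := by
  have h1 : classSize E rep a = ∑ c ∈ E, if rep c = a then 1 else 0 := by
    rw [classSize, Finset.card_filter]
  rw [h1, potential, potential, ← Finset.sum_add_distrib]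
  refine Finset.sum_le_sum fun c hc => ?_
  by_cases hca : rep c = a
  · have h2 : mergeRep rep a b c = b := by simp [mergeRep, hca]
    have h3 : 0 < classSize E rep a := hca ▸ classSize_pos hc
    have h4 : classSize E rep a + classSize E rep b ≤ E.card := classSize_add_le hab
    rw [h2, hca, classSize_mergeRep_same hab, if_pos rfl]
    have h5 : Nat.log 2 (classSize E rep a * 2) ≤ Nat.log 2 (classSize E rep a + classSize E rep b) :=
      Nat.log_mono_right (by omega)
    rw [Nat.log_mul_base (by norm_num) h3.ne'] at h5
    have h6 : Nat.log 2 (classSize E rep a + classSize E rep b) ≤ Nat.log 2 n :=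
      Nat.log_mono_right (by omega)
    omega
  · have h2 : mergeRep rep a b c = rep c := by simp [mergeRep, hca]
    rw [h2, if_neg hca]
    by_cases hcb : rep c = b
    · rw [hcb, classSize_mergeRep_same hab]
      have : Nat.log 2 (classSize E rep b) ≤ Nat.log 2 (classSize E rep a + classSize E rep b) :=
        Nat.log_mono_right (by omega)
      omega
    · rw [classSize_mergeRep_of_ne hca hcb]
      omega

/-- Move the elements of the set with representative `var 52` to the set with representative
`var 53`, whose top becomes `var 54`. -/
def relabel : Cmd :=
  .seq (forLoop 27 (load 43 (var 52))
    (.seq (assign 56 (load 44 (var 52 * var 0 + var 27)))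
    (.seq (.store 41 (var 56) (var 53))
      (.store 44 (var 53 * var 0 + (load 43 (var 53) + var 27)) (var 56)))))
  (.seq (.store 43 (var 53) (load 43 (var 53) + load 43 (var 52)))
    (.store 42 (var 53) (var 54)))

theorem mul_add_inj {n i j k l : ℕ} (hj : j < n) (hl : l < n) (h : i * n + j = k * n + l) :
    i = k ∧ j = l := by
  have h1 := mul_add_div_mod (x := i) hj
  rw [h, (mul_add_div_mod hl).1, (mul_add_div_mod hl).2] at h1
  exact ⟨h1.1.symm, h1.2.symm⟩

theorem relabel_spec {B : ℕ} (hB : 16 ≤ B) (hqB : q * q ≤ B) (hE : ∀ c ∈ E, c < q)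
    (hEq : E.card < q) {M : Memory} {τ : ℕ} (S : SetPartition q E rep top M) (ha : a ∈ E)
    (hb : b ∈ E) (hra : rep a = a) (hrb : rep b = b) (hab : a ≠ b) {t : ℕ} (ht : t ∈ E)
    (h00 : M 0 0 = q) (h52 : M 52 0 = a) (h53 : M 53 0 = b) (h54 : M 54 0 = t) :
    relabel.VC B (fun M' τ' => τ' ≤ τ + (60 * classSize E rep a + 50) ∧
      SetPartition q E (mergeRep rep a b) (Function.update top b t) M') M τ := by
  have hsum := classSize_add_le (E := E) (rep := rep) hab
  have hqq : q ≤ q * q := Nat.le_mul_of_pos_left q (by omega)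
  have hblock : ∀ c < q, ∀ j < q, c * q + j < q * q := by
    intro c hc j hj
    have := Nat.mul_le_mul_right q (Nat.succ_le_of_lt hc)
    rw [Nat.succ_mul] at this
    omega
  have ha' := hE a ha
  have hb' := hE b hb
  have h43a := S.load_size a ha hra
  have h43b := S.load_size b hb hrb
  refine vc_seq (P := fun M' τ' => τ' ≤ τ + (60 * classSize E rep a + 20) ∧ M' 53 = M 53 ∧
      M' 52 = M 52 ∧ M' 54 = M 54 ∧ M' 43 = M 43 ∧ M' 42 = M 42 ∧
      (∀ c ∈ E, rep c ≠ a → M' 41 c = M 41 c) ∧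
      (∀ k < classSize E rep a, M' 41 (M 44 (a * q + k : ℕ)) = b ∧
        M' 44 (b * q + (classSize E rep b + k) : ℕ) = M 44 (a * q + k : ℕ)) ∧
      ∀ r ∈ E, ∀ k < classSize E rep r, M' 44 (r * q + k : ℕ) = M 44 (r * q + k : ℕ)) ?_ ?_
  · refine vc_for hB (n := classSize E rep a) (by omega)
      (fun i M' τ' => τ' ≤ τ + (60 * i + 3) ∧ M' 0 = M 0 ∧ M' 53 = M 53 ∧
        M' 52 = M 52 ∧ M' 54 = M 54 ∧ M' 43 = M 43 ∧ M' 42 = M 42 ∧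
        (∀ c ∈ E, rep c ≠ a → M' 41 c = M 41 c) ∧
        (∀ k < i, M' 41 (M 44 (a * q + k : ℕ)) = b ∧
          M' 44 (b * q + (classSize E rep b + k) : ℕ) = M 44 (a * q + k : ℕ)) ∧
        ∀ r ∈ E, ∀ k < classSize E rep r, M' 44 (r * q + k : ℕ) = M 44 (r * q + k : ℕ))
      (τ + (60 * classSize E rep a + 3)) ?_ ?_ ?_ ?_ ?_
    · intro i M' τ' hi h
      have := h.1
      omega
    · intro i M' τ' hi h
      simp [h.2.2.2.1, h.2.2.2.2.2.1, h52, h43a]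
    · simp
    · rintro i M' τ' hi ⟨hτ, e0, e53, e52, e54, e43, e42, e41, ek, e44⟩ hv
      obtain ⟨x, hxE, hxa, hx⟩ := S.load_elem a ha hra i hi
      have hx' := e44 a ha i hi
      rw [hx] at hx'
      have h1 := hblock a ha' i (by omega)
      have h2 := hblock b hb' (classSize E rep b + i) (by omega)
      have h3 : (a : ℤ) * q + i < (q * q : ℕ) := by exact_mod_cast h1
      have h4 : (b : ℤ) * q + (classSize E rep b + i) < (q * q : ℕ) := by exact_mod_cast h2
      have h5 : (0 : ℤ) ≤ a * q := by positivity
      have h6 : (0 : ℤ) ≤ b * q := by positivity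
      push_cast at hx'
      simp only [vc_seq_iff, vc_assign, vc_store]
      simp [e0, e53, e52, e54, e43, e42, hv, h00, h52, h53, h43b, hx']
      refine ⟨by omega, by omega, by omega, ?_, ?_, ?_⟩
      · intro c hc hca
        rw [if_neg (by rintro rfl; exact hca hxa), e41 c hc hca]
      · intro k hk
        obtain hk | rfl := Nat.lt_or_eq_of_le hk
        · obtain ⟨h7, h8⟩ := ek k hk
          push_cast at h7 h8
          refine ⟨fun _ => h7, ?_⟩
          rw [if_neg (by omega), h8]
        · push_cast at hx
          simp [hx]
      · intro r hr k hk
        rw [if_neg]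
        · have := e44 r hr k hk
          push_cast at this
          exact this
        · intro heq
          have heq' : r * q + k = b * q + (classSize E rep b + i) := by exact_mod_cast heq
          have hcr := classSize_le (E := E) (rep := rep) r
          obtain ⟨rfl, h8⟩ := mul_add_inj (by omega) (by omega) heq'
          omega
    · rintro M' τ' ⟨hτ, e0, e53, e52, e54, e43, e42, e41, ek, e44⟩ hv
      simp only [cost_load, cost_var]
      exact ⟨by omega, e53, e52, e54, e43, e42, e41, ek, e44⟩
  · rintro M₁ τ₁ ⟨hτ, e53, e52, e54, e43, e42, e41, ek, e44⟩ -
    simp only [vc_seq_iff, vc_store]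
    simp [e53, e52, e54, e43, h52, h53, h54, h43a, h43b]
    have hmb : mergeRep rep a b b = b := by simp [mergeRep, hrb, hab.symm]
    have hroot : ∀ r ∈ E, mergeRep rep a b r = r → r ≠ a ∧ rep r = r := by
      intro r hr h
      rw [mergeRep] at h
      split_ifs at h with h'
      · subst h
        rw [hrb] at h'
        exact absurd h'.symm hab
      · refine ⟨?_, h⟩
        rintro rfl
        exact h' h
    refine ⟨by omega, by omega, ?_, ?_, ?_, ?_, ?_, ?_, ?_, ?_⟩
    · intro c hc
      rw [mergeRep]
      split_ifs
      exacts [hb, S.rep_mem c hc]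
    · intro c hc
      by_cases h : rep c = a
      · simp [mergeRep, h, hrb, hab.symm]
      · simp [mergeRep, h, S.rep_rep c hc]
    · intro r hr h
      by_cases hrb' : r = b
      · simp [hrb', ht]
      · rw [Function.update_of_ne hrb']
        exact S.top_mem r hr (hroot r hr h).2
    · intro c hc
      rw [Memory.set_of_ne _ _ _ (by norm_num), Memory.set_of_ne _ _ _ (by norm_num), mergeRep]
      split_ifs with h
      · obtain ⟨k, hk, hc'⟩ := S.cover c hc
        rw [h] at hk hc'
        have := (ek k hk).1
        rwa [hc'] at this
      · rw [e41 c hc h, S.load_rep c hc]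
    · intro r hr h
      by_cases hrb' : r = b
      · simp [hrb']
      · rw [Function.update_of_ne hrb']
        simp [hrb', e42, S.load_top r hr (hroot r hr h).2]
    · intro r hr h
      by_cases hrb' : r = b
      · subst hrb'
        simp [classSize_mergeRep_same hab]
        ring
      · rw [classSize_mergeRep_of_ne (hroot r hr h).1 hrb']
        simp [hrb', e43, S.load_size r hr (hroot r hr h).2]
    · intro r hr h k hk
      obtain ⟨hra', hrr⟩ := hroot r hr h
      rw [Memory.set_of_ne _ _ _ (by norm_num), Memory.set_of_ne _ _ _ (by norm_num)]
      by_cases hrb' : r = b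
      · subst hrb'
        rw [classSize_mergeRep_same hab] at hk
        by_cases hkb : k < classSize E rep r
        · obtain ⟨c, hc, hcr, h7⟩ := S.load_elem r hr hrr k hkb
          exact ⟨c, hc, by simp [mergeRep, hcr], by rw [e44 r hr k hkb, h7]⟩
        · obtain ⟨c, hc, hcr, h7⟩ := S.load_elem a ha hra (k - classSize E rep r) (by omega)
          refine ⟨c, hc, by simp [mergeRep, hcr], ?_⟩
          have := (ek (k - classSize E rep r) (by omega)).2
          rw [show classSize E rep r + (k - classSize E rep r) = k by omega] at this
          rw [this, h7]
      · rw [classSize_mergeRep_of_ne hra' hrb'] at hk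
        obtain ⟨c, hc, hcr, h7⟩ := S.load_elem r hr hrr k hk
        exact ⟨c, hc, by simp [mergeRep, hcr, hra'], by rw [e44 r hr k hk, h7]⟩
    · intro c hc
      rw [Memory.set_of_ne _ _ _ (by norm_num), Memory.set_of_ne _ _ _ (by norm_num)]
      obtain ⟨k, hk, h7⟩ := S.cover c hc
      by_cases h : rep c = a
      · have h8 : mergeRep rep a b c = b := by simp [mergeRep, h]
        rw [h8, classSize_mergeRep_same hab]
        rw [h] at hk h7
        exact ⟨classSize E rep b + k, by omega, by rw [(ek k hk).2, h7]⟩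
      · have h8 : mergeRep rep a b c = rep c := by simp [mergeRep, h]
        rw [h8]
        refine ⟨k, ?_, by rw [e44 _ (S.rep_mem c hc) k hk, h7]⟩
        by_cases hcb : rep c = b
        · rw [hcb, classSize_mergeRep_same hab]
          rw [hcb] at hk
          omega
        · rwa [classSize_mergeRep_of_ne h hcb]

/-- Unite the sets of `var 61` and `e`, keeping the top of the latter. -/
def unite (e : Expr) : Cmd :=
  .seq (assign 52 (load 41 (var 61)))
  (.seq (assign 53 (load 41 e))
  (.seq (assign 54 (load 42 (var 53)))
  (.seq (.ite (lt (load 43 (var 53)) (load 43 (var 52)))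
      (.seq (assign 55 (var 52)) (.seq (assign 52 (var 53)) (assign 53 (var 55)))) .skip)
    relabel)))

/-- The partition into singletons. -/
def initSets : Cmd :=
  forLoop 12 (var 0)
    (.seq (.store 41 (var 12) (var 12))
    (.seq (.store 42 (var 12) (var 12))
    (.seq (.store 43 (var 12) (const 1))
      (.store 44 (var 12 * var 0) (var 12)))))

theorem initSets_spec {B : ℕ} (hB : 16 ≤ B) (hqB : q * q ≤ B) (hqB' : q ≤ B)
    (hE : ∀ c ∈ E, c < q)
    {M : Memory} {τ : ℕ} (h00 : M 0 0 = q) :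
    initSets.VC B (fun M' τ' => τ' ≤ τ + (50 * q + 20) ∧ SetPartition q E id id M') M τ := by
  refine vc_for hB (n := q) hqB'
    (fun i M' τ' => τ' ≤ τ + (50 * i + 3) ∧ M' 0 = M 0 ∧ ∀ c < i, M' 41 c = (c : ℕ) ∧
      M' 42 c = (c : ℕ) ∧ M' 43 c = 1 ∧ M' 44 (c * q : ℕ) = (c : ℕ)) (τ + (50 * q + 3)) ?_ ?_ ?_ ?_ ?_
  · intro i M' τ' hi h
    have := h.1
    omega
  · intro i M' τ' hi h
    simp [h.2.1, h00]
  · simp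
  · rintro i M' τ' hi ⟨hτ, e0, ec⟩ hv
    have h1 : i * q ≤ q * q := Nat.mul_le_mul_right q hi.le
    have h2 : (i : ℤ) * q ≤ (q * q : ℕ) := by exact_mod_cast h1
    have h3 : (0 : ℤ) ≤ i * q := by positivity
    simp [e0, hv, h00]
    refine ⟨by omega, by omega, fun c hc => ?_⟩
    obtain hc | rfl := Nat.lt_or_eq_of_le hc
    · obtain ⟨h4, h5, h6, h7⟩ := ec c hc
      push_cast at h7
      have h8 : c ≠ i := hc.ne
      refine ⟨by rw [if_neg h8, h4], by rw [if_neg h8, h5], fun _ => h6, ?_⟩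
      rw [if_neg, h7]
      intro heq
      have := hc.ne
      have hq : q ≠ 0 := by omega
      simp_all
    · simp
  · rintro M' τ' ⟨hτ, e0, ec⟩ hv
    have hsize : ∀ c ∈ E, classSize E id c = 1 := by
      intro c hc
      rw [classSize, Finset.card_eq_one]
      refine ⟨c, ?_⟩
      ext d
      simp only [id, Finset.mem_filter, Finset.mem_singleton]
      exact ⟨fun h => h.2, fun h => ⟨h ▸ hc, h⟩⟩
    simp only [cost_var]
    refine ⟨by omega, fun c hc => hc, fun c hc => rfl, fun c hc _ => hc,
      fun c hc => (ec c (hE c hc)).1, fun c hc _ => (ec c (hE c hc)).2.1, fun c hc _ => ?_,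
      fun c hc _ k hk => ?_, fun c hc => ?_⟩
    · rw [hsize c hc]
      exact (ec c (hE c hc)).2.2.1
    · rw [hsize c hc] at hk
      obtain rfl : k = 0 := by omega
      exact ⟨c, hc, rfl, (ec c (hE c hc)).2.2.2⟩
    · exact ⟨0, classSize_pos hc, (ec c (hE c hc)).2.2.2⟩

theorem unite_spec {B : ℕ} (hB : 16 ≤ B) (hqB : q * q ≤ B) (hE : ∀ c ∈ E, c < q)
    (hEq : E.card < q) {n : ℕ} (hn : E.card ≤ n) {M : Memory} {τ : ℕ}
    (S : SetPartition q E rep top M)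
    {c d : ℕ} (hc : c ∈ E) (hd : d ∈ E) (hcd : rep c ≠ rep d) (h00 : M 0 0 = q) (h61 : M 61 0 = c)
    {e : Expr} (hok : ∀ z, e.Ok B (M.set 52 0 z)) (hval : ∀ z, e.val (M.set 52 0 z) = d)
    (hcost : e.cost ≤ 20) :
    (unite e).VC B (fun M' τ' => ∃ rep' top', SetPartition q E rep' top' M' ∧
      τ' + 400 * potential n E rep' + 150 ≤ τ + 400 * potential n E rep ∧
      ∀ x ∈ E, top' (rep' x) = if rep x = rep c then top (rep d) else top (rep x)) M τ := by
  have hrc := S.rep_mem c hc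
  have hrd := S.rep_mem d hd
  have hrrc := S.rep_rep c hc
  have hrrd := S.rep_rep d hd
  have h42d := S.load_top _ hrd hrrd
  have h43c := S.load_size _ hrc hrrc
  have h43d := S.load_size _ hrd hrrd
  simp only [unite, vc_seq_iff, vc_assign, vc_ite, vc_skip]
  simp [hok, hval, h61, S.load_rep c hc, S.load_rep d hd, h42d, h43c, h43d]
  refine ⟨fun h => ?_, fun h => ?_⟩
  · refine vc_mono (relabel_spec hB hqB hE hEq
      (S.congr (by simp) (by simp) (by simp) (by simp)) hrd hrc hrrd hrrc hcd.symm
      (S.top_mem _ hrd hrrd) (by simp [h00]) (by simp) (by simp) (by simp)) ?_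
    rintro M' τ' ⟨hτ', S'⟩
    have hpot := potential_mergeRep hn hcd.symm h.le
    have hpos := classSize_pos (rep := rep) hd
    refine ⟨_, _, S', by omega, fun x hx => ?_⟩
    by_cases h1 : rep x = rep d
    · have h2 : mergeRep rep (rep d) (rep c) x = rep c := by simp [mergeRep, h1]
      rw [h2, Function.update_self, h1]
      simp
    · have h2 : mergeRep rep (rep d) (rep c) x = rep x := by simp [mergeRep, h1]
      rw [h2]
      by_cases h3 : rep x = rep c
      · simp [h3]
      · rw [Function.update_of_ne h3, if_neg h3]
  · refine vc_mono (relabel_spec hB hqB hE hEq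
      (S.congr (by simp) (by simp) (by simp) (by simp)) hrc hrd hrrc hrrd hcd
      (S.top_mem _ hrd hrrd) (by simp [h00]) (by simp) (by simp) (by simp)) ?_
    rintro M' τ' ⟨hτ', S'⟩
    have hpot := potential_mergeRep hn hcd h
    have hpos := classSize_pos (rep := rep) hc
    refine ⟨_, _, S', by omega, fun x hx => ?_⟩
    by_cases h1 : rep x = rep c
    · have h2 : mergeRep rep (rep c) (rep d) x = rep d := by simp [mergeRep, h1]
      rw [h2, Function.update_self, if_pos h1]
    · have h2 : mergeRep rep (rep c) (rep d) x = rep x := by simp [mergeRep, h1]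
      rw [h2, if_neg h1]
      by_cases h3 : rep x = rep d
      · simp [h3]
      · rw [Function.update_of_ne h3]

end WordRAM

/-!
# Marking the nodes by descending weight
-/

namespace WordRAM

open WordRAM.Expr WordRAM.Cmd

/-- `z` is an ancestor of `x`, and the nodes from `x` up to `z`, excluding `z`, are not in `U`. -/
def Free (p : ℕ → ℕ) (U : Finset ℕ) (x z : ℕ) : Prop :=
  Anc p x z ∧ ∀ y, Anc p x y → y < z → y ∉ U

/-- The node `y` lies on the path from `lo i` up to its ancestor `up i`, excluding `up i`. -/
def OnPath (p lo up : ℕ → ℕ) (i y : ℕ) : Prop := Anc p (lo i) y ∧ y < up i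

/-- The maximum of the weights of the paths through `y` is `v`. -/
def IsMaxWeight (m : ℕ) (p lo up : ℕ → ℕ) (w : ℕ → ℤ) (y : ℕ) (v : ℤ) : Prop :=
  (∃ i < m, OnPath p lo up i y ∧ v = w i) ∧ ∀ j < m, OnPath p lo up j y → w j ≤ v

/-- The representation of the lowest ancestor of `x` in `U` that is in the cluster of `x`; it is `0`
if there is none. -/
noncomputable def lookup (q : ℕ) (p cl : ℕ → ℕ) (U : Finset ℕ) (x : ℕ) : ℕ :=
  commonBit (nodeBits q cl (clusterPath q p cl x)) (nodeBits q cl (U.filter fun y => cl y = cl x))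

section Free

variable {q n : ℕ} {p cl : ℕ → ℕ} {U V : Finset ℕ} {x y z : ℕ}

theorem Free.mono (h : Free p U x z) (hV : V ⊆ U) : Free p V x z :=
  ⟨h.1, fun y h1 h2 h3 => h.2 y h1 h2 (hV h3)⟩

theorem Free.trans (T : OrderedTree q p) (hx : x < q) (h : Free p U x y) (h' : Free p U y z) :
    Free p U x z := by
  refine ⟨h.1.trans h'.1, fun v hv hvz => ?_⟩
  obtain h1 | h1 := h.1.total hv
  · exact h'.2 v h1 hvz
  · obtain h2 | rfl := (T.anc_le (T.anc_le hx hv).2 h1).1.lt_or_eq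
    · exact h.2 v hv h2
    · exact h'.2 v (Anc.refl _ _) hvz

theorem Free.parent (T : OrderedTree q p) (hx : x < q) (h : x ∉ U) : Free p U x (p x) := by
  refine ⟨Anc.parent _ _, fun y hy hlt => ?_⟩
  obtain rfl | hy := hy.eq_or_parent
  · exact h
  · have := (T.anc_le (T.parent_lt x hx) hy).1
    omega

theorem Free.refl (T : OrderedTree q p) (hx : x < q) : Free p U x x := by
  refine ⟨Anc.refl _ _, fun y hy hlt => ?_⟩
  have := (T.anc_le hx hy).1
  omega

theorem lookup_spec (T : OrderedTree q p) (C : Clustering q p n cl) (hU : U ⊆ Finset.range (q - 1))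
    (hx : x < q - 1) : (lookup q p cl U x = 0 → Free p U x (p (cl x))) ∧
    (lookup q p cl U x ≠ 0 → ∃ y ∈ U, cl y = cl x ∧ lookup q p cl U x = 2 ^ bitIndex q cl y ∧
      Free p U x y) := by
  have hsub : clusterPath q p cl x ⊆ (Finset.range (q - 1)).filter fun y => cl y = cl x := by
    intro y hy
    simp only [clusterPath, Finset.mem_filter] at hy ⊢
    exact ⟨hy.1, hy.2.2⟩
  have hpath : ∀ y, Anc p x y → y < p (cl x) → y ∈ clusterPath q p cl x := by
    intro y hxy hy
    have hc := C.eq_of_lt_exit x hx y hxy hy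
    have h1 := T.parent_lt (cl x) (by have := C.leader_lt x hx; omega)
    simp only [clusterPath, Finset.mem_filter, Finset.mem_range]
    exact ⟨by omega, hxy, hc⟩
  obtain ⟨h1, h2⟩ := commonBit_sum (bitIndex_injOn (q := q) (cl := cl) (cl x)) hsub
    (Finset.filter_subset_filter (fun y => cl y = cl x) hU)
  refine ⟨fun h => ⟨C.anc_exit x hx, fun y hxy hy hyU => ?_⟩, fun h => ?_⟩
  · have h3 := hpath y hxy hy
    have h4 : cl y = cl x := C.eq_of_lt_exit x hx y hxy hy
    exact h1 h y h3 (by simp [hyU, h4])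
  · obtain ⟨y, hy, hyU, h3, h4⟩ := h2 h
    rw [Finset.mem_filter] at hyU
    have hy' : y < q - 1 ∧ Anc p x y ∧ cl y = cl x := by simpa [clusterPath] using hy
    refine ⟨y, hyU.1, hyU.2, h3, hy'.2.1, fun v hv hvy hvU => ?_⟩
    have hexit := C.lt_exit y hy'.1
    rw [hyU.2] at hexit
    have h5 := hpath v hv (by omega)
    have h6 := C.eq_of_lt_exit x hx v hv (by omega)
    have h7 := h4 v h5 (by simp [hvU, h6])
    have h8 := bitIndex_lt (cl := cl) hvy hy'.1 (by rw [h6, hyU.2])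
    omega

end Free

/-- What the marking uses but does not change. -/
structure Prepared (q m : ℕ) (p lo up : ℕ → ℕ) (w : ℕ → ℤ) (cl : ℕ → ℕ) (l : List ℕ) (K : ℕ)
    (M : Memory) : Prop where
  nodes : M 0 0 = q
  paths : M 0 1 = m
  weight : ∀ i < m, M 4 i = w i
  parent : ∀ x < q, M 15 x = p x
  lower : ∀ i < m, M 16 i = lo i
  upper : ∀ i < m, M 17 i = up i
  order : Holds (M 23) 0 l
  base : M 30 0 = K
  table : ∀ a < K, ∀ u < K, M 31 (a * K + u : ℕ) = commonBit a u
  cluster : ∀ x < q - 1, M 36 x = cl x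
  path : ∀ x < q - 1, M 37 x = nodeBits q cl (clusterPath q p cl x)
  member : ∀ x < q - 1, M 39 (cl x * K + 2 ^ bitIndex q cl x : ℕ) = x

/-- The state of the marking; `U` is the set of the unmarked nodes. -/
structure Marking (q m : ℕ) (p lo up : ℕ → ℕ) (w : ℕ → ℤ) (cl : ℕ → ℕ) (l : List ℕ) (K : ℕ)
    (E U : Finset ℕ) (rep top : ℕ → ℕ) (M : Memory) : Prop where
  prepared : Prepared q m p lo up w cl l K M
  sets : SetPartition q E rep top M
  subset : U ⊆ Finset.range (q - 1)
  bits : ∀ c : ℕ, M 38 c = nodeBits q cl (U.filter fun y => cl y = c)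
  marked : ∀ x < q - 1, M 45 x = if x ∈ U then 0 else 1
  root : M 45 (q - 1 : ℕ) = 0
  value : ∀ x < q - 1, x ∉ U → IsMaxWeight m p lo up w x (M 46 x)
  free : ∀ c ∈ E, Free p U (p c) (p (top (rep c)))

variable {q m n K : ℕ} {p lo up : ℕ → ℕ} {w : ℕ → ℤ} {cl : ℕ → ℕ} {l : List ℕ} {E U : Finset ℕ}
  {rep top : ℕ → ℕ} {M M' : Memory}

theorem Prepared.congr (h : Prepared q m p lo up w cl l K M)
    (h' : ∀ a ∈ [0, 4, 15, 16, 17, 23, 30, 31, 36, 37, 39], M' a = M a) :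
    Prepared q m p lo up w cl l K M' := by
  simp only [List.forall_mem_cons] at h'
  obtain ⟨e0, e4, e15, e16, e17, e23, e30, e31, e36, e37, e39, -⟩ := h'
  obtain ⟨h1, h2, h3, h4, h5, h6, h7, h8, h9, h10, h11, h12⟩ := h
  exact ⟨by rwa [e0], by rwa [e0], by rwa [e4], by rwa [e15], by rwa [e16], by rwa [e17],
    by rwa [e23], by rwa [e30], by rwa [e31], by rwa [e36], by rwa [e37], by rwa [e39]⟩

theorem Marking.congr (h : Marking q m p lo up w cl l K E U rep top M)
    (h' : ∀ a ∈ [0, 4, 15, 16, 17, 23, 30, 31, 36, 37, 39, 38, 41, 42, 43, 44, 45, 46],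
      M' a = M a) : Marking q m p lo up w cl l K E U rep top M' := by
  have hp := h.prepared.congr (M' := M') fun a ha => h' a (by
    simp only [List.mem_cons] at ha ⊢
    tauto)
  obtain ⟨-, h2, h3, h4, h5, h6, h7, h8⟩ := h
  have e38 := h' 38 (by simp)
  have e45 := h' 45 (by simp)
  have e46 := h' 46 (by simp)
  exact ⟨hp, h2.congr (h' _ (by simp)) (h' _ (by simp)) (h' _ (by simp)) (h' _ (by simp)), h3,
    by rwa [e38], by rwa [e45], by rwa [e45], by rwa [e46], h8⟩

theorem Marking.mark (h : Marking q m p lo up w cl l K E U rep top M) {y : ℕ} (hy : y ∈ U) {v : ℤ}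
    (hv : IsMaxWeight m p lo up w y v) : Marking q m p lo up w cl l K E (U.erase y) rep top
      (((M.set 38 (cl y) (M 38 (cl y) - 2 ^ bitIndex q cl y)).set 45 y 1).set 46 y v) := by
  have hyq : y < q - 1 := by simpa using h.subset hy
  refine ⟨h.prepared.congr (by simp), h.sets.congr (by simp) (by simp) (by simp) (by simp),
    (Finset.erase_subset _ _).trans h.subset, fun c => ?_, fun x hx => ?_, ?_, fun x hx hxU => ?_,
    fun c hc => (h.free c hc).mono (Finset.erase_subset _ _)⟩
  · have hfilter : (U.erase y).filter (fun x => cl x = c) =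
        (U.filter fun x => cl x = c).erase y := by
      ext x
      simp only [Finset.mem_filter, Finset.mem_erase]
      tauto
    by_cases hc : c = cl y
    · subst hc
      have := Finset.add_sum_erase (U.filter fun x => cl x = cl y) (fun x => 2 ^ bitIndex q cl x)
        (a := y) (by simp [hy])
      simp only [h.bits, nodeBits, hfilter, ← this]
      simp
    · rw [hfilter, Finset.erase_eq_of_notMem (by simp [Ne.symm hc]), ← h.bits]
      simp [hc]
  · by_cases hxy : x = y
    · simp [hxy]
    · simp [hxy, h.marked x hx]
  · have : q - 1 ≠ y := by omega
    rw [Memory.set_of_ne _ _ _ (by norm_num), Memory.set_same, if_neg (by exact_mod_cast this),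
      Memory.set_of_ne _ _ _ (by norm_num), h.root]
  · by_cases hxy : x = y
    · simpa [hxy] using hv
    · have : x ∉ U := fun h' => hxU (by simp [hxy, h'])
      simpa [hxy] using h.value x hx this

theorem Marking.lookup_eq (h : Marking q m p lo up w cl l K E U rep top M)
    (C : Clustering q p n cl) (hK : K = 2 ^ n) {x : ℕ} (hx : x < q - 1) :
    M 31 (M 37 x * K + M 38 (cl x)) = lookup q p cl U x ∧ 0 ≤ M 37 x ∧ M 37 x < K ∧
      0 ≤ M 38 (cl x) ∧ M 38 (cl x) < K := by
  have hc := (C.count_lt x hx).le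
  have h1 : nodeBits q cl (clusterPath q p cl x) < 2 ^ n := by
    refine nodeBits_lt hc fun y hy => ?_
    simp only [clusterPath, Finset.mem_filter] at hy ⊢
    exact ⟨hy.1, hy.2.2⟩
  have h2 : nodeBits q cl (U.filter fun y => cl y = cl x) < 2 ^ n :=
    nodeBits_lt hc (Finset.filter_subset_filter _ h.subset)
  rw [h.prepared.path x hx, h.bits]
  rw [← hK] at h1 h2
  refine ⟨?_, by positivity, by exact_mod_cast h1, by positivity, by exact_mod_cast h2⟩
  have := h.prepared.table _ h1 _ h2
  push_cast at this
  exact this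

/-- Process the path `var 58`, whose unmarked nodes from `var 60` on are to be marked. -/
def markPath : Cmd :=
  .while (lt (var 60) (var 59))
    (.seq (assign 61 (load 36 (var 60)))
    (.seq (assign 62 (load 31 (load 37 (var 60) * var 30 + load 38 (var 61))))
      (.ite (var 62)
        (.seq (assign 63 (load 39 (var 61 * var 30 + var 62)))
        (.ite (lt (var 63) (var 59))
          (.seq (.store 38 (var 61) (load 38 (var 61) - var 62))
          (.seq (.store 45 (var 63) (const 1))
          (.seq (.store 46 (var 63) (load 4 (var 58)))
            (assign 60 (load 15 (var 63))))))
          (assign 60 (var 63))))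
        (.seq (assign 64 (load 15 (load 42 (load 41 (var 61)))))
          (.ite (lt (var 64) (var 59))
            (.seq (assign 65 (load 31 (load 37 (var 64) * var 30 + load 38 (load 36 (var 64)))))
              (.ite (var 65) (assign 60 (var 64)) (unite (load 36 (var 64)))))
            (assign 60 (var 64)))))))

/-- Process the paths by descending weight. -/
def markPaths : Cmd :=
  forLoop 57 (load 0 (const 1))
    (.seq (assign 58 (load 23 (var 57)))
    (.seq (assign 59 (load 17 (var 58)))
    (.seq (assign 60 (load 16 (var 58)))
      markPath)))

open scoped Classical in
/-- The invariant of `markPath`. -/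
def MarkPathInv (q m : ℕ) (p lo up : ℕ → ℕ) (w : ℕ → ℤ) (cl : ℕ → ℕ) (l : List ℕ) (K : ℕ)
    (E U₀ : Finset ℕ) (t i T : ℕ) (M : Memory) (τ : ℕ) : Prop :=
  ∃ (U : Finset ℕ) (rep top : ℕ → ℕ) (x : ℕ), Marking q m p lo up w cl l K E U rep top M ∧ U ⊆ U₀ ∧ M 57 0 = t ∧
    M 58 0 = i ∧ M 59 0 = up i ∧ M 60 0 = x ∧ Free p U (lo i) x ∧
    τ + 200 * U.card + 400 * potential q E rep +
      (if x < up i then 100 + (if lookup q p cl U x = 0 then 100 else 0) else 0) ≤ T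

theorem markPath_spec {B : ℕ} (hB : 16 ≤ B) (hqB : q * q ≤ B) (T : OrderedTree q p)
    (C : Clustering q p n cl) (hK : K = 2 ^ n) (hKB : (q + 2) * K ≤ B) (hKB' : 2 * (K * K) ≤ B)
    (hE : ∀ c ∈ E, c < q - 1) (hclE : ∀ x < q - 1, cl x ∈ E)
    {U₀ : Finset ℕ} {t i T₀ τ : ℕ} (hi : i < m) (hlo : lo i < q) (hup : up i < q)
    (hmax : ∀ y ∈ U₀, OnPath p lo up i y → IsMaxWeight m p lo up w y (w i))
    (hinv : MarkPathInv q m p lo up w cl l K E U₀ t i T₀ M τ) :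
    markPath.VC B (fun M' τ' => τ' ≤ T₀ + 8 ∧ ∃ U rep top,
      Marking q m p lo up w cl l K E U rep top M' ∧ U ⊆ U₀ ∧ M' 57 0 = t ∧
      (∀ y, OnPath p lo up i y → y ∉ U) ∧
      τ' + 200 * U.card + 400 * potential q E rep ≤ T₀ + 8) M τ := by
  refine vc_while hB (MarkPathInv q m p lo up w cl l K E U₀ t i T₀) T₀ hinv ?_
  clear hinv
  rintro M τ ⟨U, rep, top, x, hM, hU, h57, h58, h59, h60, hfree, hτ⟩
  have hxq : x < q := (T.anc_le hlo hfree.1).2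
  have hcost : (lt (var 60) (var 59)).cost = 7 := rfl
  have hE' : ∀ c ∈ E, c < q := fun c hc => (hE c hc).trans_le (Nat.sub_le _ _)
  have hEq : E.card < q := by
    have := Finset.card_le_card (show E ⊆ Finset.range (q - 1) from
      fun c hc => Finset.mem_range.2 (hE c hc))
    rw [Finset.card_range] at this
    omega
  rw [hcost]
  refine ⟨by omega, by simp, fun h => ?_, fun h => ?_⟩
  swap
  · have hxu : up i ≤ x := by
      simpa [h59, h60] using h
    rw [if_neg (by omega)] at hτ
    exact ⟨by omega, U, rep, top, hM, hU, h57,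
      fun y hy => hfree.2 y hy.1 (lt_of_lt_of_le hy.2 hxu), by omega⟩
  have hxu : x < up i := by
    simpa [h59, h60] using h
  have hx : x < q - 1 := by omega
  rw [if_pos hxu] at hτ
  have hP := hM.prepared
  have h36 := hP.cluster x hx
  have h30 := hP.base
  obtain ⟨hl, ha0, haK, hu0, huK⟩ := hM.lookup_eq C hK hx
  obtain ⟨hmiss, hhit⟩ := lookup_spec T C hM.subset hx
  have hKB2 : 2 * ((K : ℤ) * K) ≤ B := by exact_mod_cast hKB'
  have hmul : ∀ a : ℤ, 0 ≤ a → a < K → 0 ≤ a * K ∧ a * K + K ≤ K * K := by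
    intro a h1 h2
    constructor
    · positivity
    · nlinarith
  have hmx := hmul _ ha0 haK
  have hKpos : (0 : ℤ) < K := by
    rw [hK]
    positivity
  have hKB3 : (q : ℤ) * K + 2 * K ≤ B := by
    have : (((q + 2) * K : ℕ) : ℤ) ≤ B := by exact_mod_cast hKB
    push_cast at this
    linarith
  by_cases h0 : lookup q p cl U x = 0
  · rw [if_pos h0] at hτ
    have hfree' := hfree.trans T hlo (hmiss h0)
    have hcE := hclE x hx
    have hrE := hM.sets.rep_mem _ hcE
    have hrr := hM.sets.rep_rep _ hcE
    have htE := hM.sets.top_mem _ hrE hrr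
    have h41 := hM.sets.load_rep _ hcE
    have h42 := hM.sets.load_top _ hrE hrr
    have htq := hE _ htE
    have h15 := hP.parent (top (rep (cl x))) (by omega)
    have hfz := hfree'.trans T hlo (hM.free _ hcE)
    have hfrc := hM.free _ hcE
    obtain ⟨z, hz⟩ : ∃ z, z = p (top (rep (cl x))) := ⟨_, rfl⟩
    rw [← hz] at h15 hfz hfrc
    simp only [vc_seq_iff, vc_assign]
    simp only [cost_load, cost_var, cost_add, cost_mul]
    simp [h60, h36, h30, hl, h0, h41, h42, h15, h59]
    refine ⟨by omega, fun hzu => ?_, fun hzu => ?_⟩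
    · have hz' : z < q - 1 := by omega
      have h36z := hP.cluster z hz'
      obtain ⟨hl', ha0', haK', hu0', huK'⟩ := hM.lookup_eq C hK hz'
      have hmz := hmul _ ha0' haK'
      simp [h36z, hl']
      refine ⟨by omega, fun h0' => ?_, fun h0' => ?_⟩
      · refine ⟨U, rep, top, z, hM.congr (by simp), hU, by simp [h57], by simp [h58], by simp [h59],
          by simp, hfz, ?_⟩
        rw [if_pos hzu, if_neg h0']
        omega
      · have hdE := hclE z hz'
        have hexit := C.lt_exit z hz'
        have hcd : rep (cl x) ≠ rep (cl z) := by
          intro heq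
          have h1 := hM.free _ hdE
          rw [← heq, ← hz] at h1
          have h2 := (T.anc_le (T.parent_lt (cl z) (hE' _ hdE)) h1.1).1
          omega
        refine vc_mono (vc_frame (unite_spec hB hqB hE' hEq hEq.le
          (hM.sets.congr (by simp) (by simp) (by simp) (by simp)) hcE hdE hcd (by simp [hP.nodes])
          (by simp) (by simp) (by simp [h36z]) (by simp))) ?_
        rintro M₁ τ₁ ⟨⟨rep', top', hS, hτ₁, htop⟩, hfr⟩
        refine ⟨U, rep', top', x, ⟨hP.congr ?_, hS, hM.subset, ?_, ?_, ?_, ?_, ?_⟩, hU, ?_, ?_, ?_, ?_,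
          hfree, ?_⟩
        · intro a ha
          rw [hfr a ((by decide : ∀ a ∈ [0, 4, 15, 16, 17, 23, 30, 31, 36, 37, 39],
            a ∉ (unite (load 36 (var 64))).writes) a ha)]
          revert a
          simp
        · intro c
          rw [hfr _ (show _ ∉ _ by decide)]
          simp [hM.bits]
        · intro y hy
          rw [hfr _ (show _ ∉ _ by decide)]
          simp [hM.marked y hy]
        · rw [hfr _ (show _ ∉ _ by decide)]
          simp [hM.root]
        · intro y hy hyU
          rw [hfr _ (show _ ∉ _ by decide)]
          simpa using hM.value y hy hyU
        · intro e he
          have h1 := hM.free e he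
          rw [htop e he]
          split_ifs with h2
          · rw [h2, ← hz] at h1
            have h3 : Free p U z (p (cl z)) := (lookup_spec T C hM.subset hz').1 h0'
            have hpe := T.parent_lt e (hE' e he)
            exact (h1.trans T hpe h3).trans T hpe (hM.free _ hdE)
          · exact h1
        · rw [hfr _ (show _ ∉ _ by decide)]
          simp [h57]
        · rw [hfr _ (show _ ∉ _ by decide)]
          simp [h58]
        · rw [hfr _ (show _ ∉ _ by decide)]
          simp [h59]
        · rw [hfr _ (show _ ∉ _ by decide)]
          simp [h60]
        · rw [if_pos hxu, if_pos h0]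
          omega
    · refine ⟨U, rep, top, z, hM.congr (by simp), hU, by simp [h57], by simp [h58], by simp [h59],
        by simp, hfz, ?_⟩
      rw [if_neg (by omega)]
      omega
  · obtain ⟨y, hyU, hcy, hly, hfy⟩ := hhit h0
    have hyq : y < q - 1 := by simpa using hM.subset hyU
    have h39 := hP.member y hyq
    rw [← hly, hcy] at h39
    push_cast at h39
    have hbit : lookup q p cl U x < K := by
      rw [hly, hK]
      refine Nat.pow_lt_pow_right (by norm_num) ?_
      exact (bitIndex_lt_count hyq).trans (C.count_lt y hyq)
    have hclx := C.leader_lt x hx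
    have h1 : (cl x : ℤ) * K + K ≤ q * K := by
      have := Nat.mul_le_mul_right K (show cl x + 1 ≤ q by omega)
      rw [Nat.succ_mul] at this
      exact_mod_cast this
    have h2 : (0 : ℤ) ≤ cl x * K := by positivity
    have h15 := hP.parent y (by omega)
    have hfree' := hfree.trans T hlo hfy
    rw [if_neg h0] at hτ
    simp only [vc_seq_iff, vc_assign, vc_ite, vc_store]
    simp only [cost_load, cost_var, cost_add, cost_mul]
    simp [h60, h36, h30, hl, h0, h39, h59, h58, hP.weight i hi, h15]
    refine ⟨by omega, by omega, fun hyu => ⟨by omega, ?_⟩, fun hyu => ?_⟩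
    · have hon : OnPath p lo up i y := ⟨hfree'.1, hyu⟩
      have hm' := (hM.congr (M' := ((M.set 61 0 (cl x)).set 62 0 (lookup q p cl U x)).set 63 0 y)
        (by simp)).mark hyU (hmax y (hU hyU) hon)
      have hly' : (2 : ℤ) ^ bitIndex q cl y = lookup q p cl U x := by
        rw [hly]
        push_cast
        rfl
      rw [hcy, hly'] at hm'
      have hnot : y ∉ U.erase y := by simp
      refine ⟨U.erase y, rep, top, p y, hm'.congr ?_, (Finset.erase_subset _ _).trans hU, by simp [h57],
        by simp [h58], by simp [h59], by simp, ?_, ?_⟩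
      · simp
      · exact (hfree'.mono (Finset.erase_subset _ _)).trans T hlo (Free.parent T (by omega) hnot)
      · have hcard := Finset.card_erase_add_one hyU
        split_ifs <;> omega
    · refine ⟨U, rep, top, y, hM.congr (by simp), hU, by simp [h57], by simp [h58], by simp [h59],
        by simp, hfree', ?_⟩
      rw [if_neg (by omega)]
      omega

theorem markPaths_spec {B : ℕ} (hB : 16 ≤ B) (hqB : q * q ≤ B) (hm : m ≤ B) (T : OrderedTree q p)
    (C : Clustering q p n cl) (hK : K = 2 ^ n) (hKB : (q + 2) * K ≤ B) (hKB' : 2 * (K * K) ≤ B)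
    (hE : ∀ c ∈ E, c < q - 1) (hclE : ∀ x < q - 1, cl x ∈ E) (hlo : ∀ i < m, lo i < q)
    (hup : ∀ i < m, up i < q) (hperm : l.Perm (List.range m))
    (hsorted : l.Pairwise fun i j => w j ≤ w i) {τ : ℕ} (hP : Prepared q m p lo up w cl l K M)
    (hS : SetPartition q E id id M)
    (h38 : ∀ c : ℕ, M 38 c = nodeBits q cl ((Finset.range (q - 1)).filter fun y => cl y = c))
    (h45 : M 45 = 0) :
    markPaths.VC B (fun M' τ' => τ' ≤ τ + (300 * m + 200 * q + 400 * potential q E id + 20) ∧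
      ∀ x < q, (M' 45 x = 0 ∧ ∀ i < m, ¬ OnPath p lo up i x) ∨
        (M' 45 x ≠ 0 ∧ IsMaxWeight m p lo up w x (M' 46 x))) M τ := by
  have hq := T.pos
  have hlen : l.length = m := by rw [hperm.length_eq, List.length_range]
  refine vc_for hB (n := m) hm
    (fun t M' τ' => ∃ (U : Finset ℕ) (rep top : ℕ → ℕ), Marking q m p lo up w cl l K E U rep top M' ∧
      (∀ j ∈ l.take t, ∀ y, OnPath p lo up j y → y ∉ U) ∧
      τ' + 200 * U.card + 400 * potential q E rep ≤
        τ + 3 + 300 * t + (200 * q + 400 * potential q E id))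
    (τ + 3 + 300 * m + (200 * q + 400 * potential q E id)) ?_ ?_ ?_ ?_ ?_
  · rintro t M' τ' ht ⟨U, rep, top, -, -, h⟩
    omega
  · rintro t M' τ' ht ⟨U, rep, top, h, -, -⟩
    simp [h.prepared.paths]
  · refine ⟨Finset.range (q - 1), id, id, ⟨hP.congr (by simp), hS.congr (by simp) (by simp) (by simp)
      (by simp), subset_rfl, by simpa using h38, fun x hx => ?_, by simp [h45], fun x hx hx' => ?_,
      fun c hc => ?_⟩, by simp, ?_⟩
    · simp [h45, hx]
    · simp [hx] at hx'
    · exact Free.refl T (T.parent_lt c (by have := hE c hc; omega))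
    · rw [Finset.card_range]
      omega
  · rintro t M' τ' ht ⟨U, rep, top, hM, hdone, hτ⟩ hv
    have htl : t < l.length := by omega
    have h23 := hM.prepared.order.get htl
    rw [zero_add] at h23
    obtain ⟨i, hi⟩ : ∃ i, i = l[t] := ⟨_, rfl⟩
    rw [← hi] at h23
    have him : i < m := by
      rw [← List.mem_range, ← hperm.mem_iff, hi]
      exact List.getElem_mem htl
    simp only [vc_seq_iff, vc_assign]
    simp [hv, h23, hM.prepared.upper i him, hM.prepared.lower i him]
    refine vc_mono (markPath_spec hB hqB T C hK hKB hKB' hE hclE (U₀ := U) (t := t) (i := i)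
      (T₀ := τ + 3 + 300 * t + (200 * q + 400 * potential q E id) + 240) him (hlo i him) (hup i him)
      ?_ ⟨U, rep, top, lo i, hM.congr (by simp), subset_rfl, by simp [hv], by simp, by simp,
        by simp, Free.refl T (hlo i him), ?_⟩) ?_
    · intro y hyU hy
      refine ⟨⟨i, him, hy, rfl⟩, fun j hj hjy => ?_⟩
      have hjl : j ∈ l := by rwa [hperm.mem_iff, List.mem_range]
      obtain ⟨k, hk, rfl⟩ := List.getElem_of_mem hjl
      rw [hi]
      obtain h | rfl | h := lt_trichotomy k t
      · exact absurd hyU (hdone _ (by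
          rw [List.mem_take_iff_getElem]
          exact ⟨k, by omega, rfl⟩) y hjy)
      · exact le_rfl
      · exact List.pairwise_iff_getElem.1 hsorted t k htl hk h
    · split_ifs <;> omega
    · rintro M₁ τ₁ ⟨-, U', rep', top', hM', hU', h57, hfree, hτ₁⟩
      refine ⟨h57, U', rep', ⟨top', hM'.congr (by simp)⟩, fun j hj y hy => ?_, by omega⟩
      rw [List.take_add_one, List.getElem?_eq_getElem htl, List.mem_append] at hj
      obtain hj | hj := hj
      · exact fun h => hdone j hj y hy (hU' h)
      · simp only [Option.toList_some, List.mem_singleton] at hj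
        rw [← hi] at hj
        subst hj
        exact hfree y hy
  · rintro M' τ' ⟨U, rep, top, hM, hdone, hτ⟩ -
    simp only [cost_load, cost_const]
    refine ⟨by omega, fun x hx => ?_⟩
    have hnone : ∀ i < m, OnPath p lo up i x → x ∉ U := by
      intro i him hix
      refine hdone i ?_ x hix
      rw [← hlen, List.take_length, hperm.mem_iff, List.mem_range]
      exact him
    by_cases hxq : x = q - 1
    · refine Or.inl ⟨by rw [hxq, hM.root], fun i him hix => ?_⟩
      have := hup i him
      have := hix.2
      omega
    · have hxq' : x < q - 1 := by omega
      by_cases hxU : x ∈ U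
      · exact Or.inl ⟨by rw [hM.marked x hxq', if_pos hxU], fun i him hix => hnone i him hix hxU⟩
      · exact Or.inr ⟨by rw [hM.marked x hxq', if_neg hxU]; norm_num, hM.value x hxq' hxU⟩

end WordRAM

/-!
# The algorithm
-/

namespace WordRAM

open WordRAM.Expr WordRAM.Cmd

theorem potential_id_le (n : ℕ) (E : Finset ℕ) : potential n E id ≤ E.card * Nat.log 2 n := by
  rw [potential, ← smul_eq_mul]
  exact Finset.sum_le_card_nsmul _ _ _ fun c _ => Nat.sub_le _ _

/-- Copy the results to the original numbers of the nodes. -/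
def copyResults : Cmd :=
  forLoop 12 (var 0)
    (.seq (.store 5 (var 12) (load 45 (load 10 (var 12))))
    (.seq (.store 6 (var 12) (load 46 (load 10 (var 12))))
      (.store 7 (var 12) (load 18 (load 10 (var 12))))))

theorem copyResults_spec {B : ℕ} (hB : 16 ≤ B) {q : ℕ} (hq : q < B) {pos : ℕ → ℕ} {M : Memory}
    {τ : ℕ} (h00 : M 0 0 = q) (h10 : ∀ x < q, M 10 x = pos x) :
    copyResults.VC B (fun M' τ' => τ' ≤ τ + (40 * q + 20) ∧ ∀ x < q, M' 5 x = M 45 (pos x) ∧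
      M' 6 x = M 46 (pos x) ∧ M' 7 x = M 18 (pos x)) M τ := by
  refine vc_for hB (n := q) hq.le
    (fun i M' τ' => τ' ≤ τ + (40 * i + 3) ∧ M' 0 = M 0 ∧ M' 10 = M 10 ∧ M' 45 = M 45 ∧
      M' 46 = M 46 ∧ M' 18 = M 18 ∧ ∀ x < i, M' 5 x = M 45 (pos x) ∧
      M' 6 x = M 46 (pos x) ∧ M' 7 x = M 18 (pos x)) (τ + (40 * q + 3)) ?_ ?_ ?_ ?_ ?_
  · intro i M' τ' hi h
    have := h.1
    omega
  · intro i M' τ' hi h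
    simp [h.2.1, h00]
  · simp
  · rintro i M' τ' hi ⟨hτ, e0, e10, e45, e46, e18, ex⟩ hv
    simp [e0, e10, e45, e46, e18, hv, h10 i hi]
    refine ⟨by omega, fun x hx => ?_⟩
    obtain hx | rfl := Nat.lt_or_eq_of_le hx
    · simp [hx.ne, ex x hx]
    · simp
  · rintro M' τ' ⟨hτ, e0, e10, e45, e46, e18, ex⟩ hv
    simp only [cost_var]
    exact ⟨by omega, ex⟩

theorem Numbering.anc_iff {q : ℕ} {par : ℕ → ℕ} {r : ℕ} {D ord pos : ℕ → ℕ}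
    (T : ParentTree q par r D) (N : Numbering q par r ord pos) {x y : ℕ} (hx : x < q) (hy : y < q) :
    Anc (fun i => pos (par (ord i))) (pos x) (pos y) ↔ Anc par x y := by
  have h : ∀ k, par^[k] x < q ∧ (fun i => pos (par (ord i)))^[k] (pos x) = pos (par^[k] x) := by
    intro k
    induction k with
    | zero => exact ⟨hx, rfl⟩
    | succ k ih =>
      rw [Function.iterate_succ_apply', Function.iterate_succ_apply', ih.2, N.ord_pos _ ih.1]
      exact ⟨T.par_lt _ ih.1, rfl⟩
  refine exists_congr fun k => ?_
  rw [(h k).2]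
  refine ⟨fun h' => ?_, fun h' => by rw [h']⟩
  rw [← N.ord_pos _ (h k).1, h', N.ord_pos _ hy]

/-- The node `v` lies on the path from `lower i` up to `upper i`, excluding `upper i`. -/
def Covers (par lower upper : ℕ → ℕ) (i v : ℕ) : Prop :=
  Anc par (lower i) v ∧ ¬ Anc par (upper i) v

theorem Numbering.onPath_iff {q : ℕ} {par : ℕ → ℕ} {r : ℕ} {D ord pos lower upper : ℕ → ℕ}
    (T : ParentTree q par r D) (N : Numbering q par r ord pos) {i v : ℕ} (hl : lower i < q)
    (hu : upper i < q) (hlu : Anc par (lower i) (upper i)) (hv : v < q) :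
    OnPath (fun i => pos (par (ord i))) (fun i => pos (lower i)) (fun i => pos (upper i)) i (pos v) ↔
      Covers par lower upper i v := by
  rw [OnPath, Covers, N.anc_iff T hl hv, ← N.anc_iff T hu hv]
  refine and_congr_right fun h => ?_
  have hO := N.orderedTree T
  refine ⟨fun h1 h2 => ?_, fun h1 => ?_⟩
  · have := (hO.anc_le (N.pos_lt _ hu) h2).1
    omega
  · by_contra hcon
    rw [← N.anc_iff T hl hu] at hlu
    rw [← N.anc_iff T hl hv] at h
    exact h1 (hO.anc_of_le (N.pos_lt _ hl) hlu h (by omega))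

/-- The algorithm for the Tree-Path-Problem. -/
def treePath : Cmd :=
  .seq orderNodes
  (.seq renumber
  (.seq sumWeights
  (.seq sortPaths
  (.seq (assign 48 (var 0 + load 0 (const 1) + const 1))
  (.seq chooseBits
  (.seq makeTable
  (.seq groupNodes
  (.seq clusterNodes
  (.seq initSets
  (.seq markPaths copyResults))))))))))

open scoped Classical in
theorem treePath_spec {B : ℕ} {q m N : ℕ} (hN : N = q + m + 1) (hNB : 256 * N ≤ B)
    (hNB' : 32 * (N * N) ≤ B) {W : ℕ} (hW : 2 * m * W * (q + 1) ≤ B) (e : ℕ) (hWe : 2 * W < N ^ e)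
    (hNe : N ^ e ≤ B) {par : ℕ → ℕ} {r : ℕ} {D : ℕ → ℕ} (T : ParentTree q par r D)
    {lower upper : ℕ → ℕ} {w : ℕ → ℤ} (hlower : ∀ i < m, lower i < q) (hupper : ∀ i < m, upper i < q)
    (hlu : ∀ i < m, Anc par (lower i) (upper i)) (hw : ∀ i < m, |w i| ≤ W) {M : Memory} {τ : ℕ}
    (h00 : M 0 0 = q) (h01 : M 0 1 = m) (h1 : ∀ x < q, M 1 x = par x)
    (h2 : ∀ i < m, M 2 i = lower i) (h3 : ∀ i < m, M 3 i = upper i) (h4 : ∀ i < m, M 4 i = w i)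
    (h5 : ∀ a, 5 ≤ a → M a = 0) :
    treePath.VC B (fun M' τ' => τ' ≤ τ + (300 * (e + 1) + 60000) * N ∧ ∀ v < q,
      ((M' 5 v = 0 ∧ ∀ i < m, ¬ Covers par lower upper i v) ∨
        (M' 5 v ≠ 0 ∧ (∃ i < m, Covers par lower upper i v ∧ M' 6 v = w i) ∧
          ∀ i < m, Covers par lower upper i v → w i ≤ M' 6 v)) ∧
      M' 7 v = ∑ i ∈ Finset.range m, if Covers par lower upper i v then w i else 0) M τ := by
  have hroot := T.root_lt
  have hB : 16 ≤ B := by omega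
  have hq : q < B := by omega
  have hm : m < B := by omega
  have hqN : q * q ≤ N * N := Nat.mul_le_mul (by omega) (by omega)
  refine vc_seq (orderNodes_spec hB hq T h00 h1 (h5 _ (by norm_num)) (h5 _ (by norm_num))) ?_
  rintro M1 τ1 ⟨t1, ord, pos, Nb, o9, o10⟩ f1
  have O := Nb.orderedTree T
  have hlo : ∀ i < m, pos (lower i) < q := fun i hi => Nb.pos_lt _ (hlower i hi)
  have hup : ∀ i < m, pos (upper i) < q := fun i hi => Nb.pos_lt _ (hupper i hi)
  have hcov := fun i v => @Numbering.onPath_iff q par r D ord pos lower upper T Nb i v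
  have hanc := fun x y => @Numbering.anc_iff q par r D ord pos T Nb x y
  refine vc_seq (renumber_spec hB hq hm (by rw [f1 0 (by decide), h00])
    (by rw [f1 0 (by decide), h01]) (by rwa [f1 1 (by decide)]) T.par_lt (by rwa [f1 2 (by decide)])
    hlower (by rwa [f1 3 (by decide)]) hupper o9 Nb.ord_lt o10) ?_
  rintro M2 τ2 ⟨t2, o15, o16, o17⟩ f2
  obtain ⟨p, hp⟩ : ∃ p : ℕ → ℕ, p = fun i => pos (par (ord i)) := ⟨_, rfl⟩
  replace o15 : ∀ i < q, M2 15 i = p i := by rwa [hp]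
  rw [← hp] at O
  simp only [← hp] at hcov hanc
  clear hp
  have z2 : ∀ a ∈ [18, 19, 25, 31, 32, 35, 38, 45], M2 a = 0 := by
    intro a ha
    rw [f2 a ((by decide : ∀ a ∈ [18, 19, 25, 31, 32, 35, 38, 45], a ∉ renumber.writes) a ha),
      f1 a ((by decide : ∀ a ∈ [18, 19, 25, 31, 32, 35, 38, 45], a ∉ orderNodes.writes) a ha)]
    exact h5 a ((by decide : ∀ a ∈ [18, 19, 25, 31, 32, 35, 38, 45], 5 ≤ a) a ha)
  have b0 : M2 0 = M 0 := by rw [f2 0 (by decide), f1 0 (by decide)]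
  have b4 : M2 4 = M 4 := by rw [f2 4 (by decide), f1 4 (by decide)]
  have b10 : M2 10 = M1 10 := by rw [f2 10 (by decide)]
  rw [← b0] at h00 h01
  rw [← b4] at h4
  rw [← b10] at o10
  clear f1 f2 h1 h2 h3 h5 o9 b0 b4 b10
  refine vc_seq (sumWeights_spec hB hq hm hW O hlo hup hw h00 h01 h4 o15 o16 o17
    (z2 18 (by simp))) ?_
  rintro M3 τ3 ⟨t3, o18⟩ f3
  have hNm : N * m + m ≤ N * N := by
    have := Nat.mul_le_mul_left N (show m + 1 ≤ N by omega)
    rw [Nat.mul_succ] at this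
    omega
  refine vc_seq (sortPaths_spec hB O.pos hN (by omega) (by omega) e hWe hNe hw
    (by rw [f3 0 (by decide), h00]) (by rw [f3 0 (by decide), h01]) (by rwa [f3 4 (by decide)])
    (by rw [f3 19 (by decide), z2 19 (by simp)]) (by rw [f3 25 (by decide), z2 25 (by simp)])) ?_
  rintro M4 τ4 ⟨t4, l, hperm, o23, hsorted⟩ f4
  have e0 : M4 0 = M2 0 := by rw [f4 0 (by decide), f3 0 (by decide)]
  refine vc_seq (P := fun M' τ' => τ' ≤ τ4 + 20 ∧ M' 48 0 = N) ?_ ?_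
  · rw [vc_assign]
    simp [e0, h00, h01, hN]
    omega
  rintro M5 τ5 ⟨t5, o48⟩ f5
  clear e0
  refine vc_seq (chooseBits_spec hB (by omega) hNB o48) ?_
  rintro M6 τ6 ⟨t6, b, hb, o29, o30, hNb, hbN⟩ f6
  obtain ⟨K, hK⟩ : ∃ K, K = 4 ^ b := ⟨_, rfl⟩
  have hKK : K * K = 16 ^ b := by
    rw [hK, ← Nat.mul_pow]
  have hKpos : 0 < K := by
    rw [hK]
    positivity
  have hbK : b < K := by
    rw [hK]
    exact Nat.lt_pow_self (by norm_num)
  have hKle : K ≤ K * K := Nat.le_mul_of_pos_left K hKpos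
  rw [← hK] at o30
  refine vc_seq (makeTable_spec hB hKpos (by omega) o30 (by
    rw [f6 31 (by decide), f5 31 (by decide), f4 31 (by decide), f3 31 (by decide),
      z2 31 (by simp)])) ?_
  rintro M7 τ7 ⟨t7, o31⟩ f7
  have e0 : M7 0 0 = q := (by rw [f7 0 (by decide), f6 0 (by decide), f5 0 (by decide), f4 0 (by decide), f3 0 (by decide), h00])
  have e15 : ∀ x < q, M7 15 x = p x := by
    rwa [f7 15 (by decide), f6 15 (by decide), f5 15 (by decide), f4 15 (by decide), f3 15 (by decide)]
  have e29 : M7 29 0 = b := (by rw [f7 29 (by decide), o29])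
  have e32 : M7 32 = 0 := (by rw [f7 32 (by decide), f6 32 (by decide), f5 32 (by decide), f4 32 (by decide), f3 32 (by decide), z2 32 (by simp)])
  have e35 : M7 35 = 0 := (by rw [f7 35 (by decide), f6 35 (by decide), f5 35 (by decide), f4 35 (by decide), f3 35 (by decide), z2 35 (by simp)])
  refine vc_seq (groupNodes_spec hB hq O hb (by omega) e0 e15 e29 e32 e35) ?_
  rintro M8 τ8 ⟨t8, g, E, μ, s, G, hE, o34, o35, hcard⟩ f8
  clear e29 e32 e35
  have hKq : (q + 2) * K ≤ B := by
    have h6 : (q + 2) * K ≤ (2 * N) * (16 * N) := Nat.mul_le_mul (by omega) (by omega)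
    have h7 : (2 * N) * (16 * N) = 32 * (N * N) := by ring
    omega
  refine vc_seq (clusterNodes_spec hB hq O G hE hK hKq (by rw [f8 0 (by decide), e0])
    (by rwa [f8 15 (by decide)]) (by rw [f8 30 (by decide), f7 30 (by decide), o30]) o34 o35 (by rw [f8 38 (by decide), f7 38 (by decide), f6 38 (by decide), f5 38 (by decide), f4 38 (by decide), f3 38 (by decide), z2 38 (by simp)])) ?_
  rintro M9 τ9 ⟨t9, o36, o38⟩ f9
  have C := clustering_clusterOf O G hE
  have hclE := clusterOf_mem O hE
  generalize clusterOf q p g E = cl at *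
  have hEq : ∀ c ∈ E, c < q := fun c hc => (G.mem_lt c hc).trans_le (Nat.sub_le _ _)
  refine vc_seq (initSets_spec hB (by omega) hq.le hEq
    (by rw [f9 0 (by decide), f8 0 (by decide), e0])) ?_
  rintro M10 τ10 ⟨t10, S⟩ f10
  clear e0 e15
  have hprep : Prepared q m p (fun i => pos (lower i)) (fun i => pos (upper i)) w cl l K M10 := by
    have e0 : M10 0 = M2 0 := by rw [f10 0 (by decide), f9 0 (by decide), f8 0 (by decide), f7 0 (by decide), f6 0 (by decide), f5 0 (by decide), f4 0 (by decide), f3 0 (by decide)]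
    have e4 : M10 4 = M2 4 := by rw [f10 4 (by decide), f9 4 (by decide), f8 4 (by decide), f7 4 (by decide), f6 4 (by decide), f5 4 (by decide), f4 4 (by decide), f3 4 (by decide)]
    have e15 : M10 15 = M2 15 := by rw [f10 15 (by decide), f9 15 (by decide), f8 15 (by decide), f7 15 (by decide), f6 15 (by decide), f5 15 (by decide), f4 15 (by decide), f3 15 (by decide)]
    have e16 : M10 16 = M2 16 := by rw [f10 16 (by decide), f9 16 (by decide), f8 16 (by decide), f7 16 (by decide), f6 16 (by decide), f5 16 (by decide), f4 16 (by decide), f3 16 (by decide)]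
    have e17 : M10 17 = M2 17 := by rw [f10 17 (by decide), f9 17 (by decide), f8 17 (by decide), f7 17 (by decide), f6 17 (by decide), f5 17 (by decide), f4 17 (by decide), f3 17 (by decide)]
    have e23 : M10 23 = M4 23 := by rw [f10 23 (by decide), f9 23 (by decide), f8 23 (by decide), f7 23 (by decide), f6 23 (by decide), f5 23 (by decide)]
    have e30 : M10 30 = M6 30 := by rw [f10 30 (by decide), f9 30 (by decide), f8 30 (by decide), f7 30 (by decide)]
    have e31 : M10 31 = M7 31 := by rw [f10 31 (by decide), f9 31 (by decide), f8 31 (by decide)]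
    have e36 : M10 36 = M9 36 := by rw [f10 36 (by decide)]
    have e37 : M10 37 = M9 37 := by rw [f10 37 (by decide)]
    have e39 : M10 39 = M9 39 := by rw [f10 39 (by decide)]
    refine ⟨by rwa [e0], by rwa [e0], by rwa [e4], by rwa [e15], by rwa [e16], by rwa [e17],
      by rwa [e23], by rwa [e30], by rwa [e31], ?_, ?_, ?_⟩
    · rw [e36]
      exact fun x hx => (o36 x hx).1
    · rw [e37]
      exact fun x hx => (o36 x hx).2.1
    · rw [e39]
      exact fun x hx => (o36 x hx).2.2
  refine vc_seq (markPaths_spec hB (by omega) hm.le O C (show K = 2 ^ (2 * b) by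
      rw [hK, pow_mul]; norm_num) hKq (by omega) G.mem_lt hclE hlo hup hperm hsorted hprep S
    (by rwa [f10 38 (by decide)]) (by rw [f10 45 (by decide), f9 45 (by decide), f8 45 (by decide), f7 45 (by decide), f6 45 (by decide), f5 45 (by decide), f4 45 (by decide), f3 45 (by decide), z2 45 (by simp)])) ?_
  rintro M11 τ11 ⟨t11, omax⟩ f11
  refine vc_mono (copyResults_spec hB hq (by rw [f11 0 (by decide), f10 0 (by decide), f9 0 (by decide), f8 0 (by decide), f7 0 (by decide), f6 0 (by decide), f5 0 (by decide), f4 0 (by decide), f3 0 (by decide), h00]) (by rwa [f11 10 (by decide), f10 10 (by decide), f9 10 (by decide), f8 10 (by decide), f7 10 (by decide), f6 10 (by decide), f5 10 (by decide), f4 10 (by decide), f3 10 (by decide)])) ?_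
  rintro M12 τ12 ⟨t12, ores⟩
  refine ⟨?_, fun v hv => ?_⟩
  · have hlog : Nat.log 2 q ≤ 8 * b := by
      have h6 : Nat.log 2 q < 4 * (b + 1) := by
        refine Nat.log_lt_of_lt_pow hroot.ne_bot ?_
        rw [pow_mul]
        norm_num
        omega
      omega
    have hpot : potential q E id ≤ 8 * (q + b) := by
      refine (potential_id_le q E).trans ((Nat.mul_le_mul_left _ hlog).trans ?_)
      have : E.card * (8 * b) = 8 * (E.card * b) := by ring
      omega
    have h6 : (300 * (e + 1) + 60000) * N = 300 * (e + 1) * N + 60000 * N := by ring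
    omega
  · obtain ⟨r5, r6, r7⟩ := ores v hv
    rw [r5, r6, r7]
    refine ⟨?_, ?_⟩
    · obtain ⟨h6, h7⟩ | ⟨h6, ⟨i, hi, h7, h8⟩, h9⟩ := omax (pos v) (Nb.pos_lt v hv)
      · exact Or.inl ⟨h6, fun i hi h8 => h7 i hi
          ((hcov i v (hlower i hi) (hupper i hi) (hlu i hi) hv).2 h8)⟩
      · exact Or.inr ⟨h6, ⟨i, hi, (hcov i v (hlower i hi) (hupper i hi) (hlu i hi) hv).1 h7, h8⟩,
          fun j hj h10 => h9 j hj
            ((hcov j v (hlower j hj) (hupper j hj) (hlu j hj) hv).2 h10)⟩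
    · rw [f11 18 (by decide), f10 18 (by decide), f9 18 (by decide), f8 18 (by decide), f7 18 (by decide), f6 18 (by decide), f5 18 (by decide), f4 18 (by decide), o18 _ (Nb.pos_lt v hv)]
      refine Finset.sum_congr rfl fun i hi => ?_
      rw [Finset.mem_range] at hi
      rw [hanc _ _ (hlower i hi) hv, hanc _ _ (hupper i hi) hv]
      have h6 : Anc par (upper i) v → Anc par (lower i) v := (hlu i hi).trans
      by_cases h7 : Anc par (upper i) v
      · simp [Covers, h7, h6 h7]
      · simp [Covers, h7]

end WordRAM

namespace TreePathInstance

open WordRAM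

variable (I : TreePathInstance)

/-- The number of the parent of the node with number `x`. -/
noncomputable def parentNum (x : ℕ) : ℕ :=
  if h : x < I.q then I.num (Order.pred (I.num.symm ⟨x, h⟩)) else 0

theorem parentNum_num (a : I.T) : I.parentNum (I.num a) = I.num (Order.pred a) := by
  simp [parentNum]

/-- The number of the lower end of the path `i`. -/
noncomputable def lowerNum (i : ℕ) : ℕ := if h : i < I.m then I.num (I.lower ⟨i, h⟩) else 0

/-- The number of the upper end of the path `i`. -/
noncomputable def upperNum (i : ℕ) : ℕ := if h : i < I.m then I.num (I.upper ⟨i, h⟩) else 0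

/-- The weight of the path `i`. -/
def weight (i : ℕ) : ℤ := if h : i < I.m then I.w ⟨i, h⟩ else 0

theorem anc_num (a b : I.T) : Anc I.parentNum (I.num a) (I.num b) ↔ b ≤ a := by
  have h : ∀ k, I.parentNum^[k] (I.num a) = I.num (Order.pred^[k] a) := by
    intro k
    induction k with
    | zero => rfl
    | succ k ih => rw [Function.iterate_succ_apply', Function.iterate_succ_apply', ih, parentNum_num]
  constructor
  · rintro ⟨k, hk⟩
    rw [h, Fin.val_inj, I.num.apply_eq_iff_eq] at hk
    rw [← hk]
    exact Order.pred_iterate_le k a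
  · intro hba
    obtain ⟨k, hk⟩ := hba.exists_pred_iterate
    exact ⟨k, by rw [h, hk]⟩

theorem exists_iterate_eq_bot (a : I.T) : ∃ k, Order.pred^[k] a = ⊥ :=
  (bot_le (a := a)).exists_pred_iterate

/-- The depth of the node with number `x`. -/
noncomputable def depth (x : ℕ) : ℕ :=
  if h : x < I.q then sInf {k | Order.pred^[k] (I.num.symm ⟨x, h⟩) = ⊥} else 0

theorem parentTree : ParentTree I.q I.parentNum (I.num ⊥) I.depth := by
  refine ⟨(I.num ⊥).2, by rw [parentNum_num, Order.pred_bot], fun x hx => ?_, fun x hx hne => ?_⟩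
  · rw [parentNum, dif_pos hx]
    exact (I.num _).2
  · obtain ⟨a, rfl⟩ : ∃ a, x = I.num a := ⟨I.num.symm ⟨x, hx⟩, by simp⟩
    have ha : a ≠ ⊥ := by
      rintro rfl
      exact hne rfl
    rw [parentNum_num]
    simp only [depth, Fin.is_lt, dif_pos, Fin.eta, Equiv.symm_apply_apply]
    have h1 : Order.pred^[sInf {k | Order.pred^[k] a = ⊥}] a = ⊥ :=
      Nat.sInf_mem (s := {k | Order.pred^[k] a = ⊥}) (I.exists_iterate_eq_bot a)
    cases hn : sInf {k | Order.pred^[k] a = ⊥} with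
    | zero =>
      rw [hn] at h1
      exact absurd h1 ha
    | succ n =>
      rw [hn] at h1
      exact Nat.lt_succ_of_le (Nat.sInf_le (s := {k | Order.pred^[k] (Order.pred a) = ⊥}) h1)

theorem covers_num (i : Fin I.m) (v : I.T) :
    Covers I.parentNum I.lowerNum I.upperNum i (I.num v) ↔ v ∈ I.path i := by
  simp only [Covers, lowerNum, upperNum, Fin.is_lt, dif_pos, Fin.eta, anc_num, path,
    Set.mem_ofPred_eq]
  constructor
  · rintro ⟨h1, h2⟩
    refine ⟨lt_of_le_not_ge ?_ h2, h1⟩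
    obtain h3 | h3 := ((I.anc_num _ _).2 h1).total ((I.anc_num _ _).2 (I.upper_le_lower i))
    · exact (I.anc_num _ _).1 h3
    · exact absurd ((I.anc_num _ _).1 h3) h2
  · rintro ⟨h1, h2⟩
    exact ⟨h2, not_le_of_gt h1⟩

theorem arrayOf_apply {n : ℕ} (f : Fin n → ℤ) {i : ℕ} (hi : i < n) : arrayOf f i = f ⟨i, hi⟩ := by
  simp [arrayOf, hi]

theorem abs_arrayOf_le {n : ℕ} {f : Fin n → ℤ} {B : ℤ} (hB : 0 ≤ B) (h : ∀ i, |f i| ≤ B) (j : ℤ) :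
    |arrayOf f j| ≤ B := by
  rw [arrayOf]
  split_ifs
  · exact h _
  · simpa using hB

theorem input_bounded {B : ℕ} (hq : I.q ≤ B) (hm : I.m ≤ B) (hw : ∀ i, |I.w i| ≤ B) :
    I.input.Bounded B := by
  have hB : (0 : ℤ) ≤ B := by positivity
  have hnum : ∀ a : I.T, |((I.num a : ℕ) : ℤ)| ≤ B := by
    intro a
    have := (I.num a).2
    rw [abs_of_nonneg (by positivity)]
    omega
  intro a j
  match a with
  | 0 =>
    refine abs_arrayOf_le (f := ![(I.q : ℤ), (I.m : ℤ)]) hB (fun i => ?_) j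
    fin_cases i <;> simpa
  | 1 =>
    simp only [input]
    exact abs_arrayOf_le hB (fun i => hnum _) j
  | 2 =>
    simp only [input]
    exact abs_arrayOf_le hB (fun i => hnum _) j
  | 3 =>
    simp only [input]
    exact abs_arrayOf_le hB (fun i => hnum _) j
  | 4 =>
    simp only [input]
    exact abs_arrayOf_le hB hw j
  | _ + 5 => simp [input]

theorem isSolution_of {M : Memory} (h : ∀ v < I.q,
      ((M 5 v = 0 ∧ ∀ i < I.m, ¬ Covers I.parentNum I.lowerNum I.upperNum i v) ∨
        (M 5 v ≠ 0 ∧ (∃ i < I.m, Covers I.parentNum I.lowerNum I.upperNum i v ∧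
          M 6 v = I.weight i) ∧
          ∀ i < I.m, Covers I.parentNum I.lowerNum I.upperNum i v → I.weight i ≤ M 6 v)) ∧
      M 7 v = ∑ i ∈ Finset.range I.m, open scoped Classical in
        if Covers I.parentNum I.lowerNum I.upperNum i v then I.weight i else 0) :
    I.IsSolution M := by
  classical
  intro v
  obtain ⟨hmax, hsum⟩ := h (I.num v) (I.num v).2
  have hweight : ∀ i : Fin I.m, I.weight i = I.w i := fun i => by simp [weight]
  constructor
  · rw [maxWeight]
    obtain ⟨h0, hnone⟩ | ⟨h0, ⟨i, hi, hcov, hval⟩, hle⟩ := hmax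
    · rw [if_pos h0, Finset.filter_eq_empty_iff.2, Finset.sup_empty]
      intro i _ hi
      exact hnone i i.2 ((I.covers_num i v).2 hi)
    · rw [if_neg h0]
      refine le_antisymm ?_ (Finset.sup_le fun j hj => ?_)
      · rw [hval, show I.weight i = I.w ⟨i, hi⟩ from hweight ⟨i, hi⟩]
        exact Finset.le_sup (f := fun i => ((I.w i : ℤ) : WithBot ℤ))
          (by simpa using (I.covers_num ⟨i, hi⟩ v).1 hcov)
      · rw [Finset.mem_filter] at hj
        have := hle j j.2 ((I.covers_num j v).2 hj.2)
        rw [hweight] at this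
        exact_mod_cast this
  · rw [hsum, sumWeight, Finset.sum_filter, Finset.sum_range]
    refine Finset.sum_congr rfl fun i _ => ?_
    rw [hweight]
    exact if_congr (I.covers_num i v) rfl rfl

end TreePathInstance

/-- One program solves all instances; for weights of absolute value at most `(q + m) ^ d` it runs
in `C * (q + m)` steps with words of `k * log₂ (q + m + 1)` bits (up to the sign), where `C` and `k`
depend on `d` only. -/
theorem mainTheorem7 :
    ∃ prog : WordRAM.Cmd, ∀ d : ℕ, ∃ C k : ℕ, ∀ I : TreePathInstance,
      (∀ i, |I.w i| ≤ ((I.q + I.m : ℕ) : ℤ) ^ d) →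
        ∃ (t : ℕ) (M : WordRAM.Memory),
          WordRAM.Exec ((I.q + I.m + 1) ^ k) prog I.input t M ∧
          t ≤ C * (I.q + I.m) ∧ I.IsSolution M := by
  refine ⟨WordRAM.treePath, fun d => ⟨2 * (300 * (d + 3) + 60000), d + 9, fun I hI => ?_⟩⟩
  have hT := I.parentTree
  have hq := hT.root_lt
  obtain ⟨N, hN⟩ : ∃ N, N = I.q + I.m + 1 := ⟨_, rfl⟩
  rw [← hN]
  have hN2 : 2 ≤ N := by omega
  have hpow : ∀ {a b : ℕ}, a ≤ b → N ^ a ≤ N ^ b := fun h => Nat.pow_le_pow_right (by omega) h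
  have hpow2 : ∀ a, 2 ^ a ≤ N ^ a := fun a => Nat.pow_le_pow_left hN2 a
  have hWd : (I.q + I.m) ^ d ≤ N ^ d := Nat.pow_le_pow_left (by omega) d
  have hNd : 0 < N ^ d := by positivity
  have h256 : 256 * N ≤ N ^ (d + 9) := by
    refine le_trans ?_ (hpow (show 9 ≤ d + 9 by omega))
    rw [pow_succ]
    exact Nat.mul_le_mul_right N (hpow2 8)
  have h32 : 32 * (N * N) ≤ N ^ (d + 9) := by
    refine le_trans ?_ (hpow (show 7 ≤ d + 9 by omega))
    rw [show N ^ 7 = N ^ 5 * (N * N) by ring]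
    exact Nat.mul_le_mul_right _ (hpow2 5)
  have hsum : 2 * I.m * (I.q + I.m) ^ d * (I.q + 1) ≤ N ^ (d + 9) := by
    refine le_trans ?_ (hpow (show d + 3 ≤ d + 9 by omega))
    calc 2 * I.m * (I.q + I.m) ^ d * (I.q + 1) ≤ N * N * N ^ d * N := by
          gcongr <;> omega
      _ = N ^ (d + 3) := by ring
  have hsort : 2 * (I.q + I.m) ^ d < N ^ (d + 2) := by
    calc 2 * (I.q + I.m) ^ d < N ^ d * 2 ^ 2 := by omega
      _ ≤ N ^ d * N ^ 2 := Nat.mul_le_mul_left _ (hpow2 2)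
      _ = N ^ (d + 2) := by ring
  have hweight : ∀ i, |I.w i| ≤ (((I.q + I.m) ^ d : ℕ) : ℤ) := by exact_mod_cast hI
  have hbound : I.input.Bounded (N ^ (d + 9)) := by
    refine I.input_bounded (by omega) (by omega) fun i => (hweight i).trans ?_
    exact_mod_cast hWd.trans (hpow (by omega))
  obtain ⟨t, M, hexec, htime, hsol⟩ := (WordRAM.treePath_spec (τ := 0) hN h256 h32 hsum (d + 2) hsort
    (hpow (by omega)) hT (lower := I.lowerNum) (upper := I.upperNum) (w := I.weight) (M := I.input)
    (fun i hi => by simp [TreePathInstance.lowerNum, hi])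
    (fun i hi => by simp [TreePathInstance.upperNum, hi])
    (fun i hi => by
      simp only [TreePathInstance.lowerNum, TreePathInstance.upperNum, hi, dif_pos]
      exact (I.anc_num _ _).2 (I.upper_le_lower _))
    (fun i hi => by
      simp only [TreePathInstance.weight, hi, dif_pos]
      exact hweight _)
    (by simp [TreePathInstance.input, WordRAM.arrayOf])
    (by simp [TreePathInstance.input, WordRAM.arrayOf])
    (fun x hx => by
      simp [TreePathInstance.input, TreePathInstance.arrayOf_apply, TreePathInstance.parentNum, hx])
    (fun i hi => by
      simp [TreePathInstance.input, TreePathInstance.arrayOf_apply, TreePathInstance.lowerNum, hi])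
    (fun i hi => by
      simp [TreePathInstance.input, TreePathInstance.arrayOf_apply, TreePathInstance.upperNum, hi])
    (fun i hi => by
      simp [TreePathInstance.input, TreePathInstance.arrayOf_apply, TreePathInstance.weight, hi])
    (fun a ha => by
      obtain ⟨a, rfl⟩ := Nat.exists_eq_add_of_le' ha
      rfl)).exec (by omega) hbound
  refine ⟨t, M, hexec, ?_, I.isSolution_of hsol⟩
  have h1 : t ≤ (300 * (d + 3) + 60000) * N := by simpa using htime
  refine h1.trans ?_
  rw [show 2 * (300 * (d + 3) + 60000) * (I.q + I.m) =
    (300 * (d + 3) + 60000) * (2 * (I.q + I.m)) by ring]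
  exact Nat.mul_le_mul_left _ (by omega)
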